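/- Let $\Bbbk$ be an algebraically closed field of characteristic zero (for instance $\Bbbk=\mathbb{C}$), $G$ a finite group, $\chi:G\to\Bbbk^\times$ a character, $g$ a central element of $G$, $n$ the order of $\chi(g)$, and $\mu\in\Bbbk$, such that $n\ge 2$, $\chi^n=1$ and $\mu(g^n-1)\neq 0$ in $\Bbbk G$. Let $H$ be the Hopf algebra generated by the group algebra $\Bbbk G$ and an element $y$ subject to $$y^n=\mu(g^n-1),\qquad yh=\chi(h)hy\quad(h\in G),$$ with $\Delta(h)=h\otimes h$, $\varepsilon(h)=1$, $S(h)=h^{-1}$ for $h\in G$ and $\Delta(y)=y\otimes g+1\otimes y$, $\varepsilon(y)=0$, $S(y)=-yg^{-1}$ (a pointed Hopf algebra of rank one of non-nilpotent type). Let $\{V_i\mid i\in\Omega\}$ be the (finite) complete set of simple $\Bbbk G$-modules up to isomorphism, and let $\Omega_0\subseteq\Omega$ be the set of those $i$ for which $g^n$ acts as the identity on $V_i$. For $i\in\Omega_0$ and $1\le j\le n-1$ let $M(j,i)=V_i\oplus xV_i\oplus\cdots\oplus x^{j-1}V_i$ be the $H$-module with $$h(x^kv)=\chi(h)^{-k}x^k(hv)\quad(h\in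 G),\qquad y(x^kv)=\begin{cases}x^{k+1}v,&0\le k\le j-2,\\0,&k=j-1,\end{cases}$$ and let $I=\{(j,i)\mid i\in\Omega_0,\ 1\le j\le n-1\}$. Let $r_{st}(H)$ be the stable Green ring of $H$, that is, the Green ring of the stable category of finite dimensional $H$-modules (module morphisms modulo those factoring through projective modules): it is generated by the classes $\overline{[M]}$ of finite dimensional $H$-modules $M$, where stably isomorphic modules have equal classes, with $\overline{[M\oplus N]}=\overline{[M]}+\overline{[N]}$, $\overline{[M\otimes N]}=\overline{[M]}\,\overline{[N]}$ and identity the class of the trivial module. Then the classes $\overline{M[j,i]}$ of the modules $M(j,i)$, $(j,i)\in I$, form a $\mathbb{Z}$-basis of $r_{st}(H)$. Define the Frobenius–Perron dimension $\mathrm{FPdim}(\overline{M[j,i]})$ of $M(j,i)$ in the stable category to be the maximal nonnegative eigenvalue of the matrix, with respect to this basis, of left multiplication by $\overline{M[j,i]}$. This maximum exists, and $$\mathrm{FPdim}(\overline{M[j,i]})=\dim(V_i)\,F_j\!\left(1,2\cos\tfrac{\pi}{n}\right)\qquad\text{for all }(j,i)\in I,$$ where $F_j$ is the $j$-th Dickson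 polynomial of the second type: $F_1(Y,Z)=1$, $F_2(Y,Z)=Z$ and $F_j(Y,Z)=ZF_{j-1}(Y,Z)-YF_{j-2}(Y,Z)$ for $j\ge 3$. -/

import Mathlib

open scoped TensorProduct

universe u v

/-! ### Group data -/

/-- A group datum `(G, χ, g, μ)`: `χ` a linear character of the finite group `G`, `g` central in `G`,
and `χ ^ n = 1` or `μ (g ^ n - 1) = 0` (in the group algebra), `n` being the order of `χ g`. -/
structure GroupDatum (K : Type u) (G : Type v) [Field K] [Group G] [Finite G] where
  χ : G →* Kˣ
  g : G
  g_mem_center : g ∈ Subgroup.center G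
  μ : K
  compat : χ ^ orderOf (χ g) = 1 ∨
    μ • (MonoidAlgebra.of K G (g ^ orderOf (χ g)) - 1) = (0 : MonoidAlgebra K G)

namespace GroupDatum

variable {K : Type u} {G : Type v} [Field K] [Group G] [Finite G] (D : GroupDatum K G)

/-- `n`, the order of `q = χ g`. -/
noncomputable def n : ℕ := orderOf (D.χ D.g)

/-- The group datum is of non-nilpotent type: `μ (g ^ n - 1) ≠ 0` and `χ ^ n = 1`. -/
def IsNonNilpotent : Prop :=
  D.μ • (MonoidAlgebra.of K G (D.g ^ D.n) - 1) ≠ (0 : MonoidAlgebra K G) ∧ D.χ ^ D.n = 1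

theorem g_comm (h : G) : D.g * h = h * D.g :=
  (Subgroup.mem_center_iff.mp D.g_mem_center h).symm

theorem n_pos : 0 < D.n := by
  have : IsOfFinOrder (D.χ D.g) := MonoidHom.isOfFinOrder D.χ (isOfFinOrder_of_finite D.g)
  exact this.orderOf_pos

/-! ### The algebra `H` attached to a group datum -/

/-- The algebra generators of `H`: the elements of `G` and `y`. -/
inductive Gen (G : Type v) : Type v
  | grp (h : G)
  | y

/-- The defining relations of `H`: those of the group algebra of `G`,
`y ^ n = μ (g ^ n - 1)`, and `y h = χ(h) h y`. -/
inductive Rel : FreeAlgebra K (Gen G) → FreeAlgebra K (Gen G) → Prop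
  | one : Rel (FreeAlgebra.ι K (.grp 1)) 1
  | mul (a b : G) : Rel (FreeAlgebra.ι K (.grp (a * b)))
      (FreeAlgebra.ι K (.grp a) * FreeAlgebra.ι K (.grp b))
  | y_pow : Rel (FreeAlgebra.ι K .y ^ D.n)
      (D.μ • (FreeAlgebra.ι K (.grp (D.g ^ D.n)) - 1))
  | y_mul (a : G) : Rel (FreeAlgebra.ι K .y * FreeAlgebra.ι K (.grp a))
      ((D.χ a : K) • (FreeAlgebra.ι K (.grp a) * FreeAlgebra.ι K .y))

/-- The algebra `H` of the group datum, by generators and relations. -/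
def H : Type max u v := RingQuot D.Rel

noncomputable instance : Ring D.H := inferInstanceAs (Ring (RingQuot D.Rel))

noncomputable instance : Algebra K D.H := inferInstanceAs (Algebra K (RingQuot D.Rel))

/-- The class of a group element in `H`. -/
noncomputable def ofG (a : G) : D.H := RingQuot.mkAlgHom K D.Rel (FreeAlgebra.ι K (.grp a))

/-- The generator `y` of `H`. -/
noncomputable def y : D.H := RingQuot.mkAlgHom K D.Rel (FreeAlgebra.ι K .y)

theorem ofG_one : D.ofG 1 = 1 :=
  (RingQuot.mkAlgHom_rel K (Rel.one (D := D))).trans (map_one _)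

theorem ofG_mul (a b : G) : D.ofG (a * b) = D.ofG a * D.ofG b :=
  (RingQuot.mkAlgHom_rel K (Rel.mul (D := D) a b)).trans (map_mul _ _ _)

theorem y_pow_n : D.y ^ D.n = D.μ • (D.ofG (D.g ^ D.n) - 1) := by
  have := RingQuot.mkAlgHom_rel K (Rel.y_pow (D := D))
  rw [map_pow, map_smul, map_sub, map_one] at this
  exact this

theorem y_mul_ofG (a : G) : D.y * D.ofG a = (D.χ a : K) • (D.ofG a * D.y) := by
  have := RingQuot.mkAlgHom_rel K (Rel.y_mul (D := D) a)
  rw [map_mul, map_smul, map_mul] at this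
  exact this

section lift

variable {B : Type*} [Ring B] [Algebra K B]

/-- The universal property of `H`. -/
noncomputable def lift (f : G →* B) (Y : B) (hpow : Y ^ D.n = D.μ • (f (D.g ^ D.n) - 1))
    (hmul : ∀ a, Y * f a = (D.χ a : K) • (f a * Y)) : D.H →ₐ[K] B :=
  RingQuot.liftAlgHom K ⟨FreeAlgebra.lift K (fun x => match x with | .grp a => f a | .y => Y), by
    intro a b h
    induction h with
    | one => simp
    | mul a b => simp
    | y_pow => simpa using hpow
    | y_mul a => simpa using hmul a⟩

variable (f : G →* B) (Y : B) (hpow : Y ^ D.n = D.μ • (f (D.g ^ D.n) - 1))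
  (hmul : ∀ a, Y * f a = (D.χ a : K) • (f a * Y))

@[simp] theorem lift_ofG (a : G) : D.lift f Y hpow hmul (D.ofG a) = f a := by
  refine (RingQuot.liftAlgHom_mkAlgHom_apply K _ _ _).trans ?_
  simp

@[simp] theorem lift_y : D.lift f Y hpow hmul D.y = Y := by
  refine (RingQuot.liftAlgHom_mkAlgHom_apply K _ _ _).trans ?_
  simp

end lift

theorem algHom_ext {B : Type*} [Semiring B] [Algebra K B] {φ ψ : D.H →ₐ[K] B}
    (hG : ∀ a, φ (D.ofG a) = ψ (D.ofG a)) (hy : φ D.y = ψ D.y) : φ = ψ := by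
  apply RingQuot.ringQuot_ext'
  apply FreeAlgebra.hom_ext
  funext x
  cases x with
  | grp a => exact hG a
  | y => exact hy

/-- `G → H` as a monoid homomorphism. -/
noncomputable def ofGHom : G →* D.H where
  toFun := D.ofG
  map_one' := D.ofG_one
  map_mul' := D.ofG_mul

@[simp] theorem ofGHom_apply (a : G) : D.ofGHom a = D.ofG a := rfl

/-! ### Powers of `a + b` when `b a = q a b` -/

/-- Gaussian binomial coefficients. -/
def gauss (q : K) : ℕ → ℕ → K
  | _, 0 => 1
  | 0, _ + 1 => 0
  | m + 1, k + 1 => gauss q m k + q ^ (k + 1) * gauss q m (k + 1)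

theorem gauss_eq_zero_of_lt (q : K) : ∀ m k, m < k → gauss q m k = 0
  | _, 0, h => by omega
  | 0, _ + 1, _ => rfl
  | m + 1, k + 1, h => by
    rw [gauss, gauss_eq_zero_of_lt q m k (by omega), gauss_eq_zero_of_lt q m (k + 1) (by omega)]
    simp

theorem gauss_self (q : K) : ∀ m, gauss q m m = 1
  | 0 => rfl
  | m + 1 => by rw [gauss, gauss_self q m, gauss_eq_zero_of_lt q m (m + 1) (by omega)]; simp

theorem gauss_rec (q : K) : ∀ m k,
    gauss q m (k + 1) * (q ^ (k + 1) - 1) * q ^ k = gauss q m k * (q ^ m - q ^ k)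
  | 0, 0 => by simp [gauss]
  | 0, k + 1 => by simp [gauss]
  | m + 1, 0 => by
    have h := gauss_rec q m 0
    simp only [gauss] at h ⊢
    linear_combination q * h
  | m + 1, k + 1 => by
    have h1 := gauss_rec q m (k + 1)
    have h0 := gauss_rec q m k
    simp only [gauss] at h1 h0 ⊢
    linear_combination q ^ (k + 2) * h1 + q * h0

theorem gauss_primitive {q : K} {m : ℕ} (hq : orderOf q = m) : ∀ k, 0 < k → k < m →
    gauss q m k = 0
  | 0, h, _ => by omega
  | k + 1, _, hk => by
    have hm : q ^ m = 1 := hq ▸ pow_orderOf_eq_one q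
    have hq0 : q ≠ 0 := by
      rintro rfl
      rw [zero_pow (by omega)] at hm
      exact zero_ne_one hm
    have h1 : q ^ (k + 1) - 1 ≠ 0 := fun h =>
      pow_ne_one_of_lt_orderOf (x := q) (n := k + 1) (by omega) (by omega) (sub_eq_zero.mp h)
    have hr := gauss_rec q m k
    have hz : gauss q m k * (q ^ m - q ^ k) = 0 := by
      rcases Nat.eq_zero_or_pos k with rfl | hk0
      · simp [hm]
      · rw [gauss_primitive hq k hk0 (by omega), zero_mul]
    rw [hz] at hr
    rcases mul_eq_zero.mp hr with h | h
    · exact (mul_eq_zero.mp h).resolve_right h1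
    · exact absurd h (pow_ne_zero _ hq0)

section qbinom

variable {B : Type*} [Ring B] [Algebra K B] {a b : B} {q : K}

theorem mul_pow_of_qcomm (h : b * a = q • (a * b)) (k : ℕ) : b * a ^ k = q ^ k • (a ^ k * b) := by
  induction k with
  | zero => simp
  | succ k ih =>
    rw [pow_succ, ← mul_assoc, ih, smul_mul_assoc, mul_assoc, h, mul_smul_comm, smul_smul,
      ← mul_assoc, pow_succ]

theorem add_pow_gauss (h : b * a = q • (a * b)) (m : ℕ) :
    (a + b) ^ m = ∑ k ∈ Finset.range (m + 1), gauss q m k • (a ^ k * b ^ (m - k)) := by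
  induction m with
  | zero => simp [gauss]
  | succ m ih =>
    have e1 : ∀ k ∈ Finset.range (m + 1), b * (gauss q m k • (a ^ k * b ^ (m - k))) =
        (q ^ k * gauss q m k) • (a ^ k * b ^ (m + 1 - k)) := by
      intro k hk
      have hk' : m + 1 - k = (m - k) + 1 := by have := Finset.mem_range.mp hk; omega
      rw [mul_smul_comm, ← mul_assoc, mul_pow_of_qcomm h, smul_mul_assoc, smul_smul, mul_assoc,
        ← pow_succ', hk', mul_comm]
    have e2 : ∀ k ∈ Finset.range (m + 1), a * (gauss q m k • (a ^ k * b ^ (m - k))) =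
        gauss q m k • (a ^ (k + 1) * b ^ (m + 1 - (k + 1))) := by
      intro k _
      rw [mul_smul_comm, ← mul_assoc, ← pow_succ', Nat.add_sub_add_right]
    rw [pow_succ', ih, add_mul, Finset.mul_sum, Finset.mul_sum, Finset.sum_congr rfl e1,
      Finset.sum_congr rfl e2, Finset.sum_range_succ' _ (m + 1),
      Finset.sum_range_succ' (fun k => (q ^ k * gauss q m k) • (a ^ k * b ^ (m + 1 - k))) m]
    have e3 : ∑ k ∈ Finset.range (m + 1),
        (q ^ (k + 1) * gauss q m (k + 1)) • (a ^ (k + 1) * b ^ (m + 1 - (k + 1))) =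
        ∑ k ∈ Finset.range m,
        (q ^ (k + 1) * gauss q m (k + 1)) • (a ^ (k + 1) * b ^ (m + 1 - (k + 1))) := by
      rw [Finset.sum_range_succ, gauss_eq_zero_of_lt q m (m + 1) (by omega)]
      simp
    rw [← e3, ← add_assoc, ← Finset.sum_add_distrib]
    simp [gauss, add_smul]

theorem add_pow_orderOf (h : b * a = q • (a * b)) {m : ℕ} (hq : orderOf q = m) (hm : 0 < m) :
    (a + b) ^ m = a ^ m + b ^ m := by
  obtain ⟨m, rfl⟩ : ∃ k, m = k + 1 := ⟨m - 1, by omega⟩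
  rw [add_pow_gauss h, Finset.sum_range_succ, Finset.sum_range_succ', Finset.sum_eq_zero]
  · rw [gauss_self]
    simp [gauss, add_comm]
  · intro k hk
    rw [gauss_primitive hq (k + 1) (by omega) (by have := Finset.mem_range.mp hk; omega), zero_smul]

end qbinom

theorem orderOf_q : orderOf (D.χ D.g : K) = D.n := orderOf_units

/-! ### The Hopf algebra structure of `H` -/

/-- `Δ(h) = h ⊗ h`, `Δ(y) = y ⊗ g + 1 ⊗ y`. -/
noncomputable def comulHom : D.H →ₐ[K] D.H ⊗[K] D.H :=
  D.lift
    { toFun := fun a => D.ofG a ⊗ₜ[K] D.ofG a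
      map_one' := by rw [ofG_one]; rfl
      map_mul' := fun a b => by rw [ofG_mul, Algebra.TensorProduct.tmul_mul_tmul] }
    (D.y ⊗ₜ[K] D.ofG D.g + 1 ⊗ₜ[K] D.y)
    (by
      have hc : ((1 : D.H) ⊗ₜ[K] D.y) * (D.y ⊗ₜ[K] D.ofG D.g) =
          (D.χ D.g : K) • ((D.y ⊗ₜ[K] D.ofG D.g) * ((1 : D.H) ⊗ₜ[K] D.y)) := by
        simp only [Algebra.TensorProduct.tmul_mul_tmul, one_mul, mul_one, y_mul_ofG]
        rw [TensorProduct.tmul_smul]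
      rw [add_pow_orderOf hc D.orderOf_q D.n_pos, Algebra.TensorProduct.tmul_pow,
        Algebra.TensorProduct.tmul_pow, one_pow, y_pow_n, ← ofGHom_apply, ← ofGHom_apply, ← map_pow]
      simp only [MonoidHom.coe_mk, OneHom.coe_mk, ofGHom_apply, Algebra.TensorProduct.one_def]
      rw [← TensorProduct.smul_tmul', TensorProduct.tmul_smul, ← smul_add,
        TensorProduct.sub_tmul, TensorProduct.tmul_sub]
      congr 1
      abel)
    (fun a => by
      simp only [MonoidHom.coe_mk, OneHom.coe_mk, add_mul, mul_add,
        Algebra.TensorProduct.tmul_mul_tmul, one_mul, mul_one, y_mul_ofG, smul_add,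
        TensorProduct.smul_tmul', TensorProduct.tmul_smul, ← ofG_mul, D.g_comm])

/-- `ε(h) = 1`, `ε(y) = 0`. -/
noncomputable def counitHom : D.H →ₐ[K] K :=
  D.lift 1 0 (by simp [D.n_pos.ne']) (by simp)

@[simp] theorem comulHom_ofG (a : G) : D.comulHom (D.ofG a) = D.ofG a ⊗ₜ[K] D.ofG a := by
  simp [comulHom]

@[simp] theorem comulHom_y :
    D.comulHom D.y = D.y ⊗ₜ[K] D.ofG D.g + 1 ⊗ₜ[K] D.y := by
  simp [comulHom]

@[simp] theorem counitHom_ofG (a : G) : D.counitHom (D.ofG a) = 1 := by simp [counitHom]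

@[simp] theorem counitHom_y : D.counitHom D.y = 0 := by simp [counitHom]

noncomputable instance : Bialgebra K D.H :=
  Bialgebra.ofAlgHom D.comulHom D.counitHom
    (D.algHom_ext (fun a => by simp) (by
      simp [TensorProduct.add_tmul, TensorProduct.tmul_add, Algebra.TensorProduct.one_def,
        add_assoc]))
    (D.algHom_ext (fun a => by simp) (by simp))
    (D.algHom_ext (fun a => by simp) (by simp))

@[simp] theorem comul_apply (x : D.H) : Coalgebra.comul (R := K) x = D.comulHom x := rfl

@[simp] theorem counit_apply (x : D.H) : Coalgebra.counit (R := K) x = D.counitHom x := rfl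

theorem prod_neg_pow {q : K} {m : ℕ} (hq : orderOf q = m) (hm : 0 < m) :
    ∏ i ∈ Finset.range m, (-q ^ i) = -1 := by
  have hqm : q ^ m = 1 := hq ▸ pow_orderOf_eq_one q
  have hsum := Finset.sum_range_id_mul_two m
  rw [Finset.prod_neg, Finset.card_range, Finset.prod_pow_eq_pow_sum]
  rcases Nat.even_or_odd' m with ⟨k, rfl | rfl⟩
  · obtain ⟨l, rfl⟩ : ∃ l, k = l + 1 := ⟨k - 1, by omega⟩
    have h2 : q ^ (l + 1) = -1 := by
      have h3 : q ^ (l + 1) ≠ 1 := pow_ne_one_of_lt_orderOf (by omega) (by omega)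
      have h4 : (q ^ (l + 1)) * (q ^ (l + 1)) = 1 := by rw [← pow_add, ← two_mul, hqm]
      exact (mul_self_eq_one_iff.mp h4).resolve_left h3
    have h5 : ∑ i ∈ Finset.range (2 * (l + 1)), i = (l + 1) * (2 * l + 1) := by
      have : 2 * (l + 1) - 1 = 2 * l + 1 := by omega
      rw [this] at hsum
      nlinarith
    rw [h5, pow_mul q, h2, pow_mul, neg_one_sq, one_pow, one_mul, pow_succ, pow_mul, neg_one_sq,
      one_pow, one_mul]
  · have h5 : ∑ i ∈ Finset.range (2 * k + 1), i = (2 * k + 1) * k := by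
      rw [Nat.add_sub_cancel] at hsum
      nlinarith
    rw [h5, pow_mul q, hqm, one_pow, mul_one, pow_succ, pow_mul, neg_one_sq, one_pow, one_mul]

theorem smul_y_pow (k : ℕ) : (-(D.y * D.ofG D.g⁻¹)) ^ k =
    (∏ i ∈ Finset.range k, (-(D.χ D.g : K) ^ i)) • (D.y ^ k * D.ofG (D.g⁻¹ ^ k)) := by
  have h : D.ofG D.g⁻¹ * D.y = (D.χ D.g : K) • (D.y * D.ofG D.g⁻¹) := by
    rw [y_mul_ofG, smul_smul, map_inv, Units.mul_inv, one_smul]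
  induction k with
  | zero => simp [ofG_one]
  | succ k ih =>
    rw [pow_succ', ih, neg_mul, mul_smul_comm, mul_assoc, ← mul_assoc (D.ofG D.g⁻¹),
      mul_pow_of_qcomm h, smul_mul_assoc, mul_smul_comm, smul_smul, Finset.prod_range_succ, mul_assoc,
      ← ofG_mul, ← mul_assoc, ← pow_succ', ← pow_succ', mul_neg, neg_smul]

/-- The anti-homomorphism `S(h) = h⁻¹`, `S(y) = -y g⁻¹`. -/
noncomputable def antipodeHom : D.H →ₐ[K] D.Hᵐᵒᵖ :=
  D.lift
    { toFun := fun a => MulOpposite.op (D.ofG a⁻¹)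
      map_one' := by rw [inv_one, ofG_one]; rfl
      map_mul' := fun a b => by rw [mul_inv_rev, ofG_mul]; rfl }
    (MulOpposite.op (-(D.y * D.ofG D.g⁻¹)))
    (by
      rw [← MulOpposite.op_pow, smul_y_pow, prod_neg_pow D.orderOf_q D.n_pos, y_pow_n]
      simp only [MonoidHom.coe_mk, OneHom.coe_mk]
      rw [← MulOpposite.op_one, ← MulOpposite.op_sub, ← MulOpposite.op_smul]
      congr 1
      rw [smul_mul_assoc, sub_mul, ← ofG_mul, inv_pow, mul_inv_cancel, ofG_one, one_mul, neg_smul,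
        one_smul, ← smul_neg, neg_sub])
    (fun a => by
      simp only [MonoidHom.coe_mk, OneHom.coe_mk]
      rw [← MulOpposite.op_mul, ← MulOpposite.op_mul, ← MulOpposite.op_smul]
      congr 1
      have h1 : D.g⁻¹ * a⁻¹ = a⁻¹ * D.g⁻¹ := by
        rw [← mul_inv_rev, ← mul_inv_rev, D.g_comm]
      rw [neg_mul, mul_assoc D.y, ← ofG_mul, h1, ofG_mul, ← mul_assoc D.y, D.y_mul_ofG a⁻¹, map_inv,
        smul_mul_assoc, smul_neg, smul_smul, Units.mul_inv, one_smul, mul_neg, mul_assoc])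

/-- The antipode of `H`. -/
noncomputable def antipodeLin : D.H →ₗ[K] D.H :=
  (MulOpposite.opLinearEquiv K).symm.toLinearMap ∘ₗ D.antipodeHom.toLinearMap

@[simp] theorem antipodeLin_ofG (a : G) : D.antipodeLin (D.ofG a) = D.ofG a⁻¹ := by
  simp [antipodeLin, antipodeHom]

@[simp] theorem antipodeLin_y : D.antipodeLin D.y = -(D.y * D.ofG D.g⁻¹) := by
  simp [antipodeLin, antipodeHom]

theorem antipodeLin_one : D.antipodeLin 1 = 1 := by
  simp [antipodeLin]

theorem antipodeLin_mul (a b : D.H) :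
    D.antipodeLin (a * b) = D.antipodeLin b * D.antipodeLin a := by
  simp [antipodeLin]

theorem ofG_inv_mul (a : G) : D.ofG a⁻¹ * D.ofG a = 1 := by
  rw [← ofG_mul, inv_mul_cancel, ofG_one]

theorem ofG_mul_inv (a : G) : D.ofG a * D.ofG a⁻¹ = 1 := by
  rw [← ofG_mul, mul_inv_cancel, ofG_one]

theorem induction {P : D.H → Prop} (hs : ∀ c : K, P (algebraMap K D.H c))
    (hG : ∀ a, P (D.ofG a)) (hy : P D.y) (hm : ∀ a b, P a → P b → P (a * b))
    (ha : ∀ a b, P a → P b → P (a + b)) (x : D.H) : P x := by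
  obtain ⟨x, rfl⟩ := RingQuot.mkAlgHom_surjective K D.Rel x
  induction x using FreeAlgebra.induction with
  | grade0 c => rw [AlgHom.commutes]; exact hs c
  | grade1 t =>
    cases t with
    | grp a => exact hG a
    | y => exact hy
  | mul a b h1 h2 => rw [map_mul]; exact hm _ _ h1 h2
  | add a b h1 h2 => rw [map_add]; exact ha _ _ h1 h2

theorem antipode_left (x : D.H) :
    LinearMap.mul' K D.H (D.antipodeLin.rTensor D.H (D.comulHom x)) =
      algebraMap K D.H (D.counitHom x) := by
  have key : ∀ (t : D.H ⊗[K] D.H) (u v : D.H),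
      LinearMap.mul' K D.H (D.antipodeLin.rTensor D.H (t * (u ⊗ₜ[K] v))) =
      D.antipodeLin u * LinearMap.mul' K D.H (D.antipodeLin.rTensor D.H t) * v := by
    intro t u v
    induction t with
    | zero => simp
    | tmul a b => simp [antipodeLin_mul, mul_assoc]
    | add a b h1 h2 => rw [add_mul, map_add, map_add, h1, h2, map_add, map_add, mul_add, add_mul]
  have key2 : ∀ (c : K) (t w : D.H ⊗[K] D.H),
      LinearMap.mul' K D.H (D.antipodeLin.rTensor D.H t) = algebraMap K D.H c →
      LinearMap.mul' K D.H (D.antipodeLin.rTensor D.H (t * w)) =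
      algebraMap K D.H c * LinearMap.mul' K D.H (D.antipodeLin.rTensor D.H w) := by
    intro c t w h
    induction w with
    | zero => simp
    | tmul a b => rw [key, h, ← Algebra.commutes, mul_assoc]; simp
    | add a b h1 h2 => rw [mul_add, map_add, map_add, h1, h2, map_add, map_add, mul_add]
  induction x using D.induction with
  | hs c => simp [Algebra.TensorProduct.one_def, Algebra.algebraMap_eq_smul_one,
      antipodeLin_one]
  | hG a => simp [ofG_inv_mul]
  | hy => simp [antipodeLin_one, mul_assoc, ofG_inv_mul]
  | hm a b h1 h2 => rw [map_mul, key2 _ _ _ h1, h2, map_mul, map_mul]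
  | ha a b h1 h2 => simp only [map_add, h1, h2]

theorem antipode_right (x : D.H) :
    LinearMap.mul' K D.H (D.antipodeLin.lTensor D.H (D.comulHom x)) =
      algebraMap K D.H (D.counitHom x) := by
  have key : ∀ (t : D.H ⊗[K] D.H) (u v : D.H),
      LinearMap.mul' K D.H (D.antipodeLin.lTensor D.H ((u ⊗ₜ[K] v) * t)) =
      u * LinearMap.mul' K D.H (D.antipodeLin.lTensor D.H t) * D.antipodeLin v := by
    intro t u v
    induction t with
    | zero => simp
    | tmul a b => simp [antipodeLin_mul, mul_assoc]
    | add a b h1 h2 => rw [mul_add, map_add, map_add, h1, h2, map_add, map_add, mul_add, add_mul]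
  have key2 : ∀ (c : K) (t w : D.H ⊗[K] D.H),
      LinearMap.mul' K D.H (D.antipodeLin.lTensor D.H t) = algebraMap K D.H c →
      LinearMap.mul' K D.H (D.antipodeLin.lTensor D.H (w * t)) =
      LinearMap.mul' K D.H (D.antipodeLin.lTensor D.H w) * algebraMap K D.H c := by
    intro c t w h
    induction w with
    | zero => simp
    | tmul a b => rw [key, h, mul_assoc, Algebra.commutes, ← mul_assoc]; simp
    | add a b h1 h2 => rw [add_mul, map_add, map_add, h1, h2, map_add, map_add, add_mul]
  induction x using D.induction with
  | hs c => simp [Algebra.TensorProduct.one_def, Algebra.algebraMap_eq_smul_one,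
      antipodeLin_one]
  | hG a => simp [ofG_mul_inv]
  | hy => simp
  | hm a b h1 h2 => rw [map_mul, key2 _ _ _ h2, h1, map_mul, map_mul]
  | ha a b h1 h2 => simp only [map_add, h1, h2]

noncomputable instance : HopfAlgebra K D.H where
  antipode := D.antipodeLin
  mul_antipode_rTensor_comul := LinearMap.ext fun x => D.antipode_left x
  mul_antipode_lTensor_comul := LinearMap.ext fun x => D.antipode_right x

end GroupDatum

/-! ### Finite dimensional modules over a bialgebra -/

/-- A finite dimensional left module over the `K`-algebra `A`. -/
structure FDModule (K : Type u) (A : Type v) [Field K] [Ring A] [Algebra K A] where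
  carrier : Type u
  [addCommGroup : AddCommGroup carrier]
  [moduleBase : Module K carrier]
  [module : Module A carrier]
  [isScalarTower : IsScalarTower K A carrier]
  [finiteDimensional : FiniteDimensional K carrier]

namespace FDModule

attribute [instance] addCommGroup moduleBase module isScalarTower finiteDimensional

variable {K : Type u} {A : Type v} [Field K] [Ring A]

instance [Algebra K A] : CoeSort (FDModule K A) (Type u) := ⟨carrier⟩

/-- The `A`-module given by a `K`-vector space `V` and an algebra morphism `A → End_K V`. -/
def ofAct [Algebra K A] (V : Type u) [AddCommGroup V] [Module K V] [FiniteDimensional K V]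
    (act : A →ₐ[K] Module.End K V) : FDModule K A :=
  letI m : Module A V := Module.compHom V act.toRingHom
  haveI : IsScalarTower K A V := ⟨fun c a x => by
    change act (c • a) x = c • act a x
    rw [map_smul, LinearMap.smul_apply]⟩
  { carrier := V }

/-- The direct sum of two modules. -/
def directSum [Algebra K A] (M N : FDModule K A) : FDModule K A where
  carrier := M × N

/-- The tensor product `M ⊗ N` over `K`, with `A` acting through the comultiplication. -/
noncomputable def tensor [Bialgebra K A] (M N : FDModule K A) : FDModule K A :=
  ofAct (M ⊗[K] N)
    (Module.endTensorEndAlgHom.comp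
      ((Algebra.TensorProduct.map (Algebra.lsmul K K M) (Algebra.lsmul K K N)).comp
        (Bialgebra.comulAlgHom K A)))

/-- The trivial module `K`, with `A` acting through the counit. -/
noncomputable def trivial (K : Type u) (A : Type v) [Field K] [Ring A] [Bialgebra K A] :
    FDModule K A :=
  ofAct K ((Algebra.lsmul K K K).comp (Bialgebra.counitAlgHom K A))

/-! ### The stable category and its Green ring -/

/-- The morphism `f` factors through a finite dimensional projective module. -/
def FactorsThroughProjective [Algebra K A] {M N : FDModule K A} (f : M →ₗ[A] N) : Prop :=
  ∃ P : FDModule K A, Module.Projective A P ∧ ∃ (a : M →ₗ[A] P) (b : P →ₗ[A] N), f = b ∘ₗ a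

/-- `M` and `N` are isomorphic in the stable category, whose objects are the finite dimensional
modules and whose morphisms are the module morphisms modulo those that factor through a projective:
there are morphisms `M → N` and `N → M` that are mutually inverse modulo such morphisms. -/
def StablyIso [Algebra K A] (M N : FDModule K A) : Prop :=
  ∃ (f : M →ₗ[A] N) (f' : N →ₗ[A] M),
    FactorsThroughProjective (f' ∘ₗ f - LinearMap.id) ∧
    FactorsThroughProjective (f ∘ₗ f' - LinearMap.id)

end FDModule

/-- The defining relations of the stable Green ring, on the symbols `[M]`: isomorphic objects of
the stable category have the same class, `[M ⊕ N] = [M] + [N]`, `[M ⊗ N] = [M] [N]`, and the trivial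
module is the identity. -/
inductive StableGreenRel (K : Type u) (A : Type v) [Field K] [Ring A] [Bialgebra K A] :
    FreeAlgebra ℤ (FDModule K A) → FreeAlgebra ℤ (FDModule K A) → Prop
  | iso {M N : FDModule K A} (h : M.StablyIso N) :
      StableGreenRel K A (FreeAlgebra.ι ℤ M) (FreeAlgebra.ι ℤ N)
  | directSum (M N : FDModule K A) : StableGreenRel K A
      (FreeAlgebra.ι ℤ (M.directSum N)) (FreeAlgebra.ι ℤ M + FreeAlgebra.ι ℤ N)
  | tensor (M N : FDModule K A) : StableGreenRel K A
      (FreeAlgebra.ι ℤ (M.tensor N)) (FreeAlgebra.ι ℤ M * FreeAlgebra.ι ℤ N)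
  | trivial : StableGreenRel K A (FreeAlgebra.ι ℤ (FDModule.trivial K A)) 1

/-- The stable Green ring `r_st(A)`, i.e. the Green ring of the stable category of `A`. -/
def StableGreenRing (K : Type u) (A : Type v) [Field K] [Ring A] [Bialgebra K A] :
    Type max (u + 1) v :=
  RingQuot (StableGreenRel K A)

namespace StableGreenRing

variable {K : Type u} {A : Type v} [Field K] [Ring A] [Bialgebra K A]

noncomputable instance : Ring (StableGreenRing K A) :=
  inferInstanceAs (Ring (RingQuot (StableGreenRel K A)))

/-- The class of a module in the stable Green ring. -/
noncomputable def cls (M : FDModule K A) : StableGreenRing K A :=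
  RingQuot.mkRingHom (StableGreenRel K A) (FreeAlgebra.ι ℤ M)

end StableGreenRing

/-- `d` is the maximal nonnegative (real) eigenvalue of the integer matrix of left multiplication
by `x` with respect to the `ℤ`-basis `b` of the ring `R`. -/
def IsFPdim {R I : Type*} [Ring R] [Finite I] (b : Module.Basis I ℤ R) (x : R) (d : ℝ) : Prop :=
  letI := Fintype.ofFinite I
  letI := Classical.decEq I
  IsGreatest {t : ℝ | 0 ≤ t ∧ Module.End.HasEigenvalue
    (Matrix.toLin' ((Algebra.leftMulMatrix b x).map (Int.cast : ℤ → ℝ))) t} d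

/-! ### Dickson polynomials of the second type -/

/-- The value `F_j(Y, Z)` of the `j`-th Dickson polynomial of the second type, numbered from `1`;
the three lemmas below are its recursive definition. -/
noncomputable def dicksonF {R : Type*} [CommRing R] (j : ℕ) (Y Z : R) : R :=
  (Polynomial.dickson 2 Y (j - 1)).eval Z

theorem dicksonF_one {R : Type*} [CommRing R] (Y Z : R) : dicksonF 1 Y Z = 1 := by
  simp [dicksonF]
  norm_num

theorem dicksonF_two {R : Type*} [CommRing R] (Y Z : R) : dicksonF 2 Y Z = Z := by
  simp [dicksonF]

theorem dicksonF_rec {R : Type*} [CommRing R] (Y Z : R) (j : ℕ) (hj : 3 ≤ j) :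
    dicksonF j Y Z = Z * dicksonF (j - 1) Y Z - Y * dicksonF (j - 2) Y Z := by
  obtain ⟨k, rfl⟩ : ∃ k, j = k + 3 := ⟨j - 3, by omega⟩
  have e1 : k + 3 - 1 = k + 2 := by omega
  have e2 : k + 2 - 1 = k + 1 := by omega
  have e3 : k + 3 - 2 - 1 = k := by omega
  simp only [dicksonF, e1, e2, e3, Polynomial.dickson_add_two]
  simp

/-! ### The modules `M(j, i)` -/

/-- The family `ρ` is a complete set of simple `K G`-modules up to isomorphism: its members are
simple and pairwise non-isomorphic, and each simple module is isomorphic to one of them. -/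
def IsCompleteSimpleSet {K : Type u} {G : Type v} [Field K] [Group G] {Ω : Type*} {V : Ω → Type u}
    [∀ i, AddCommGroup (V i)] [∀ i, Module K (V i)] (ρ : ∀ i, Representation K G (V i)) : Prop :=
  (∀ i, (ρ i).IsIrreducible) ∧
  (∀ i i', Nonempty ((ρ i).Equiv (ρ i')) → i = i') ∧
  ∀ (W : Type u) [AddCommGroup W] [Module K W] [FiniteDimensional K W]
    (σ : Representation K G W), σ.IsIrreducible → ∃ i, Nonempty (σ.Equiv (ρ i))

namespace GroupDatum

variable {K : Type u} {G : Type v} [Field K] [Group G] [Finite G] (D : GroupDatum K G)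

section M

variable {V : Type u} [AddCommGroup V] [Module K V]

/-- The action `h (x ^ k v) = χ(h) ^ (-k) x ^ k (h v)` of `G` on `V ⊕ x V ⊕ ⋯ ⊕ x ^ (j - 1) V`; the
element `∑ x ^ k v_k` is the function `k ↦ v_k`. -/
def actG (ρ : Representation K G V) (j : ℕ) : G →* Module.End K (Fin j → V) where
  toFun h := LinearMap.pi fun k =>
    (((D.χ h)⁻¹ ^ (k : ℕ) : Kˣ) : K) • (ρ h ∘ₗ LinearMap.proj k)
  map_one' := by
    ext
    simp
  map_mul' a b := by
    refine LinearMap.ext fun f => funext fun k => ?_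
    simp only [LinearMap.pi_apply, LinearMap.smul_apply, LinearMap.comp_apply, LinearMap.proj_apply,
      Module.End.mul_apply, map_mul, map_smul, smul_smul, mul_inv, mul_pow, Units.val_mul]

/-- The action of `y` on `V ⊕ x V ⊕ ⋯ ⊕ x ^ (j - 1) V`: `x ^ k v ↦ x ^ (k + 1) v` for
`k ≤ j - 2` and `x ^ (j - 1) v ↦ 0`. -/
def actY (K : Type u) [Field K] (V : Type u) [AddCommGroup V] [Module K V] (j : ℕ) :
    Module.End K (Fin j → V) :=
  LinearMap.pi fun k =>
    if (k : ℕ) = 0 then 0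
    else LinearMap.proj (⟨k - 1, lt_of_le_of_lt (Nat.sub_le _ _) k.2⟩ : Fin j)

theorem actY_apply (j : ℕ) (f : Fin j → V) (k : Fin j) : actY K V j f k =
    if (k : ℕ) = 0 then 0 else f ⟨k - 1, lt_of_le_of_lt (Nat.sub_le _ _) k.2⟩ := by
  simp only [actY, LinearMap.pi_apply]
  split_ifs <;> simp

theorem actY_single (j : ℕ) (k : Fin j) (v : V) : actY K V j (Pi.single k v) =
    if h : (k : ℕ) + 1 < j then Pi.single ⟨k + 1, h⟩ v else 0 := by
  funext l
  rw [actY_apply]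
  split_ifs with h1 h2 h2
  · rw [Pi.single_eq_of_ne]
    intro h
    rw [h] at h1
    simp at h1
  · rfl
  · simp only [Pi.single_apply, Fin.ext_iff]
    congr 1
    simp only [eq_iff_iff]
    omega
  · rw [Pi.single_eq_of_ne, Pi.zero_apply]
    intro h
    have := l.2
    simp only [Fin.ext_iff] at h
    omega

theorem actY_pow_apply (j m : ℕ) (f : Fin j → V) (k : Fin j) : (actY K V j ^ m) f k =
    if (k : ℕ) < m then 0 else f ⟨k - m, lt_of_le_of_lt (Nat.sub_le _ _) k.2⟩ := by
  induction m generalizing k with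
  | zero => simp
  | succ m ih =>
    rw [pow_succ', Module.End.mul_apply, actY_apply]
    split_ifs with h1 h2 h2
    · rfl
    · omega
    · rw [ih, if_pos (by simp; omega)]
    · rw [ih, if_neg (by simp; omega)]
      congr 2
      simp
      omega

theorem actY_pow_eq_zero {j m : ℕ} (h : j ≤ m) : actY K V j ^ m = 0 := by
  refine LinearMap.ext fun f => funext fun k => ?_
  rw [actY_pow_apply, if_pos (by omega)]
  rfl

/-- The `H`-module `M(j, V) = V ⊕ x V ⊕ ⋯ ⊕ x ^ (j - 1) V`, for `j ≤ n` and a `K G`-module `V` on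
which `g ^ n` acts as the identity. -/
noncomputable def M [FiniteDimensional K V] (ρ : Representation K G V) (hρ : ρ (D.g ^ D.n) = 1)
    (j : ℕ) (hj : j ≤ D.n) : FDModule K D.H :=
  FDModule.ofAct (Fin j → V) <| D.lift (D.actG ρ j) (actY K V j)
    (by
      have h : D.actG ρ j (D.g ^ D.n) = 1 := by
        refine LinearMap.ext fun f => funext fun k => ?_
        have hχ : D.χ (D.g ^ D.n) = 1 := by
          rw [map_pow]
          exact pow_orderOf_eq_one _
        simp [actG, hχ, hρ]
      rw [h, sub_self, smul_zero, actY_pow_eq_zero hj])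
    (fun a => by
      refine LinearMap.ext fun f => funext fun k => ?_
      simp only [Module.End.mul_apply, LinearMap.smul_apply, Pi.smul_apply, actY_apply, actG,
        MonoidHom.coe_mk, OneHom.coe_mk, LinearMap.pi_apply, LinearMap.comp_apply,
        LinearMap.proj_apply]
      split_ifs with h
      · simp
      · obtain ⟨m, hm⟩ : ∃ m, (k : ℕ) = m + 1 := ⟨k - 1, by omega⟩
        rw [smul_smul, ← Units.val_mul]
        simp only [hm, Nat.add_sub_cancel]
        rw [pow_succ', mul_inv_cancel_left])

end M

/-- The set `Ω₀` of the indices `i` for which `g ^ n` acts as the identity on `V_i`. -/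
def Ω₀ {Ω : Type*} {V : Ω → Type u} [∀ i, AddCommGroup (V i)] [∀ i, Module K (V i)]
    (ρ : ∀ i, Representation K G (V i)) : Set Ω :=
  {i | ρ i (D.g ^ D.n) = 1}

/-- The index set `I = {(j, i) | i ∈ Ω₀, 1 ≤ j ≤ n - 1}`. -/
def I {Ω : Type*} {V : Ω → Type u} [∀ i, AddCommGroup (V i)] [∀ i, Module K (V i)]
    (ρ : ∀ i, Representation K G (V i)) : Set (ℕ × Ω) :=
  {p | p.2 ∈ D.Ω₀ ρ ∧ 1 ≤ p.1 ∧ p.1 ≤ D.n - 1}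

instance {Ω : Type*} [Finite Ω] {V : Ω → Type u} [∀ i, AddCommGroup (V i)] [∀ i, Module K (V i)]
    (ρ : ∀ i, Representation K G (V i)) : Finite (D.I ρ) :=
  ((Set.finite_Iic (D.n - 1)).prod (Set.finite_univ (α := Ω))).subset
    fun _ hp => ⟨hp.2.2, trivial⟩

/-- The module `M(j, i)`, for `(j, i) ∈ I`. -/
noncomputable def MI {Ω : Type*} {V : Ω → Type u} [∀ i, AddCommGroup (V i)] [∀ i, Module K (V i)]
    [∀ i, FiniteDimensional K (V i)] (ρ : ∀ i, Representation K G (V i)) (p : D.I ρ) :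
    FDModule K D.H :=
  D.M (ρ p.1.2) p.2.1 p.1.1 (p.2.2.2.trans (Nat.sub_le _ _))

end GroupDatum

set_option autoImplicit false

/-! An `H`-module is a representation of `G` with an operator y such that y h = χ(h) h y and y^n =
μ(g^n − 1). Since g^n is central in H, a module X splits into the invariants of g^n and a
complement. On the complement y^n is invertible, which makes it projective, so X is stably
isomorphic to its invariants (`stablyIso_fixed`), where y^n = 0. There, if j is the nilpotency index
of y, a simple V_i in X that misses ker y^(j−1) generates a direct summand M(j, V_i)
(`exists_directSum_M`), and induction on the dimension decomposes X. The modules M(n, V) are induced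
from G, hence projective (`projective_M`). So additive stable invariants are determined by their
values at M(j, i) with j < n (`module_induction`), and the classes of these modules span.

For independence, the number of summands M(j, V_i) of X is the dimension of the space of equivariant
maps V_i → ker y^j modulo those with values in ker y^(j−1) + im y. This additive functor kills
projectives, because ker y^j ⊆ im y holds there for j < n (`exists_yEnd_eq_of_projective`), so the
number is a stable invariant. The stable Green ring is presented as a ring, so an additive function
of modules does not descend to it directly. Instead the ring acts on ℤ^I by tensoring on the left
(`tensorOpHom`), and applying [X] to the multiplicity vector of the trivial module returns that of X
(`multHom_cls`).

For the dimension, a Perron argument (`isFPdim_of_functional`) reduces the claim to a functional d,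
positive on the basis, with d(x b) = c d(b) for all basis elements b. Take d[M(j, V)] = dim V · [j]
with [j] = sin(jπ/n) / sin(π/n) = F_j(1, 2cos(π/n)). It is multiplicative for right multiplication
by M(1, W), since M(j, V) ⊗ M(1, W) ≅ M(j, V ⊗ W), and by M(2, K), since M(j, V) ⊗ M(2, K) ≅ M(j+1,
V) ⊕ M(j−1, V ⊗ χ⁻¹) and [j+1] + [j−1] = [2][j]. For j = n − 1 the summand M(n, V) is stably zero,
in accordance with [n] = 0: this dictates the angle π/n. The same rule yields the other M(j, W)
recursively, and [j] > 0 for 0 < j < n. -/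

namespace GroupDatum

variable {K : Type u} {G : Type v} [Field K] [Group G] [Finite G] (D : GroupDatum K G)

/-! ### Modules over `H` as representations of `G` with an operator `y` -/

section basic

variable (N : Type*) [AddCommGroup N] [Module K N] [Module D.H N] [IsScalarTower K D.H N]

/-- The representation of `G` on an `H`-module. -/
noncomputable def rep : Representation K G N :=
  (Algebra.lsmul K K N : D.H →ₐ[K] Module.End K N).toMonoidHom.comp D.ofGHom

/-- The action of `y` on an `H`-module. -/
noncomputable def yEnd : Module.End K N := Algebra.lsmul K K N D.y

variable {N}

theorem rep_apply (a : G) (x : N) : D.rep N a x = D.ofG a • x := rfl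

theorem yEnd_apply (x : N) : D.yEnd N x = D.y • x := rfl

theorem yEnd_rep (a : G) (x : N) :
    D.yEnd N (D.rep N a x) = (D.χ a : K) • D.rep N a (D.yEnd N x) := by
  simp only [rep_apply, yEnd_apply, smul_smul, y_mul_ofG, smul_assoc]

theorem yEnd_pow_apply (k : ℕ) (x : N) : (D.yEnd N ^ k) x = D.y ^ k • x := by
  rw [yEnd, ← map_pow]; rfl

theorem yEnd_pow_rep (k : ℕ) (a : G) (x : N) :
    (D.yEnd N ^ k) (D.rep N a x) = (D.χ a : K) ^ k • D.rep N a ((D.yEnd N ^ k) x) := by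
  induction k with
  | zero => simp
  | succ k ih =>
    rw [pow_succ', Module.End.mul_apply, ih, map_smul, yEnd_rep, smul_smul, ← pow_succ,
      Module.End.mul_apply]

theorem yEnd_pow_n (x : N) : (D.yEnd N ^ D.n) x = D.μ • (D.rep N (D.g ^ D.n) x - x) := by
  rw [yEnd_pow_apply, y_pow_n, smul_assoc, sub_smul, one_smul, rep_apply]

theorem yEnd_pow_n_eq_zero (h : ∀ x : N, D.rep N (D.g ^ D.n) x = x) : D.yEnd N ^ D.n = 0 := by
  ext x
  rw [yEnd_pow_n, h, sub_self, smul_zero, LinearMap.zero_apply]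

variable {N' : Type*} [AddCommGroup N'] [Module K N'] [Module D.H N'] [IsScalarTower K D.H N']

/-- A linear map that commutes with `G` and with `y` is `H`-linear. -/
def homOf (f : N →ₗ[K] N') (hG : ∀ a x, f (D.rep N a x) = D.rep N' a (f x))
    (hy : ∀ x, f (D.yEnd N x) = D.yEnd N' (f x)) : N →ₗ[D.H] N' where
  toFun := f
  map_add' := map_add f
  map_smul' c := by
    induction c using D.induction with
    | hs c => intro x; simp
    | hG a => exact hG a
    | hy => exact hy
    | hm a b h1 h2 => intro x; simp only [RingHom.id_apply] at *; rw [mul_smul, h1, h2, mul_smul]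
    | ha a b h1 h2 => intro x; simp only [RingHom.id_apply] at *; rw [add_smul, map_add, h1, h2, add_smul]

@[simp] theorem homOf_apply (f : N →ₗ[K] N') (hG hy) (x : N) : D.homOf f hG hy x = f x := rfl

theorem hom_rep (φ : N →ₗ[D.H] N') (a : G) (x : N) : φ (D.rep N a x) = D.rep N' a (φ x) :=
  map_smul φ _ _

theorem hom_yEnd (φ : N →ₗ[D.H] N') (x : N) : φ (D.yEnd N x) = D.yEnd N' (φ x) :=
  map_smul φ _ _

theorem hom_yEnd_pow (φ : N →ₗ[D.H] N') (k : ℕ) (x : N) :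
    φ ((D.yEnd N ^ k) x) = (D.yEnd N' ^ k) (φ x) := by
  simp only [yEnd_pow_apply, map_smul]

/-- An `H`-submodule from a subspace stable under `G` and `y`. -/
def submoduleOf (S : Submodule K N) (hG : ∀ a, ∀ x ∈ S, D.rep N a x ∈ S)
    (hy : ∀ x ∈ S, D.yEnd N x ∈ S) : Submodule D.H N where
  carrier := S
  add_mem' := S.add_mem
  zero_mem' := S.zero_mem
  smul_mem' c := by
    induction c using D.induction with
    | hs c => intro x hx; simpa using S.smul_mem c hx
    | hG a => intro x; exact hG a x
    | hy => intro x; exact hy x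
    | hm a b h1 h2 => intro x hx; rw [mul_smul]; exact h1 (h2 hx)
    | ha a b h1 h2 => intro x hx; rw [add_smul]; exact S.add_mem (h1 hx) (h2 hx)

end basic

/-! ### Averaging -/

section avg

variable {V W W' : Type*} [AddCommGroup V] [Module K V] [AddCommGroup W] [Module K W]
  [AddCommGroup W'] [Module K W']

/-- The average of a linear map over `G`. -/
noncomputable def average (σ : Representation K G V) (τ : Representation K G W)
    (f : V →ₗ[K] W) : V →ₗ[K] W :=
  let _ := Fintype.ofFinite G
  (Nat.card G : K)⁻¹ • ∑ a : G, τ a⁻¹ ∘ₗ f ∘ₗ σ a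

theorem average_equivariant (σ : Representation K G V) (τ : Representation K G W)
    (f : V →ₗ[K] W) (b : G) (x : V) : average σ τ f (σ b x) = τ b (average σ τ f x) := by
  let _ := Fintype.ofFinite G
  simp only [average, LinearMap.smul_apply, LinearMap.sum_apply, LinearMap.comp_apply, map_smul,
    map_sum]
  congr 1
  -- Substituting a b for a absorbs b on the right and produces b⁻¹ on the left.
  refine Fintype.sum_equiv (Equiv.mulRight b) (fun a => τ a⁻¹ (f (σ a (σ b x))))
    (fun a => τ b (τ a⁻¹ (f (σ a x)))) fun a => ?_
  simp only [Equiv.coe_mulRight, map_mul, mul_inv_rev, Module.End.mul_apply]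
  rw [← Module.End.mul_apply (τ b), ← map_mul, mul_inv_cancel, map_one, Module.End.one_apply]

variable [CharZero K]

/-- All |G| terms of the average have the same image under p, and characteristic zero allows
division by |G|. A retraction and a lift are both obtained from this. -/
theorem apply_average_eq {U : Type*} [AddCommGroup U] [Module K U] (σ : Representation K G V)
    (τ : Representation K G W) (f : V →ₗ[K] W) (p : W →ₗ[K] U) {x : V} {y : U}
    (h : ∀ a, p (τ a⁻¹ (f (σ a x))) = y) : p (average σ τ f x) = y := by
  let _ := Fintype.ofFinite G
  have hc : (Nat.card G : K) ≠ 0 := by exact_mod_cast Nat.card_pos.ne'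
  simp only [average, LinearMap.smul_apply, LinearMap.sum_apply, LinearMap.comp_apply, map_smul,
    map_sum, h]
  rw [Finset.sum_const, Finset.card_univ, ← Nat.cast_smul_eq_nsmul K, smul_smul,
    ← Nat.card_eq_fintype_card, inv_mul_cancel₀ hc, one_smul]

/-- Maschke: average any linear retraction. -/
theorem exists_equivariant_retraction (σ : Representation K G V) (τ : Representation K G W)
    (f : V →ₗ[K] W) (hf : ∀ a x, f (σ a x) = τ a (f x)) (hinj : Function.Injective f) :
    ∃ r : W →ₗ[K] V, (∀ a x, r (τ a x) = σ a (r x)) ∧ ∀ x, r (f x) = x := by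
  obtain ⟨r, hr⟩ := f.exists_leftInverse_of_injective (LinearMap.ker_eq_bot.mpr hinj)
  refine ⟨average τ σ r, average_equivariant τ σ r, fun x =>
    apply_average_eq τ σ r LinearMap.id fun a => ?_⟩
  rw [← hf, ← LinearMap.comp_apply r f, hr, LinearMap.id_apply, LinearMap.id_apply,
    ← Module.End.mul_apply, ← map_mul, inv_mul_cancel, map_one, Module.End.one_apply]

/-- Maschke: compose f with any linear section of p and average. -/
theorem exists_equivariant_lift (σ : Representation K G V) (τ : Representation K G W)
    (τ' : Representation K G W') (p : W →ₗ[K] W') (hp : ∀ a x, p (τ a x) = τ' a (p x))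
    (hsurj : Function.Surjective p) (f : V →ₗ[K] W') (hf : ∀ a x, f (σ a x) = τ' a (f x)) :
    ∃ f' : V →ₗ[K] W, (∀ a x, f' (σ a x) = τ a (f' x)) ∧ ∀ x, p (f' x) = f x := by
  obtain ⟨s, hs⟩ := p.exists_rightInverse_of_surjective (LinearMap.range_eq_top.mpr hsurj)
  refine ⟨average σ τ (s ∘ₗ f), average_equivariant σ τ _, fun x =>
    apply_average_eq σ τ (s ∘ₗ f) p fun a => ?_⟩
  rw [hp, LinearMap.comp_apply, ← LinearMap.comp_apply p s, hs, LinearMap.id_apply, hf,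
    ← Module.End.mul_apply, ← map_mul, inv_mul_cancel, map_one, Module.End.one_apply]

end avg

end GroupDatum

namespace GroupDatum

variable {K : Type u} {G : Type v} [Field K] [Group G] [Finite G] (D : GroupDatum K G)

/-! ### Extension of equivariant maps to `M(j, V)` and to induced modules -/

section extend

variable {V : Type u} [AddCommGroup V] [Module K V] (σ : Representation K G V)
variable {N : Type*} [AddCommGroup N] [Module K N] [Module D.H N] [IsScalarTower K D.H N]

theorem actG_single (j : ℕ) (a : G) (k : Fin j) (v : V) : D.actG σ j a (Pi.single k v) =
    (((D.χ a)⁻¹ ^ (k : ℕ) : Kˣ) : K) • Pi.single k (σ a v) := by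
  funext l
  simp only [actG, MonoidHom.coe_mk, OneHom.coe_mk, LinearMap.pi_apply, LinearMap.smul_apply,
    LinearMap.comp_apply, LinearMap.proj_apply, Pi.smul_apply]
  by_cases h : l = k
  · subst h; simp
  · simp [Pi.single_eq_of_ne h]

/-- The map `∑ x ^ k v_k ↦ ∑ y ^ k f(v_k)`. -/
noncomputable def extend (j : ℕ) (f : V →ₗ[K] N) : (Fin j → V) →ₗ[K] N :=
  ∑ k : Fin j, (D.yEnd N ^ (k : ℕ)) ∘ₗ f ∘ₗ LinearMap.proj k

@[simp] theorem extend_single (j : ℕ) (f : V →ₗ[K] N) (k : Fin j) (v : V) :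
    D.extend j f (Pi.single k v) = (D.yEnd N ^ (k : ℕ)) (f v) := by
  simp only [extend, LinearMap.sum_apply, LinearMap.comp_apply, LinearMap.proj_apply]
  rw [Finset.sum_eq_single k]
  · simp
  · intro b _ hb; simp [Pi.single_eq_of_ne hb]
  · simp

/-- Moving h through y^k produces χ(h)^k, which cancels the factor χ(h)^(−k) in the action on degree
k. -/
theorem extend_actG (j : ℕ) (f : V →ₗ[K] N) (hf : ∀ a v, f (σ a v) = D.rep N a (f v)) (a : G)
    (w : Fin j → V) : D.extend j f (D.actG σ j a w) = D.rep N a (D.extend j f w) := by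
  suffices h : D.extend j f ∘ₗ D.actG σ j a = D.rep N a ∘ₗ D.extend j f from
    LinearMap.congr_fun h w
  refine LinearMap.pi_ext' fun k => LinearMap.ext fun v => ?_
  simp only [LinearMap.comp_apply, LinearMap.single_apply, actG_single, map_smul, extend_single,
    hf, yEnd_pow_rep, smul_smul]
  rw [Units.val_pow_eq_pow_val, ← mul_pow, Units.inv_mul, one_pow, one_smul]

theorem extend_actY (j : ℕ) (f : V →ₗ[K] N) (hy : ∀ v, (D.yEnd N ^ j) (f v) = 0)
    (w : Fin j → V) : D.extend j f (actY K V j w) = D.yEnd N (D.extend j f w) := by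
  suffices h : D.extend j f ∘ₗ actY K V j = D.yEnd N ∘ₗ D.extend j f from
    LinearMap.congr_fun h w
  refine LinearMap.pi_ext' fun k => LinearMap.ext fun v => ?_
  simp only [LinearMap.comp_apply, LinearMap.single_apply, actY_single, extend_single]
  rw [← Module.End.mul_apply, ← pow_succ']
  split_ifs with h
  · simp
  · rw [map_zero, show (k : ℕ) + 1 = j by omega, hy]

theorem mem_of_extend_range (j : ℕ) (f : V →ₗ[K] N) (hy : ∀ v, (D.yEnd N ^ j) (f v) = 0) (v : V) :
    f v ∈ LinearMap.range (D.extend j f) := by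
  rcases Nat.eq_zero_or_pos j with rfl | hj
  -- For j = 0 the hypothesis says f v = 0.
  · have := hy v
    rw [pow_zero, Module.End.one_apply] at this
    rw [this]
    exact zero_mem _
  · exact ⟨Pi.single ⟨0, hj⟩ v, by simp⟩

/-- The operator `y` of the induced module `V ⊕ y V ⊕ ⋯ ⊕ y ^ (n - 1) V`. -/
noncomputable def indY : Module.End K (Fin D.n → V) :=
  LinearMap.pi fun k =>
    -- The top degree wraps around: y · y^(n−1) v = y^n v = μ(g^n − 1) v.
    if (k : ℕ) = 0 then
      D.μ • ((σ (D.g ^ D.n) - 1) ∘ₗ LinearMap.proj ⟨D.n - 1, Nat.sub_lt D.n_pos one_pos⟩)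
    else LinearMap.proj (⟨k - 1, lt_of_le_of_lt (Nat.sub_le _ _) k.2⟩ : Fin D.n)

theorem indY_apply (w : Fin D.n → V) (k : Fin D.n) : D.indY σ w k =
    if (k : ℕ) = 0 then D.μ • (σ (D.g ^ D.n) (w ⟨D.n - 1, Nat.sub_lt D.n_pos one_pos⟩) -
      w ⟨D.n - 1, Nat.sub_lt D.n_pos one_pos⟩)
    else w ⟨k - 1, lt_of_le_of_lt (Nat.sub_le _ _) k.2⟩ := by
  simp only [indY, LinearMap.pi_apply]
  split_ifs
  · simp only [LinearMap.smul_apply, LinearMap.comp_apply, LinearMap.sub_apply,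
      LinearMap.proj_apply, Module.End.one_apply]
  · simp

theorem indY_single (k : Fin D.n) (v : V) : D.indY σ (Pi.single k v) =
    if h : (k : ℕ) + 1 < D.n then Pi.single ⟨k + 1, h⟩ v
    else Pi.single ⟨0, D.n_pos⟩ (D.μ • (σ (D.g ^ D.n) v - v)) := by
  by_cases h : (k : ℕ) + 1 < D.n
  · rw [dif_pos h]
    funext l
    rw [indY_apply]
    simp only [Pi.single_apply, Fin.ext_iff]
    split_ifs <;> first | omega | simp
  · rw [dif_neg h]
    have hk : k = ⟨D.n - 1, Nat.sub_lt D.n_pos one_pos⟩ := Fin.ext (by have := k.2; simp; omega)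
    subst hk
    funext l
    have hl := l.2
    rw [indY_apply]
    simp only [Pi.single_apply, Fin.ext_iff]
    split_ifs <;> first | rfl | omega

theorem indY_pow_single_zero (m : ℕ) (h : m < D.n) (v : V) :
    (D.indY σ ^ m) (Pi.single ⟨0, D.n_pos⟩ v) = Pi.single ⟨m, h⟩ v := by
  induction m with
  | zero => simp
  | succ m ih =>
    rw [pow_succ', Module.End.mul_apply, ih (by omega), indY_single, dif_pos h]

theorem indY_pow_n : D.indY σ ^ D.n = D.μ • (D.actG σ D.n (D.g ^ D.n) - 1) := by
  refine LinearMap.pi_ext' fun k => LinearMap.ext fun v => ?_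
  have hχ : D.χ (D.g ^ D.n) = 1 := by
    rw [map_pow]
    exact pow_orderOf_eq_one _
  obtain ⟨m, hm⟩ : ∃ m, D.n = m + 1 := ⟨D.n - 1, by have := D.n_pos; omega⟩
  have key : (D.indY σ ^ D.n) (Pi.single ⟨0, D.n_pos⟩ v) =
      Pi.single ⟨0, D.n_pos⟩ (D.μ • (σ (D.g ^ D.n) v - v)) := by
    have h1 : D.indY σ ^ D.n = D.indY σ * D.indY σ ^ m := by rw [← pow_succ', ← hm]
    rw [h1, Module.End.mul_apply, indY_pow_single_zero _ _ m (by omega), indY_single,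
      dif_neg (by simp [hm])]
  simp only [LinearMap.comp_apply, LinearMap.single_apply, LinearMap.smul_apply,
    LinearMap.sub_apply, Module.End.one_apply, actG_single, hχ, inv_one, one_pow, Units.val_one,
    one_smul]
  -- A vector of degree k is y^k of one of degree 0, and y^n commutes with y^k, so degree 0
  -- suffices.
  conv_lhs => rw [show k = ⟨k.1, k.2⟩ from rfl, ← indY_pow_single_zero, ← Module.End.mul_apply, ← pow_add, add_comm,
    pow_add, Module.End.mul_apply, key, indY_pow_single_zero _ _ _ k.2]
  rw [← Pi.single_sub, ← Pi.single_smul]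

/-- Below the top degree this is the computation for M(j, V). The wrap-around from degree n − 1 to
degree 0 requires χ^(−(n−1)) = χ, which is where χ^n = 1 enters. -/
theorem indY_actG (hχ : D.χ ^ D.n = 1) (a : G) :
    D.indY σ * D.actG σ D.n a = (D.χ a : K) • (D.actG σ D.n a * D.indY σ) := by
  refine LinearMap.pi_ext' fun k => LinearMap.ext fun v => ?_
  simp only [LinearMap.comp_apply, LinearMap.single_apply, LinearMap.smul_apply,
    Module.End.mul_apply, actG_single, map_smul, indY_single]
  split_ifs with h
  · rw [actG_single, smul_smul, ← Units.val_mul, pow_succ', mul_inv_cancel_left]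
  · have hk : (k : ℕ) + 1 = D.n := by omega
    have h1 : (D.χ a) ^ D.n = 1 := by rw [← MonoidHom.pow_apply, hχ, MonoidHom.one_apply]
    have h2 : (D.χ a)⁻¹ ^ (k : ℕ) = D.χ a := by
      rw [inv_pow, inv_eq_iff_mul_eq_one, ← pow_succ, hk, h1]
    have h3 : σ (D.g ^ D.n) (σ a v) = σ a (σ (D.g ^ D.n) v) := by
      rw [← Module.End.mul_apply, ← Module.End.mul_apply, ← map_mul, ← map_mul]
      have := Subgroup.mem_center_iff.mp (Subgroup.pow_mem _ D.g_mem_center D.n) a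
      rw [this]
    rw [h2, h3, actG_single]
    simp

/-- No nilpotency condition on f is needed, because y^n acts as μ(g^n − 1) on every `H`-module,
exactly as the wrap-around does. This is Frobenius reciprocity for the induced module. -/
theorem extend_indY (f : V →ₗ[K] N) (hf : ∀ a v, f (σ a v) = D.rep N a (f v)) (w : Fin D.n → V) :
    D.extend D.n f (D.indY σ w) = D.yEnd N (D.extend D.n f w) := by
  suffices h : D.extend D.n f ∘ₗ D.indY σ = D.yEnd N ∘ₗ D.extend D.n f from
    LinearMap.congr_fun h w
  refine LinearMap.pi_ext' fun k => LinearMap.ext fun v => ?_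
  simp only [LinearMap.comp_apply, LinearMap.single_apply, indY_single, extend_single]
  rw [← Module.End.mul_apply, ← pow_succ']
  split_ifs with h
  · simp
  · rw [show (k : ℕ) + 1 = D.n by omega, yEnd_pow_n]
    rw [← hf]
    simp

end extend

end GroupDatum

namespace GroupDatum

variable {K : Type u} {G : Type v} [Field K] [Group G] [Finite G] (D : GroupDatum K G)

/-! ### The modules M(j, V) and the induced modules -/

section lift

variable {V : Type u} [AddCommGroup V] [Module K V] [FiniteDimensional K V]
  (f : G →* Module.End K V) (Y : Module.End K V) (hpow : Y ^ D.n = D.μ • (f (D.g ^ D.n) - 1))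
  (hmul : ∀ a, Y * f a = (D.χ a : K) • (f a * Y))

theorem rep_ofAct_lift (a : G) (w : V) :
    D.rep (FDModule.ofAct V (D.lift f Y hpow hmul)) a w = f a w :=
  LinearMap.congr_fun (D.lift_ofG f Y hpow hmul a) w

theorem yEnd_ofAct_lift (w : V) :
    D.yEnd (FDModule.ofAct V (D.lift f Y hpow hmul)) w = Y w :=
  LinearMap.congr_fun (D.lift_y f Y hpow hmul) w

end lift

section modules

variable {V : Type u} [AddCommGroup V] [Module K V] [FiniteDimensional K V]
  (σ : Representation K G V)

/-- The identification of `M(j, V)` with `V ^ j`. -/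
noncomputable def toM (hσ : σ (D.g ^ D.n) = 1) (j : ℕ) (hj : j ≤ D.n) :
    (Fin j → V) ≃ₗ[K] D.M σ hσ j hj := LinearEquiv.refl K (Fin j → V)

/-- The `H`-module induced from a `G`-module. -/
noncomputable def ind (hχ : D.χ ^ D.n = 1) : FDModule K D.H :=
  FDModule.ofAct (Fin D.n → V) <| D.lift (D.actG σ D.n) (D.indY σ) (D.indY_pow_n σ)
    (D.indY_actG σ hχ)

/-- The identification of the induced module with `V ^ n`. -/
noncomputable def toInd (hχ : D.χ ^ D.n = 1) :
    (Fin D.n → V) ≃ₗ[K] D.ind σ hχ := LinearEquiv.refl K (Fin D.n → V)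

section M

variable (hσ : σ (D.g ^ D.n) = 1) (j : ℕ) (hj : j ≤ D.n)

theorem rep_toM (a : G) (w : Fin j → V) :
    D.rep (D.M σ hσ j hj) a (D.toM σ hσ j hj w) = D.toM σ hσ j hj (D.actG σ j a w) :=
  D.rep_ofAct_lift (D.actG σ j) (actY K V j) _ _ a w

theorem yEnd_toM (w : Fin j → V) :
    D.yEnd (D.M σ hσ j hj) (D.toM σ hσ j hj w) = D.toM σ hσ j hj (actY K V j w) := by
  exact D.yEnd_ofAct_lift (D.actG σ j) (actY K V j) _ _ w

theorem yEnd_pow_toM (k : ℕ) (w : Fin j → V) :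
    (D.yEnd (D.M σ hσ j hj) ^ k) (D.toM σ hσ j hj w) = D.toM σ hσ j hj ((actY K V j ^ k) w) := by
  induction k with
  | zero => rfl
  | succ k ih => simp only [pow_succ', Module.End.mul_apply, ih, yEnd_toM]

theorem finrank_M : Module.finrank K (D.M σ hσ j hj) = j * Module.finrank K V := by
  rw [← (D.toM σ hσ j hj).finrank_eq, Module.finrank_pi_fintype]
  simp

variable {N : Type*} [AddCommGroup N] [Module K N] [Module D.H N] [IsScalarTower K D.H N]

/-- The morphism `M(j, V) → N` that extends an equivariant map `V → N`. -/
noncomputable def homM (f : V →ₗ[K] N) (hf : ∀ a v, f (σ a v) = D.rep N a (f v))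
    (hy : ∀ v, (D.yEnd N ^ j) (f v) = 0) : D.M σ hσ j hj →ₗ[D.H] N :=
  D.homOf (D.extend j f ∘ₗ (D.toM σ hσ j hj).symm)
    (fun a x => by
      obtain ⟨w, rfl⟩ := (D.toM σ hσ j hj).surjective x
      simp only [LinearMap.comp_apply, LinearEquiv.coe_coe, rep_toM, LinearEquiv.symm_apply_apply,
        D.extend_actG σ j f hf])
    (fun x => by
      obtain ⟨w, rfl⟩ := (D.toM σ hσ j hj).surjective x
      simp only [LinearMap.comp_apply, LinearEquiv.coe_coe, yEnd_toM, LinearEquiv.symm_apply_apply,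
        D.extend_actY j f hy])

variable (f : V →ₗ[K] N) (hf : ∀ a v, f (σ a v) = D.rep N a (f v))
  (hy : ∀ v, (D.yEnd N ^ j) (f v) = 0)

@[simp] theorem homM_toM (w : Fin j → V) :
    D.homM σ hσ j hj f hf hy (D.toM σ hσ j hj w) = D.extend j f w := by
  simp [homM]

theorem toM_single (k : Fin j) (v : V) : D.toM σ hσ j hj (Pi.single k v) =
    (D.yEnd (D.M σ hσ j hj) ^ (k : ℕ))
      (D.toM σ hσ j hj (Pi.single ⟨0, lt_of_le_of_lt (Nat.zero_le _) k.2⟩ v)) := by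
  rw [yEnd_pow_toM]
  congr 1
  funext l
  rw [actY_pow_apply]
  simp only [Pi.single_apply, Fin.ext_iff]
  split_ifs <;> first | rfl | omega

/-- M(j, V) is generated under y by its component of degree 0. Quantifying over `0 < j` includes the
zero module j = 0. -/
theorem homM_ext {φ ψ : D.M σ hσ j hj →ₗ[D.H] N}
    (h : ∀ (h0 : 0 < j) v, φ (D.toM σ hσ j hj (Pi.single ⟨0, h0⟩ v)) =
      ψ (D.toM σ hσ j hj (Pi.single ⟨0, h0⟩ v))) : φ = ψ := by
  suffices h : φ.restrictScalars K ∘ₗ (D.toM σ hσ j hj).toLinearMap =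
      ψ.restrictScalars K ∘ₗ (D.toM σ hσ j hj).toLinearMap by
    ext x
    obtain ⟨w, rfl⟩ := (D.toM σ hσ j hj).surjective x
    exact LinearMap.congr_fun h w
  refine LinearMap.pi_ext' fun k => LinearMap.ext fun v => ?_
  simp only [LinearMap.comp_apply, LinearMap.single_apply, LinearEquiv.coe_coe,
    LinearMap.restrictScalars_apply]
  rw [toM_single, hom_yEnd_pow, hom_yEnd_pow, h]

/-- A module generated under `y` by an equivariant image of `V`, and of dimension at least
`j * dim V`, is `M(j, V)` as soon as `y ^ j` kills this image. -/
theorem nonempty_equiv_M [FiniteDimensional K N]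
    (hf : ∀ a v, f (σ a v) = D.rep N a (f v)) (hy : ∀ v, (D.yEnd N ^ j) (f v) = 0)
    (hgen : ∀ S : Submodule K N, (∀ x ∈ S, D.yEnd N x ∈ S) → (∀ v, f v ∈ S) → S = ⊤)
    (hdim : Module.finrank K N = j * Module.finrank K V) :
    Nonempty (D.M σ hσ j hj ≃ₗ[D.H] N) := by
  set φ := D.homM σ hσ j hj f hf hy
  have hs : Function.Surjective φ := by
    have := hgen (LinearMap.range (D.extend j f)) (by
      rintro _ ⟨w, rfl⟩
      exact ⟨actY K V j w, D.extend_actY j f hy w⟩) (D.mem_of_extend_range j f hy)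
    intro x
    obtain ⟨w, rfl⟩ := LinearMap.range_eq_top.mp this x
    exact ⟨D.toM σ hσ j hj w, D.homM_toM σ hσ j hj f hf hy w⟩
  have hi : Function.Injective (φ.restrictScalars K) :=
    (LinearMap.injective_iff_surjective_of_finrank_eq_finrank
      (by rw [finrank_M, hdim])).mpr hs
  exact ⟨LinearEquiv.ofBijective φ ⟨hi, hs⟩⟩

end M

section ind

variable (hχ : D.χ ^ D.n = 1)

theorem rep_toInd (a : G) (w : Fin D.n → V) :
    D.rep (D.ind σ hχ) a (D.toInd σ hχ w) = D.toInd σ hχ (D.actG σ D.n a w) :=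
  D.rep_ofAct_lift (D.actG σ D.n) (D.indY σ) _ _ a w

theorem yEnd_toInd (w : Fin D.n → V) :
    D.yEnd (D.ind σ hχ) (D.toInd σ hχ w) = D.toInd σ hχ (D.indY σ w) := by
  exact D.yEnd_ofAct_lift (D.actG σ D.n) (D.indY σ) _ _ w

theorem yEnd_pow_toInd (k : ℕ) (w : Fin D.n → V) :
    (D.yEnd (D.ind σ hχ) ^ k) (D.toInd σ hχ w) = D.toInd σ hχ ((D.indY σ ^ k) w) := by
  induction k with
  | zero => rfl
  | succ k ih => simp only [pow_succ', Module.End.mul_apply, ih, yEnd_toInd]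

theorem finrank_ind : Module.finrank K (D.ind σ hχ) = D.n * Module.finrank K V := by
  rw [← (D.toInd σ hχ).finrank_eq, Module.finrank_pi_fintype]
  simp

variable {N : Type*} [AddCommGroup N] [Module K N] [Module D.H N] [IsScalarTower K D.H N]

variable (f : V →ₗ[K] N)

/-- The morphism from an induced module that extends an equivariant map `V → N`. -/
noncomputable def homInd (hf : ∀ a v, f (σ a v) = D.rep N a (f v)) :
    D.ind σ hχ →ₗ[D.H] N :=
  D.homOf (D.extend D.n f ∘ₗ (D.toInd σ hχ).symm)
    (fun a x => by
      obtain ⟨w, rfl⟩ := (D.toInd σ hχ).surjective x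
      simp only [LinearMap.comp_apply, LinearEquiv.coe_coe, rep_toInd, LinearEquiv.symm_apply_apply,
        D.extend_actG σ D.n f hf])
    (fun x => by
      obtain ⟨w, rfl⟩ := (D.toInd σ hχ).surjective x
      simp only [LinearMap.comp_apply, LinearEquiv.coe_coe, yEnd_toInd,
        LinearEquiv.symm_apply_apply, D.extend_indY σ f hf])

@[simp] theorem homInd_toInd (hf : ∀ a v, f (σ a v) = D.rep N a (f v)) (w : Fin D.n → V) :
    D.homInd σ hχ f hf (D.toInd σ hχ w) = D.extend D.n f w := by
  simp [homInd]

theorem homInd_surjective (hf : ∀ a v, f (σ a v) = D.rep N a (f v))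
    (hgen : ∀ S : Submodule K N, (∀ x ∈ S, D.yEnd N x ∈ S) → (∀ v, f v ∈ S) → S = ⊤) :
    Function.Surjective (D.homInd σ hχ f hf) := by
  have := hgen (LinearMap.range (D.extend D.n f)) (by
    rintro _ ⟨w, rfl⟩
    exact ⟨D.indY σ w, D.extend_indY σ f hf w⟩)
    (fun v => ⟨Pi.single ⟨0, D.n_pos⟩ v, by simp⟩)
  intro x
  obtain ⟨w, rfl⟩ := LinearMap.range_eq_top.mp this x
  exact ⟨D.toInd σ hχ w, D.homInd_toInd σ hχ f hf w⟩

/-- Frobenius reciprocity gives a surjection, which equality of dimensions makes bijective. -/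
theorem nonempty_equiv_ind [FiniteDimensional K N]
    (hf : ∀ a v, f (σ a v) = D.rep N a (f v))
    (hgen : ∀ S : Submodule K N, (∀ x ∈ S, D.yEnd N x ∈ S) → (∀ v, f v ∈ S) → S = ⊤)
    (hdim : Module.finrank K N = D.n * Module.finrank K V) :
    Nonempty (D.ind σ hχ ≃ₗ[D.H] N) := by
  have hs := D.homInd_surjective σ hχ f hf hgen
  have hi : Function.Injective ((D.homInd σ hχ f hf).restrictScalars K) :=
    (LinearMap.injective_iff_surjective_of_finrank_eq_finrank
      (by rw [finrank_ind, hdim])).mpr hs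
  exact ⟨LinearEquiv.ofBijective _ ⟨hi, hs⟩⟩

theorem toInd_single (k : Fin D.n) (v : V) : D.toInd σ hχ (Pi.single k v) =
    (D.yEnd (D.ind σ hχ) ^ (k : ℕ)) (D.toInd σ hχ (Pi.single ⟨0, D.n_pos⟩ v)) := by
  rw [yEnd_pow_toInd, indY_pow_single_zero _ _ _ k.2]

theorem homInd_ext {φ ψ : D.ind σ hχ →ₗ[D.H] N}
    (h : ∀ v, φ (D.toInd σ hχ (Pi.single ⟨0, D.n_pos⟩ v)) =
      ψ (D.toInd σ hχ (Pi.single ⟨0, D.n_pos⟩ v))) : φ = ψ := by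
  suffices h : φ.restrictScalars K ∘ₗ (D.toInd σ hχ).toLinearMap =
      ψ.restrictScalars K ∘ₗ (D.toInd σ hχ).toLinearMap by
    ext x
    obtain ⟨w, rfl⟩ := (D.toInd σ hχ).surjective x
    exact LinearMap.congr_fun h w
  refine LinearMap.pi_ext' fun k => LinearMap.ext fun v => ?_
  simp only [LinearMap.comp_apply, LinearMap.single_apply, LinearEquiv.coe_coe,
    LinearMap.restrictScalars_apply]
  rw [toInd_single, hom_yEnd_pow, hom_yEnd_pow, h]

theorem rep_toInd_single_zero (a : G) (v : V) :
    D.rep (D.ind σ hχ) a (D.toInd σ hχ (Pi.single ⟨0, D.n_pos⟩ v)) =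
      D.toInd σ hχ (Pi.single ⟨0, D.n_pos⟩ (σ a v)) := by
  rw [rep_toInd, actG_single]
  simp

/-- Morphisms from an induced module are the equivariant maps from V, and these lift along
surjections by averaging. -/
instance projective_ind [CharZero K] : Module.Projective D.H (D.ind σ hχ) := by
  refine Module.Projective.of_lifting_property'' fun p hp => ?_
  obtain ⟨f, hf, hpf⟩ := exists_equivariant_lift σ (D.rep (D.ind σ hχ →₀ D.H))
    (D.rep (D.ind σ hχ)) (p.restrictScalars K) (D.hom_rep p) hp
    ((D.toInd σ hχ).toLinearMap ∘ₗ LinearMap.single K (fun _ => V) ⟨0, D.n_pos⟩)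
    (fun a v => by
      simp only [LinearMap.comp_apply, LinearMap.single_apply, LinearEquiv.coe_coe,
        rep_toInd_single_zero])
  refine ⟨D.homInd σ hχ f hf, D.homInd_ext σ hχ fun v => ?_⟩
  simpa using hpf v

/-- A vector of an induced module killed by a power of `y` below the `n`-th is a multiple of `y`. -/
theorem exists_yEnd_eq_ind {j : ℕ} (hj : j < D.n) (x : D.ind σ hχ)
    (hx : (D.yEnd (D.ind σ hχ) ^ j) x = 0) : ∃ z, D.yEnd (D.ind σ hχ) z = x := by
  obtain ⟨w, rfl⟩ := (D.toInd σ hχ).surjective x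
  -- For m < n, the operator y^m carries coordinate 0 to coordinate m before any wrap-around, so y^j
  -- x = 0 forces coordinate 0 of x to vanish.
  have key : ∀ (m : ℕ) (hm : m < D.n) (w : Fin D.n → V),
      (D.indY σ ^ m) w ⟨m, hm⟩ = w ⟨0, D.n_pos⟩ := by
    intro m
    induction m with
    | zero => intros; rfl
    | succ m ih =>
      intro hm w
      rw [pow_succ', Module.End.mul_apply, indY_apply, if_neg (by simp)]
      exact ih (by omega) w
  have h0 : w ⟨0, D.n_pos⟩ = 0 := by
    rw [yEnd_pow_toInd, LinearEquiv.map_eq_zero_iff] at hx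
    rw [← key j hj w, hx]
    rfl
  -- The preimage shifts the coordinates down by one; its last coordinate is 0, so the wrap-around
  -- contributes nothing.
  refine ⟨D.toInd σ hχ fun k => if h : (k : ℕ) + 1 < D.n then w ⟨k + 1, h⟩ else 0, ?_⟩
  rw [yEnd_toInd]
  congr 1
  funext k
  have hk := k.2
  rw [indY_apply]
  split_ifs with h1 h2 h3
  · simp at h2; omega
  · rw [show k = ⟨0, D.n_pos⟩ from Fin.ext h1, h0]; simp
  · congr 1; ext; simp; omega
  · simp at h3; omega

end ind

end modules

/-! ### Projective modules as retracts of induced modules -/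

section projective

variable (hχ : D.χ ^ D.n = 1) (P : FDModule K D.H) 

/-- Each projective module is a direct summand of an induced one. -/
theorem exists_retract_ind [Module.Projective D.H P] :
    ∃ (s : P →ₗ[D.H] D.ind (D.rep P) hχ) (p : D.ind (D.rep P) hχ →ₗ[D.H] P), p ∘ₗ s = .id := by
  -- The identity of P extends to a surjection from the module induced from the restriction of P to
  -- G.
  have hs := D.homInd_surjective (D.rep P) hχ (N := P) LinearMap.id (fun _ _ => rfl)
    (fun S _ h => (Submodule.eq_top_iff' (p := S)).mpr h)
  obtain ⟨s, hs⟩ := Module.projective_lifting_property _ LinearMap.id hs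
  exact ⟨s, _, hs⟩

/-- The property holds for induced modules and passes to retracts. It makes the multiplicities below
vanish on projective modules. -/
theorem exists_yEnd_eq_of_projective [Module.Projective D.H P] (hχ : D.χ ^ D.n = 1) {j : ℕ}
    (hj : j < D.n) (x : P) (hx : (D.yEnd P ^ j) x = 0) : ∃ z, D.yEnd P z = x := by
  obtain ⟨s, p, hsp⟩ := D.exists_retract_ind hχ P
  obtain ⟨z, hz⟩ := D.exists_yEnd_eq_ind (D.rep P) hχ hj (s x)
    (by rw [← hom_yEnd_pow, hx, map_zero])
  refine ⟨p z, ?_⟩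
  rw [← hom_yEnd, hz]
  exact LinearMap.congr_fun hsp x

end projective

end GroupDatum

namespace GroupDatum

variable {K : Type u} {G : Type v} [Field K] [Group G] [Finite G] (D : GroupDatum K G)

section equiv

variable {N N' : Type*} [AddCommGroup N] [Module K N] [Module D.H N] [IsScalarTower K D.H N]
  [AddCommGroup N'] [Module K N'] [Module D.H N'] [IsScalarTower K D.H N']

/-- A linear equivalence that commutes with `G` and with `y` is `H`-linear. -/
def equivOf (e : N ≃ₗ[K] N') (hG : ∀ a x, e (D.rep N a x) = D.rep N' a (e x))
    (hy : ∀ x, e (D.yEnd N x) = D.yEnd N' (e x)) : N ≃ₗ[D.H] N' :=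
  { D.homOf e.toLinearMap hG hy with
    invFun := e.symm
    left_inv := e.left_inv
    right_inv := e.right_inv }

@[simp] theorem equivOf_apply (e : N ≃ₗ[K] N') (hG hy) (x : N) : D.equivOf e hG hy x = e x := rfl

end equiv

/-! ### Tensor products of modules and of morphisms -/

section tensor

variable (M N M' N' : FDModule K D.H)

/-- The identification of the module `M.tensor N` with the tensor product. -/
noncomputable def toT : (M ⊗[K] N) ≃ₗ[K] M.tensor N := LinearEquiv.refl K (M ⊗[K] N)

theorem rep_toT (a : G) (t : M ⊗[K] N) : D.rep (M.tensor N) a (D.toT M N t) =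
    D.toT M N (TensorProduct.map (D.rep M a) (D.rep N a) t) := by
  have : D.rep (M.tensor N) a (D.toT M N t) =
      D.toT M N (Module.endTensorEndAlgHom ((Algebra.TensorProduct.map (Algebra.lsmul K K M)
        (Algebra.lsmul K K N)) (D.comulHom (D.ofG a))) t) := rfl
  rw [this, comulHom_ofG]
  rfl

theorem yEnd_toT (t : M ⊗[K] N) : D.yEnd (M.tensor N) (D.toT M N t) =
    D.toT M N (TensorProduct.map (D.yEnd M) (D.rep N D.g) t +
      TensorProduct.map LinearMap.id (D.yEnd N) t) := by
  have : D.yEnd (M.tensor N) (D.toT M N t) =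
      D.toT M N (Module.endTensorEndAlgHom ((Algebra.TensorProduct.map (Algebra.lsmul K K M)
        (Algebra.lsmul K K N)) (D.comulHom D.y)) t) := rfl
  rw [this, comulHom_y, map_add, map_add, LinearMap.add_apply]
  congr 2
  simp only [Algebra.TensorProduct.map_tmul, map_one, Module.endTensorEndAlgHom_apply]
  rfl

theorem rep_toT_tmul (a : G) (x : M) (z : N) : D.rep (M.tensor N) a (D.toT M N (x ⊗ₜ z)) =
    D.toT M N (D.rep M a x ⊗ₜ D.rep N a z) := by
  rw [rep_toT, TensorProduct.map_tmul]

theorem yEnd_toT_tmul (x : M) (z : N) : D.yEnd (M.tensor N) (D.toT M N (x ⊗ₜ z)) =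
    D.toT M N (D.yEnd M x ⊗ₜ D.rep N D.g z) + D.toT M N (x ⊗ₜ D.yEnd N z) := by
  rw [yEnd_toT, TensorProduct.map_tmul, TensorProduct.map_tmul, map_add, LinearMap.id_apply]

theorem finrank_tensor :
    Module.finrank K (M.tensor N) = Module.finrank K M * Module.finrank K N := by
  rw [← (D.toT M N).finrank_eq, Module.finrank_tensorProduct]

variable {M N M' N'}

/-- The tensor product of two morphisms. -/
noncomputable def tensorMap (φ : M →ₗ[D.H] M') (ψ : N →ₗ[D.H] N') :
    M.tensor N →ₗ[D.H] M'.tensor N' :=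
  D.homOf (D.toT M' N' ∘ₗ TensorProduct.map (φ.restrictScalars K) (ψ.restrictScalars K) ∘ₗ
      (D.toT M N).symm)
    (fun a x => by
      obtain ⟨t, rfl⟩ := (D.toT M N).surjective x
      induction t with
      | zero => simp
      | tmul x z => simp [rep_toT_tmul, hom_rep]
      | add s t hs ht => simp only [map_add, hs, ht])
    (fun x => by
      obtain ⟨t, rfl⟩ := (D.toT M N).surjective x
      induction t with
      | zero => simp
      | tmul x z => simp [yEnd_toT_tmul, hom_rep, hom_yEnd]
      | add s t hs ht => simp only [map_add, hs, ht])

@[simp] theorem tensorMap_toT_tmul (φ : M →ₗ[D.H] M') (ψ : N →ₗ[D.H] N') (x : M) (z : N) :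
    D.tensorMap φ ψ (D.toT M N (x ⊗ₜ z)) = D.toT M' N' (φ x ⊗ₜ ψ z) := rfl

theorem tensor_hom_ext {X : Type*} [AddCommGroup X] [Module K X] [Module D.H X]
    [IsScalarTower K D.H X] {φ ψ : M.tensor N →ₗ[D.H] X}
    (h : ∀ x z, φ (D.toT M N (x ⊗ₜ z)) = ψ (D.toT M N (x ⊗ₜ z))) : φ = ψ := by
  ext x
  obtain ⟨t, rfl⟩ := (D.toT M N).surjective x
  induction t with
  | zero => simp
  | tmul x z => exact h x z
  | add s t hs ht => simp only [map_add, hs, ht]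

theorem submodule_eq_top_of_toT (S : Submodule K (M.tensor N))
    (h : ∀ x z, D.toT M N (x ⊗ₜ z) ∈ S) : S = ⊤ := by
  rw [Submodule.eq_top_iff']
  intro x
  obtain ⟨t, rfl⟩ := (D.toT M N).surjective x
  induction t with
  | zero => simp
  | tmul x z => exact h x z
  | add s t hs ht => rw [map_add]; exact S.add_mem hs ht

theorem tensorMap_comp {M'' N'' : FDModule K D.H} (φ : M →ₗ[D.H] M') (ψ : N →ₗ[D.H] N')
    (φ' : M' →ₗ[D.H] M'') (ψ' : N' →ₗ[D.H] N'') :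
    D.tensorMap (φ' ∘ₗ φ) (ψ' ∘ₗ ψ) = D.tensorMap φ' ψ' ∘ₗ D.tensorMap φ ψ :=
  D.tensor_hom_ext fun _ _ => rfl

theorem tensorMap_id : D.tensorMap (.id : M →ₗ[D.H] M) (.id : N →ₗ[D.H] N) = .id :=
  D.tensor_hom_ext fun _ _ => rfl

theorem tensorMap_sub_right (φ : M →ₗ[D.H] M') (ψ ψ' : N →ₗ[D.H] N') :
    D.tensorMap φ (ψ - ψ') = D.tensorMap φ ψ - D.tensorMap φ ψ' :=
  D.tensor_hom_ext fun _ _ => by simp [TensorProduct.tmul_sub]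

theorem tensorMap_sub_left (φ φ' : M →ₗ[D.H] M') (ψ : N →ₗ[D.H] N') :
    D.tensorMap (φ - φ') ψ = D.tensorMap φ ψ - D.tensorMap φ' ψ :=
  D.tensor_hom_ext fun _ _ => by simp [TensorProduct.sub_tmul]

/-! ### Tensor products with projective modules -/

section generation

variable {V : Type*} [AddCommGroup V] [Module K V] (σ : Representation K G V)

/-- The coproduct gives x ⊗ y z = y(x ⊗ z) − y x ⊗ g z. For z = y^k f(v) the vector g z is a nonzero
multiple of y^k f(g v), so the last term is already in S by induction. -/
theorem tmul_yEnd_pow_mem (f : V →ₗ[K] N) (hf : ∀ a v, f (σ a v) = D.rep N a (f v))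
    (S : Submodule K (M.tensor N)) (hS : ∀ x ∈ S, D.yEnd (M.tensor N) x ∈ S)
    (h : ∀ x v, D.toT M N (x ⊗ₜ f v) ∈ S) (k : ℕ) (x : M) (v : V) :
    D.toT M N (x ⊗ₜ (D.yEnd N ^ k) (f v)) ∈ S := by
  induction k generalizing x v with
  | zero => exact h x v
  | succ k ih =>
    have h1 := hS _ (ih x v)
    rw [yEnd_toT_tmul] at h1
    have h2 : D.toT M N (D.yEnd M x ⊗ₜ D.rep N D.g ((D.yEnd N ^ k) (f v))) ∈ S := by
      have h3 := ih (D.yEnd M x) (σ D.g v)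
      rw [hf, yEnd_pow_rep, TensorProduct.tmul_smul, map_smul] at h3
      exact (S.smul_mem_iff (pow_ne_zero _ (Units.ne_zero _))).mp h3
    rw [pow_succ', Module.End.mul_apply]
    exact (S.add_mem_iff_right h2).mp h1

/-- The coproduct gives y x ⊗ z = y(x ⊗ g⁻¹z) − x ⊗ y g⁻¹z. The induction needs all z at once
because z changes on the right. -/
theorem yEnd_pow_tmul_mem (f : V →ₗ[K] M)
    (S : Submodule K (M.tensor N)) (hS : ∀ x ∈ S, D.yEnd (M.tensor N) x ∈ S)
    (h : ∀ v z, D.toT M N (f v ⊗ₜ z) ∈ S) (k : ℕ) (v : V) (z : N) :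
    D.toT M N ((D.yEnd M ^ k) (f v) ⊗ₜ z) ∈ S := by
  induction k generalizing z with
  | zero => exact h v z
  | succ k ih =>
    have h1 := hS _ (ih (D.rep N D.g⁻¹ z))
    rw [yEnd_toT_tmul, ← Module.End.mul_apply (D.rep N D.g), ← map_mul, mul_inv_cancel, map_one,
      Module.End.one_apply] at h1
    rw [pow_succ', Module.End.mul_apply]
    exact (S.add_mem_iff_left (ih _)).mp h1

end generation

section ind

variable {V : Type u} [AddCommGroup V] [Module K V] [FiniteDimensional K V]
  (σ : Representation K G V) (hχ : D.χ ^ D.n = 1)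

/-- The inclusion of `V` in the induced module. -/
noncomputable def inclInd : V →ₗ[K] D.ind σ hχ :=
  (D.toInd σ hχ).toLinearMap ∘ₗ LinearMap.single K (fun _ => V) ⟨0, D.n_pos⟩

theorem inclInd_equivariant (a : G) (v : V) :
    D.inclInd σ hχ (σ a v) = D.rep (D.ind σ hχ) a (D.inclInd σ hχ v) :=
  (D.rep_toInd_single_zero σ hχ a v).symm

theorem toInd_eq_sum (w : Fin D.n → V) : D.toInd σ hχ w =
    ∑ k : Fin D.n, (D.yEnd (D.ind σ hχ) ^ (k : ℕ)) (D.inclInd σ hχ (w k)) := by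
  conv_lhs => rw [← Finset.univ_sum_single w, map_sum]
  exact Finset.sum_congr rfl fun k _ => D.toInd_single σ hχ k (w k)

/-- The tensor identity M ⊗ Ind V ≅ Ind(M ⊗ V): the subspace M ⊗ V generates under y, and the
dimensions agree. -/
theorem nonempty_equiv_tensor_ind (M : FDModule K D.H) :
    Nonempty (D.ind ((D.rep M).tprod σ) hχ ≃ₗ[D.H] M.tensor (D.ind σ hχ)) := by
  refine D.nonempty_equiv_ind _ hχ
    ((D.toT M (D.ind σ hχ)).toLinearMap ∘ₗ TensorProduct.map LinearMap.id (D.inclInd σ hχ))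
    (fun a t => ?_) (fun S hS h => D.submodule_eq_top_of_toT S fun x z => ?_) ?_
  · induction t with
    | zero => simp
    | tmul x z => simp [rep_toT_tmul, inclInd_equivariant]
    | add s t hs ht => simp only [map_add, hs, ht]
  · obtain ⟨w, rfl⟩ := (D.toInd σ hχ).surjective z
    rw [toInd_eq_sum, TensorProduct.tmul_sum, map_sum]
    exact S.sum_mem fun k _ => D.tmul_yEnd_pow_mem σ (D.inclInd σ hχ)
      (D.inclInd_equivariant σ hχ) S hS (fun x v => h (x ⊗ₜ v)) k x (w k)
  · rw [finrank_tensor, finrank_ind, Module.finrank_tensorProduct]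
    ring

theorem nonempty_equiv_ind_tensor (N : FDModule K D.H) :
    Nonempty (D.ind (σ.tprod (D.rep N)) hχ ≃ₗ[D.H] (D.ind σ hχ).tensor N) := by
  refine D.nonempty_equiv_ind _ hχ
    ((D.toT (D.ind σ hχ) N).toLinearMap ∘ₗ TensorProduct.map (D.inclInd σ hχ) LinearMap.id)
    (fun a t => ?_) (fun S hS h => D.submodule_eq_top_of_toT S fun x z => ?_) ?_
  · induction t with
    | zero => simp
    | tmul x z => simp [rep_toT_tmul, inclInd_equivariant]
    | add s t hs ht => simp only [map_add, hs, ht]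
  · obtain ⟨w, rfl⟩ := (D.toInd σ hχ).surjective x
    rw [toInd_eq_sum, TensorProduct.sum_tmul, map_sum]
    exact S.sum_mem fun k _ => D.yEnd_pow_tmul_mem (D.inclInd σ hχ)
      S hS (fun v z => h (v ⊗ₜ z)) k (w k) z
  · rw [finrank_tensor, finrank_ind, Module.finrank_tensorProduct]
    ring

variable [CharZero K]

include hχ

/-- P is a retract of an induced module, so M ⊗ P is a retract of M ⊗ Ind P, which is itself
induced. With the left-handed version, projectives form a tensor ideal, and the tensor product
descends to the stable category. -/
theorem projective_tensor_right (M P : FDModule K D.H) [Module.Projective D.H P] :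
    Module.Projective D.H (M.tensor P) := by
  obtain ⟨s, p, hsp⟩ := D.exists_retract_ind hχ P
  obtain ⟨e⟩ := D.nonempty_equiv_tensor_ind (D.rep P) hχ M
  have := Module.Projective.of_equiv e
  refine Module.Projective.of_split (D.tensorMap .id s) (D.tensorMap .id p) ?_
  rw [← tensorMap_comp, hsp, LinearMap.comp_id, tensorMap_id]

theorem projective_tensor_left (P N : FDModule K D.H) [Module.Projective D.H P] :
    Module.Projective D.H (P.tensor N) := by
  obtain ⟨s, p, hsp⟩ := D.exists_retract_ind hχ P
  obtain ⟨e⟩ := D.nonempty_equiv_ind_tensor (D.rep P) hχ N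
  have := Module.Projective.of_equiv e
  refine Module.Projective.of_split (D.tensorMap s .id) (D.tensorMap p .id) ?_
  rw [← tensorMap_comp, hsp, LinearMap.comp_id, tensorMap_id]

theorem stablyIso_tensor_right (M : FDModule K D.H) {N N' : FDModule K D.H}
    (h : N.StablyIso N') : (M.tensor N).StablyIso (M.tensor N') := by
  obtain ⟨f, f', ⟨P, hP, a, b, hab⟩, ⟨Q, hQ, c, d, hcd⟩⟩ := h
  refine ⟨D.tensorMap .id f, D.tensorMap .id f',
    ⟨M.tensor P, D.projective_tensor_right hχ M P, D.tensorMap .id a, D.tensorMap .id b, ?_⟩,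
    ⟨M.tensor Q, D.projective_tensor_right hχ M Q, D.tensorMap .id c, D.tensorMap .id d, ?_⟩⟩
  · rw [← tensorMap_comp, ← tensorMap_comp, ← hab, LinearMap.comp_id, tensorMap_sub_right,
      tensorMap_id]
  · rw [← tensorMap_comp, ← tensorMap_comp, ← hcd, LinearMap.comp_id, tensorMap_sub_right,
      tensorMap_id]

theorem stablyIso_tensor_left {M M' : FDModule K D.H} (N : FDModule K D.H)
    (h : M.StablyIso M') : (M.tensor N).StablyIso (M'.tensor N) := by
  obtain ⟨f, f', ⟨P, hP, a, b, hab⟩, ⟨Q, hQ, c, d, hcd⟩⟩ := h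
  refine ⟨D.tensorMap f .id, D.tensorMap f' .id,
    ⟨P.tensor N, D.projective_tensor_left hχ P N, D.tensorMap a .id, D.tensorMap b .id, ?_⟩,
    ⟨Q.tensor N, D.projective_tensor_left hχ Q N, D.tensorMap c .id, D.tensorMap d .id, ?_⟩⟩
  · rw [← tensorMap_comp, ← tensorMap_comp, ← hab, LinearMap.comp_id, tensorMap_sub_left,
      tensorMap_id]
  · rw [← tensorMap_comp, ← tensorMap_comp, ← hcd, LinearMap.comp_id, tensorMap_sub_left,
      tensorMap_id]

end ind

end tensor

/-! ### Isomorphisms between tensor products -/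

section isos

theorem factorsThroughProjective_zero {M N : FDModule K D.H} :
    FDModule.FactorsThroughProjective (0 : M →ₗ[D.H] N) :=
  ⟨{ carrier := PUnit.{u + 1} }, inferInstanceAs (Module.Projective D.H PUnit.{u + 1}), 0, 0,
    by simp⟩

theorem stablyIso_of_equiv {M N : FDModule K D.H} (e : M ≃ₗ[D.H] N) : M.StablyIso N := by
  refine ⟨e, e.symm, ?_, ?_⟩
  · convert D.factorsThroughProjective_zero (M := M) (N := M)
    ext; simp
  · convert D.factorsThroughProjective_zero (M := N) (N := N)
    ext; simp

theorem stablyIso_symm {M N : FDModule K D.H} (h : M.StablyIso N) : N.StablyIso M := by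
  obtain ⟨f, f', h1, h2⟩ := h
  exact ⟨f', f, h2, h1⟩

theorem stablyIso_zero_of_projective (P Z : FDModule K D.H) [hP : Module.Projective D.H P]
    [Subsingleton Z] : P.StablyIso Z := by
  -- The difference 0 − id factors through P itself.
  refine ⟨0, 0, ⟨P, hP, .id, -.id, by ext; simp⟩, ?_⟩
  convert D.factorsThroughProjective_zero (M := Z) (N := Z)
  ext
  exact Subsingleton.elim _ _

/-- The identification of the direct sum of two modules with their product. -/
noncomputable def toS (M N : FDModule K D.H) : (M × N) ≃ₗ[D.H] M.directSum N :=
  LinearEquiv.refl D.H (M × N)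

/-- A module with the projections and inclusions of a biproduct is a direct sum. -/
noncomputable def equivDirectSum {X M N : FDModule K D.H} (p : X →ₗ[D.H] M) (q : X →ₗ[D.H] N)
    (i : M →ₗ[D.H] X) (j : N →ₗ[D.H] X) (hpi : p ∘ₗ i = .id) (hqj : q ∘ₗ j = .id)
    (hpj : p ∘ₗ j = 0) (hqi : q ∘ₗ i = 0) (h : i ∘ₗ p + j ∘ₗ q = .id) :
    X ≃ₗ[D.H] M.directSum N :=
  LinearEquiv.ofLinearMap (p.prod q) (i.coprod j) (by
    apply LinearMap.prod_ext
    · ext x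
      · simpa using LinearMap.congr_fun hpi x
      · simpa using LinearMap.congr_fun hqi x
    · ext x
      · simpa using LinearMap.congr_fun hpj x
      · simpa using LinearMap.congr_fun hqj x) (by
    rw [LinearMap.coprod_comp_prod, h]) ≪≫ₗ D.toS M N

/-- The associativity of the tensor product. -/
noncomputable def tensorAssoc (M N X : FDModule K D.H) :
    (M.tensor N).tensor X ≃ₗ[D.H] M.tensor (N.tensor X) :=
  D.equivOf ((D.toT (M.tensor N) X).symm ≪≫ₗ
      (TensorProduct.congr (D.toT M N).symm (LinearEquiv.refl K X)) ≪≫ₗ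
      TensorProduct.assoc K M N X ≪≫ₗ
      TensorProduct.congr (LinearEquiv.refl K M) (D.toT N X) ≪≫ₗ D.toT M (N.tensor X))
    (fun a x => by
      obtain ⟨t, rfl⟩ := (D.toT (M.tensor N) X).surjective x
      induction t with
      | zero => simp
      | tmul s z =>
        obtain ⟨s, rfl⟩ := (D.toT M N).surjective s
        induction s with
        | zero => simp
        | tmul x y => simp [rep_toT_tmul]
        | add s t hs ht => simp only [map_add, TensorProduct.add_tmul, hs, ht]
      | add s t hs ht => simp only [map_add, hs, ht])
    (fun x => by
      obtain ⟨t, rfl⟩ := (D.toT (M.tensor N) X).surjective x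
      induction t with
      | zero => simp
      | tmul s z =>
        obtain ⟨s, rfl⟩ := (D.toT M N).surjective s
        induction s with
        | zero => simp
        | tmul x y =>
          simp [yEnd_toT_tmul, rep_toT_tmul, TensorProduct.add_tmul, TensorProduct.tmul_add,
            add_assoc]
        | add s t hs ht => simp only [map_add, TensorProduct.add_tmul, hs, ht]
      | add s t hs ht => simp only [map_add, hs, ht])

/-- The distributivity of the tensor product over the direct sum. -/
noncomputable def tensorDirectSum (X M N : FDModule K D.H) :
    X.tensor (M.directSum N) ≃ₗ[D.H] (X.tensor M).directSum (X.tensor N) :=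
  D.equivDirectSum (D.tensorMap .id (LinearMap.fst D.H M N ∘ₗ (D.toS M N).symm))
    (D.tensorMap .id (LinearMap.snd D.H M N ∘ₗ (D.toS M N).symm))
    (D.tensorMap .id (D.toS M N ∘ₗ LinearMap.inl D.H M N))
    (D.tensorMap .id (D.toS M N ∘ₗ LinearMap.inr D.H M N))
    (D.tensor_hom_ext fun x z => by simp) (D.tensor_hom_ext fun x z => by simp)
    (D.tensor_hom_ext fun x z => by simp) (D.tensor_hom_ext fun x z => by simp)
    (D.tensor_hom_ext fun x z => by
      obtain ⟨z, rfl⟩ := (D.toS M N).surjective z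
      simp only [LinearMap.add_apply, LinearMap.comp_apply, tensorMap_toT_tmul, LinearMap.id_apply,
        LinearEquiv.coe_coe, LinearEquiv.symm_apply_apply, ← map_add, ← TensorProduct.tmul_add]
      simp)

/-- The distributivity of the tensor product over the direct sum. -/
noncomputable def directSumTensor (M N X : FDModule K D.H) :
    (M.directSum N).tensor X ≃ₗ[D.H] (M.tensor X).directSum (N.tensor X) :=
  D.equivDirectSum (D.tensorMap (LinearMap.fst D.H M N ∘ₗ (D.toS M N).symm) .id)
    (D.tensorMap (LinearMap.snd D.H M N ∘ₗ (D.toS M N).symm) .id)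
    (D.tensorMap (D.toS M N ∘ₗ LinearMap.inl D.H M N) .id)
    (D.tensorMap (D.toS M N ∘ₗ LinearMap.inr D.H M N) .id)
    (D.tensor_hom_ext fun x z => by simp) (D.tensor_hom_ext fun x z => by simp)
    (D.tensor_hom_ext fun x z => by simp) (D.tensor_hom_ext fun x z => by simp)
    (D.tensor_hom_ext fun z x => by
      obtain ⟨z, rfl⟩ := (D.toS M N).surjective z
      simp only [LinearMap.add_apply, LinearMap.comp_apply, tensorMap_toT_tmul, LinearMap.id_apply,
        LinearEquiv.coe_coe, LinearEquiv.symm_apply_apply, ← map_add, ← TensorProduct.add_tmul]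
      simp)

/-- The identification of the trivial module with `K`. -/
noncomputable def toTriv : K ≃ₗ[K] FDModule.trivial K D.H := LinearEquiv.refl K K

theorem rep_toTriv (a : G) (c : K) :
    D.rep (FDModule.trivial K D.H) a (D.toTriv c) = D.toTriv c := by
  have : D.rep (FDModule.trivial K D.H) a (D.toTriv c) = D.toTriv (D.counitHom (D.ofG a) * c) := rfl
  rw [this, counitHom_ofG, one_mul]

theorem yEnd_toTriv (c : K) : D.yEnd (FDModule.trivial K D.H) (D.toTriv c) = 0 := by
  have : D.yEnd (FDModule.trivial K D.H) (D.toTriv c) = D.toTriv (D.counitHom D.y * c) := rfl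
  rw [this, counitHom_y, zero_mul, map_zero]

/-- The trivial module is a left unit. -/
noncomputable def trivialTensor (X : FDModule K D.H) :
    (FDModule.trivial K D.H).tensor X ≃ₗ[D.H] X :=
  D.equivOf ((D.toT (FDModule.trivial K D.H) X).symm ≪≫ₗ
      TensorProduct.congr D.toTriv.symm (LinearEquiv.refl K X) ≪≫ₗ TensorProduct.lid K X)
    (fun a x => by
      obtain ⟨t, rfl⟩ := (D.toT (FDModule.trivial K D.H) X).surjective x
      induction t with
      | zero => simp
      | tmul c x =>
        obtain ⟨c, rfl⟩ := D.toTriv.surjective c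
        simp [rep_toT_tmul, rep_toTriv]
      | add s t hs ht => simp only [map_add, hs, ht])
    (fun x => by
      obtain ⟨t, rfl⟩ := (D.toT (FDModule.trivial K D.H) X).surjective x
      induction t with
      | zero => simp
      | tmul c x =>
        obtain ⟨c, rfl⟩ := D.toTriv.surjective c
        simp [yEnd_toT_tmul, yEnd_toTriv]
      | add s t hs ht => simp only [map_add, hs, ht])

/-- The trivial module is a right unit. -/
noncomputable def tensorTrivial (X : FDModule K D.H) :
    X.tensor (FDModule.trivial K D.H) ≃ₗ[D.H] X :=
  D.equivOf ((D.toT X (FDModule.trivial K D.H)).symm ≪≫ₗ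
      TensorProduct.congr (LinearEquiv.refl K X) D.toTriv.symm ≪≫ₗ TensorProduct.rid K X)
    (fun a x => by
      obtain ⟨t, rfl⟩ := (D.toT X (FDModule.trivial K D.H)).surjective x
      induction t with
      | zero => simp
      | tmul x c =>
        obtain ⟨c, rfl⟩ := D.toTriv.surjective c
        simp [rep_toT_tmul, rep_toTriv]
      | add s t hs ht => simp only [map_add, hs, ht])
    (fun x => by
      obtain ⟨t, rfl⟩ := (D.toT X (FDModule.trivial K D.H)).surjective x
      induction t with
      | zero => simp
      | tmul x c =>
        obtain ⟨c, rfl⟩ := D.toTriv.surjective c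
        simp [yEnd_toT_tmul, yEnd_toTriv, rep_toTriv]
      | add s t hs ht => simp only [map_add, hs, ht])

end isos

end GroupDatum

namespace GroupDatum

variable {K : Type u} {G : Type v} [Field K] [Group G] [Finite G] (D : GroupDatum K G)

/-! ### Multiplicities of the modules `M(j, V)` -/

section mult

variable {W : Type*} [AddCommGroup W] [Module K W] (τ : Representation K G W) (S : Set G) (j : ℕ)
  (X Y : FDModule K D.H)

/-- The linear maps `W → X` that commute with the elements of `S` and are killed by `y ^ j`. -/
def cyc : Submodule K (W →ₗ[K] X) where
  carrier := {f | (∀ a ∈ S, ∀ w, f (τ a w) = D.rep X a (f w)) ∧ ∀ w, (D.yEnd X ^ j) (f w) = 0}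
  zero_mem' := by simp
  add_mem' := fun hf hg => ⟨fun a ha w => by simp [hf.1 a ha, hg.1 a ha], fun w => by
    rw [LinearMap.add_apply, map_add, hf.2, hg.2, add_zero]⟩
  smul_mem' := fun c f hf => ⟨fun a ha w => by simp [hf.1 a ha], fun w => by
    rw [LinearMap.smul_apply, map_smul, hf.2, smul_zero]⟩

/-- The sum of the kernel of `y ^ (j - 1)` and the image of `y`. -/
noncomputable def radY : Submodule K X :=
  LinearMap.ker (D.yEnd X ^ (j - 1)) ⊔ LinearMap.range (D.yEnd X)

/-- The linear maps `W → X` with values in the sum of the kernel of `y ^ (j - 1)` and the image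
of `y`, among those of `cyc`. -/
def bdr : Submodule K (D.cyc τ S j X) where
  carrier := {f | ∀ w, f.1 w ∈ D.radY j X}
  zero_mem' := fun _ => zero_mem _
  add_mem' := fun hf hg w => add_mem (hf w) (hg w)
  smul_mem' := fun c _ hf w => Submodule.smul_mem _ c (hf w)

/-- The number of direct summands `M(j, V)` of `X`, weighted with the dimension of the space of
`S`-equivariant maps `W → V`. -/
noncomputable def mult : ℕ := Module.finrank K (D.cyc τ S j X ⧸ D.bdr τ S j X)

variable {X Y}

/-- The map induced on `cyc` by a morphism of modules. -/
noncomputable def cycMap (φ : X →ₗ[D.H] Y) : D.cyc τ S j X →ₗ[K] D.cyc τ S j Y :=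
  ((LinearMap.compRight K (φ.restrictScalars K) : (W →ₗ[K] X) →ₗ[K] (W →ₗ[K] Y)).comp
    (D.cyc τ S j X).subtype).codRestrict _ fun f => ⟨fun a ha w => by
      simp [f.2.1 a ha, hom_rep], fun w => by simp [← hom_yEnd_pow, f.2.2]⟩

@[simp] theorem cycMap_apply (φ : X →ₗ[D.H] Y) (f : D.cyc τ S j X) (w : W) :
    (D.cycMap τ S j φ f).1 w = φ (f.1 w) := rfl

theorem map_mem_radY (φ : X →ₗ[D.H] Y) {x : X} (hx : x ∈ D.radY j X) : φ x ∈ D.radY j Y := by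
  obtain ⟨a, ha, _, ⟨b, rfl⟩, rfl⟩ := Submodule.mem_sup.mp hx
  rw [map_add, hom_yEnd]
  refine add_mem (Submodule.mem_sup_left ?_) (Submodule.mem_sup_right ⟨_, rfl⟩)
  rw [LinearMap.mem_ker] at ha ⊢
  rw [← hom_yEnd_pow, ha, map_zero]

/-- The map induced by a morphism of modules on `cyc` modulo `bdr`. -/
noncomputable def multMap (φ : X →ₗ[D.H] Y) :
    (D.cyc τ S j X ⧸ D.bdr τ S j X) →ₗ[K] (D.cyc τ S j Y ⧸ D.bdr τ S j Y) :=
  Submodule.mapQ _ _ (D.cycMap τ S j φ) fun _ hf w => D.map_mem_radY j φ (hf w)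

theorem multMap_id : D.multMap τ S j (.id : X →ₗ[D.H] X) = .id := by
  apply Submodule.linearMap_qext
  rfl

theorem multMap_comp {Z : FDModule K D.H} (φ : X →ₗ[D.H] Y) (ψ : Y →ₗ[D.H] Z) :
    D.multMap τ S j (ψ ∘ₗ φ) = D.multMap τ S j ψ ∘ₗ D.multMap τ S j φ := by
  apply Submodule.linearMap_qext
  rfl

theorem multMap_add (φ ψ : X →ₗ[D.H] Y) :
    D.multMap τ S j (φ + ψ) = D.multMap τ S j φ + D.multMap τ S j ψ := by
  apply Submodule.linearMap_qext
  rfl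

theorem multMap_zero : D.multMap τ S j (0 : X →ₗ[D.H] Y) = 0 := by
  have := D.multMap_add τ S j (0 : X →ₗ[D.H] Y) 0
  rwa [add_zero, left_eq_add] at this

theorem multMap_sub (φ ψ : X →ₗ[D.H] Y) :
    D.multMap τ S j (φ - ψ) = D.multMap τ S j φ - D.multMap τ S j ψ := by
  rw [eq_sub_iff_add_eq, ← multMap_add, sub_add_cancel]

theorem subsingleton_mult
    (h : ∀ x : X, (D.yEnd X ^ j) x = 0 → x ∈ D.radY j X) :
    Subsingleton (D.cyc τ S j X ⧸ D.bdr τ S j X) := by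
  rw [Submodule.Quotient.subsingleton_iff, Submodule.eq_top_iff']
  exact fun f w => h _ (f.2.2 w)

theorem mult_eq_zero (h : ∀ x : X, (D.yEnd X ^ j) x = 0 → x ∈ D.radY j X) :
    D.mult τ S j X = 0 := by
  have := D.subsingleton_mult τ S j h
  exact Module.finrank_zero_of_subsingleton

/-- On a projective module ker y^j lies in im y for j < n, so the functor vanishes there and kills
everything that factors through it. -/
theorem multMap_eq_zero (hχ : D.χ ^ D.n = 1) (hj : j < D.n) {φ : X →ₗ[D.H] Y}
    (hφ : FDModule.FactorsThroughProjective φ) : D.multMap τ S j φ = 0 := by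
  obtain ⟨P, hP, a, b, rfl⟩ := hφ
  have := D.subsingleton_mult (X := P) τ S j fun x hx =>
    Submodule.mem_sup_right (D.exists_yEnd_eq_of_projective P hχ hj x hx)
  rw [multMap_comp]
  refine LinearMap.ext fun x => ?_
  rw [LinearMap.comp_apply, Subsingleton.elim (D.multMap τ S j a x) 0, map_zero]
  rfl

/-- An additive functor that kills projectives sends mutually inverse stable morphisms to inverse
isomorphisms. -/
theorem mult_congr (hχ : D.χ ^ D.n = 1) (hj : j < D.n) (h : X.StablyIso Y) :
    D.mult τ S j X = D.mult τ S j Y := by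
  obtain ⟨f, f', h1, h2⟩ := h
  have e1 := D.multMap_eq_zero τ S j hχ hj h1
  have e2 := D.multMap_eq_zero τ S j hχ hj h2
  rw [multMap_sub, multMap_comp, multMap_id, sub_eq_zero] at e1 e2
  exact (LinearEquiv.ofLinearMap _ _ e2 e1).finrank_eq

theorem mult_directSum [FiniteDimensional K W] (X Y : FDModule K D.H) :
    D.mult τ S j (X.directSum Y) = D.mult τ S j X + D.mult τ S j Y := by
  rw [mult, mult, mult, ← Module.finrank_prod]
  refine LinearEquiv.finrank_eq (LinearEquiv.ofLinearMap
    ((D.multMap τ S j (LinearMap.fst D.H X Y ∘ₗ (D.toS X Y).symm)).prod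
      (D.multMap τ S j (LinearMap.snd D.H X Y ∘ₗ (D.toS X Y).symm)))
    ((D.multMap τ S j (D.toS X Y ∘ₗ LinearMap.inl D.H X Y)).coprod
      (D.multMap τ S j (D.toS X Y ∘ₗ LinearMap.inr D.H X Y))) ?_ ?_)
  · apply LinearMap.prod_ext
    · rw [LinearMap.comp_assoc, LinearMap.coprod_inl, LinearMap.prod_comp, ← multMap_comp,
        ← multMap_comp, LinearMap.id_comp]
      exact congrArg₂ LinearMap.prod (D.multMap_id τ S j) (D.multMap_zero τ S j)
    · rw [LinearMap.comp_assoc, LinearMap.coprod_inr, LinearMap.prod_comp, ← multMap_comp,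
        ← multMap_comp, LinearMap.id_comp]
      exact congrArg₂ LinearMap.prod (D.multMap_zero τ S j) (D.multMap_id τ S j)
  · rw [LinearMap.coprod_comp_prod, ← multMap_comp, ← multMap_comp, ← multMap_add, ← multMap_id]
    congr 1
    ext x
    obtain ⟨z, rfl⟩ := (D.toS X Y).surjective x
    simp [← map_add]

theorem mult_subsingleton (Z : FDModule K D.H) [Subsingleton Z] : D.mult τ S j Z = 0 :=
  D.mult_eq_zero τ S j fun x _ => by rw [Subsingleton.elim x 0]; exact zero_mem _

section M

variable {V : Type u} [AddCommGroup V] [Module K V] [FiniteDimensional K V]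
  (σ : Representation K G V) (hσ : σ (D.g ^ D.n) = 1)

/-- The linear maps that commute with the elements of a set `S` of group elements. -/
def homSet : Submodule K (W →ₗ[K] V) where
  carrier := {f | ∀ a ∈ S, ∀ w, f (τ a w) = σ a (f w)}
  zero_mem' := by simp
  add_mem' := fun hf hg a ha w => by simp [hf a ha, hg a ha]
  smul_mem' := fun c f hf a ha w => by simp [hf a ha]

theorem mem_range_yEnd_M {k : ℕ} {hk : k ≤ D.n} (w : Fin k → V) (hw : ∀ h, w ⟨0, h⟩ = 0) :
    D.toM σ hσ k hk w ∈ LinearMap.range (D.yEnd (D.M σ hσ k hk)) := by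
  refine ⟨D.toM σ hσ k hk fun l => if h : (l : ℕ) + 1 < k then w ⟨l + 1, h⟩ else 0, ?_⟩
  rw [yEnd_toM]
  congr 1
  funext l
  have hl := l.2
  rw [actY_apply]
  split_ifs with h1 h2
  · rw [show l = ⟨0, by omega⟩ from Fin.ext h1, hw]
  · congr 1; ext; simp; omega
  · simp at h2; omega

/-- If k < j, then y^(j−1) = 0 on M(k, V). If k > j, a vector killed by y^j has zero component in
degree 0, hence lies in im y. -/
theorem mult_M_of_ne {j k : ℕ} (hj : 0 < j) {hk : k ≤ D.n} (hjk : k ≠ j) :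
    D.mult τ S j (D.M σ hσ k hk) = 0 := by
  refine D.mult_eq_zero τ S j fun x hx => ?_
  obtain ⟨w, rfl⟩ := (D.toM σ hσ k hk).surjective x
  rw [yEnd_pow_toM, LinearEquiv.map_eq_zero_iff] at hx
  rcases lt_or_gt_of_ne hjk with h | h
  · refine Submodule.mem_sup_left ?_
    rw [LinearMap.mem_ker, yEnd_pow_toM, actY_pow_eq_zero (by omega), LinearMap.zero_apply, map_zero]
  · refine Submodule.mem_sup_right (D.mem_range_yEnd_M σ hσ w fun _ => ?_)
    -- Coordinate j of y^j w is coordinate 0 of w.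
    have := congrFun hx ⟨j, h⟩
    rw [actY_pow_apply, if_neg (by simp)] at this
    simpa using this

/-- Here y^j = 0, while ker y^(j−1) + im y consists of the vectors with zero component in degree 0.
Reading off that component identifies the quotient with the equivariant maps W → V. -/
theorem mult_M_self {j : ℕ} (hj : 0 < j) {hk : j ≤ D.n} :
    D.mult τ S j (D.M σ hσ j hk) = Module.finrank K (homSet τ S σ) := by
  set X := D.M σ hσ j hk
  let L : D.cyc τ S j X →ₗ[K] homSet τ S σ :=
    ((LinearMap.compRight K (LinearMap.proj (⟨0, hj⟩ : Fin j) ∘ₗ (D.toM σ hσ j hk).symm.toLinearMap) :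
      (W →ₗ[K] X) →ₗ[K] (W →ₗ[K] V)).comp (D.cyc τ S j X).subtype).codRestrict _
      fun f a ha w => by
        obtain ⟨z, hz⟩ := (D.toM σ hσ j hk).surjective (f.1 w)
        simp [f.2.1 a ha, ← hz, X, rep_toM, actG]
  have hL : Function.Surjective L := by
    rintro ⟨f, hf⟩
    refine ⟨⟨(D.toM σ hσ j hk).toLinearMap ∘ₗ LinearMap.single K (fun _ => V) ⟨0, hj⟩ ∘ₗ f,
      fun a ha w => ?_, fun w => ?_⟩, ?_⟩
    · simp [X, rep_toM, actG_single, hf a ha]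
    · simp only [LinearMap.comp_apply, LinearEquiv.coe_coe, X]
      rw [yEnd_pow_toM, actY_pow_eq_zero le_rfl, LinearMap.zero_apply, map_zero]
    · refine Subtype.ext (LinearMap.ext fun w => ?_)
      change (D.toM σ hσ j hk).symm (D.toM σ hσ j hk (Pi.single ⟨0, hj⟩ (f w))) ⟨0, hj⟩ = f w
      rw [LinearEquiv.symm_apply_apply, Pi.single_eq_same]
  have hker : D.bdr τ S j X = LinearMap.ker L := by
    ext f
    have key : ∀ w : Fin j → V, D.toM σ hσ j hk w ∈ D.radY j X ↔ w ⟨0, hj⟩ = 0 := by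
      intro w
      constructor
      · intro h
        obtain ⟨a, ha, _, ⟨b, rfl⟩, hab⟩ := Submodule.mem_sup.mp h
        obtain ⟨a, rfl⟩ := (D.toM σ hσ j hk).surjective a
        obtain ⟨b, rfl⟩ := (D.toM σ hσ j hk).surjective b
        rw [LinearMap.mem_ker, yEnd_pow_toM, LinearEquiv.map_eq_zero_iff] at ha
        rw [yEnd_toM, ← map_add] at hab
        have ha' := congrFun ha ⟨j - 1, by omega⟩
        rw [actY_pow_apply, if_neg (by simp)] at ha'
        rw [← (D.toM σ hσ j hk).injective hab, Pi.add_apply, actY_apply, if_pos rfl, add_zero]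
        simpa using ha'
      · intro h
        exact Submodule.mem_sup_right (D.mem_range_yEnd_M σ hσ w fun _ => h)
    have e : f ∈ D.bdr τ S j X ↔ ∀ w, (D.toM σ hσ j hk).symm (f.1 w) ⟨0, hj⟩ = 0 := by
      refine forall_congr' fun w => ?_
      rw [← key, LinearEquiv.apply_symm_apply]
    rw [e, LinearMap.mem_ker, Subtype.ext_iff, LinearMap.ext_iff]
    rfl
  rw [mult, hker]
  exact (L.quotKerEquivOfSurjective hL).finrank_eq

end M

end mult

end GroupDatum

/-! ### Simple subrepresentations outside a proper subrepresentation -/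

section simple

variable {K : Type u} {G : Type v} [Field K] [Group G]

/-- The subrepresentations of A are those of σ contained in A. -/
theorem Subrepresentation.isIrreducible_of_isAtom {N : Type*} [AddCommGroup N] [Module K N]
    {σ : Representation K G N} {A : Subrepresentation σ} (hA : IsAtom A) :
    A.toRepresentation.IsIrreducible := by
  have hmap : ∀ B : Subrepresentation A.toRepresentation,
      ∃ B' : Subrepresentation σ, B' ≤ A ∧ ∀ x : A.toSubmodule, x ∈ B ↔ (x : N) ∈ B' := by
    intro B
    refine ⟨⟨B.toSubmodule.map A.toSubmodule.subtype, ?_⟩, ?_, fun x => ?_⟩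
    · rintro a _ ⟨x, hx, rfl⟩
      exact ⟨A.toRepresentation a x, B.apply_mem_toSubmodule a hx, rfl⟩
    · rintro _ ⟨x, _, rfl⟩
      exact x.2
    · constructor
      · intro hx
        exact ⟨x, hx, rfl⟩
      · rintro ⟨z, hz, hzx⟩
        rwa [← Subtype.ext hzx]
  have hne : ∃ x ∈ A, x ≠ 0 := by
    by_contra h
    push Not at h
    exact hA.1 (le_bot_iff.mp fun x hx => by rw [h x hx]; exact zero_mem (⊥ : Submodule K N))
  refine { exists_pair_ne := ⟨⊥, ⊤, fun h => ?_⟩, eq_bot_or_eq_top := fun B => ?_ }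
  · obtain ⟨x, hx, hx0⟩ := hne
    have h1 : (⟨x, hx⟩ : A.toSubmodule) ∈ (⊤ : Subrepresentation A.toRepresentation) :=
      Submodule.mem_top (R := K)
    rw [← h] at h1
    exact hx0 (congrArg Subtype.val ((Submodule.mem_bot K).mp h1))
  · obtain ⟨B', hB', hB⟩ := hmap B
    rcases hA.le_iff.mp hB' with h | h
    · left
      refine le_bot_iff.mp fun x hx => ?_
      rw [hB, h] at hx
      exact (Submodule.mem_bot K).mpr (Subtype.ext ((Submodule.mem_bot K).mp hx))
    · right
      refine top_le_iff.mp fun x _ => ?_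
      rw [hB, h]
      exact x.2

variable [CharZero K] [Finite G] {Ω : Type*} {V : Ω → Type u} [∀ i, AddCommGroup (V i)]
  [∀ i, Module K (V i)] {ρ : ∀ i, Representation K G (V i)}

/-- A proper subrepresentation misses the image of a simple module. -/
theorem IsCompleteSimpleSet.exists_hom_not_mem (hρ : IsCompleteSimpleSet ρ) {N : Type u}
    [AddCommGroup N] [Module K N] [FiniteDimensional K N] (σ : Representation K G N)
    (p : Submodule K N) (hp : ∀ a, ∀ x ∈ p, σ a x ∈ p) (htop : p ≠ ⊤) :
    ∃ i, ∃ f : V i →ₗ[K] N, (∀ a v, f (ρ i a v) = σ a (f v)) ∧ Function.Injective f ∧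
      ∀ v, f v ∈ p → v = 0 := by
  have : NeZero (Nat.card G : K) := ⟨by exact_mod_cast Nat.card_pos.ne'⟩
  let p' : Subrepresentation σ := ⟨p, fun a x hx => hp a x hx⟩
  let e := Subrepresentation.subrepresentationSubmoduleOrderIso (ρ := σ)
  have hat : IsAtomic (Subrepresentation σ) := e.isAtomic_iff.mpr inferInstance
  have hco : ComplementedLattice (Subrepresentation σ) := e.complementedLattice_iff.mpr inferInstance
  -- By Maschke p has a complement q, nonzero since p is proper. An atom below q is a simple
  -- representation that meets p trivially.
  obtain ⟨q, hq⟩ := exists_isCompl p'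
  have hq0 : q ≠ ⊥ := by
    rintro rfl
    exact htop (congrArg Subrepresentation.toSubmodule (eq_top_of_isCompl_bot hq))
  obtain ⟨A, hA, hAq⟩ := (eq_bot_or_exists_atom_le q).resolve_left hq0
  obtain ⟨i, ⟨φ⟩⟩ := hρ.2.2 A.toSubmodule A.toRepresentation
    (Subrepresentation.isIrreducible_of_isAtom hA)
  refine ⟨i, A.toSubmodule.subtype ∘ₗ φ.symm.toLinearEquiv.toLinearMap, fun a v => ?_, ?_, ?_⟩
  · exact congrArg Subtype.val (Representation.IntertwiningMap.isIntertwining (ρ i) A.toRepresentation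
      φ.symm.toIntertwiningMap a v)
  · exact Subtype.val_injective.comp φ.symm.toLinearEquiv.injective
  · intro v hv
    have h1 : ((φ.symm v : A.toSubmodule) : N) ∈ p' ⊓ q := ⟨hv, hAq (φ.symm v).2⟩
    rw [hq.inf_eq_bot] at h1
    have h2 : φ.symm v = 0 := Subtype.ext ((Submodule.mem_bot K).mp h1)
    exact φ.symm.toLinearEquiv.map_eq_zero_iff.mp h2

end simple

namespace GroupDatum

variable {K : Type u} {G : Type v} [Field K] [Group G] [Finite G] (D : GroupDatum K G)

/-! ### Decomposition of modules -/

section split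

/-- A submodule as a finite dimensional module. -/
noncomputable def ofSubmodule {X : FDModule K D.H} (C : Submodule D.H X) : FDModule K D.H :=
  haveI : FiniteDimensional K C :=
    FiniteDimensional.of_injective (C.subtype.restrictScalars K) C.subtype_injective
  { carrier := C }

/-- A retract is a direct summand. -/
theorem exists_directSum_of_retract {X M : FDModule K D.H} (φ : M →ₗ[D.H] X) (r : X →ₗ[D.H] M)
    (h : r ∘ₗ φ = .id) : ∃ (C : FDModule K D.H) (e : X ≃ₗ[D.H] M.directSum C),
      ∀ m, e (φ m) = D.toS M C (m, 0) := by
  have hr : ∀ m, r (φ m) = m := LinearMap.congr_fun h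
  refine ⟨D.ofSubmodule (LinearMap.ker r), D.equivDirectSum r
    (N := D.ofSubmodule (LinearMap.ker r))
    ((LinearMap.id - φ ∘ₗ r).codRestrict (LinearMap.ker r) fun x => by simp [hr]) φ
    (LinearMap.ker r).subtype h ?_ ?_ ?_ ?_, fun m => ?_⟩
  · refine LinearMap.ext fun x => Subtype.ext ?_
    have hx := LinearMap.mem_ker.mp x.2
    change x.1 - φ (r x.1) = x.1
    rw [hx, map_zero, sub_zero]
  · exact LinearMap.ext fun x => x.2
  · refine LinearMap.ext fun x => Subtype.ext ?_
    change φ x - φ (r (φ x)) = 0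
    rw [hr, sub_self]
  · refine LinearMap.ext fun x => ?_
    change φ (r x) + (x - φ (r x)) = x
    abel
  · refine congrArg (D.toS _ _) (Prod.ext (hr m) (Subtype.ext ?_))
    change φ m - φ (r (φ m)) = 0
    rw [hr, sub_self]

variable [CharZero K] {V : Type u} [AddCommGroup V] [Module K V] [FiniteDimensional K V]
  (σ : Representation K G V) (hσ : σ (D.g ^ D.n) = 1)

/-- An equivariant image of `V` on which `y ^ (j - 1)` is injective generates a direct summand
`M(j, V)`, if `y ^ j = 0`. -/
theorem exists_directSum_M {X : FDModule K D.H} {j : ℕ} (hj : 0 < j) (hjn : j ≤ D.n)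
    (hX : D.yEnd X ^ j = 0) (f : V →ₗ[K] X) (hf : ∀ a v, f (σ a v) = D.rep X a (f v))
    (hinj : ∀ v, (D.yEnd X ^ (j - 1)) (f v) = 0 → v = 0) :
    ∃ (C : FDModule K D.H) (e : X ≃ₗ[D.H] (D.M σ hσ j hjn).directSum C),
      ∀ v, e (f v) = D.toS _ C (D.toM σ hσ j hjn (Pi.single ⟨0, hj⟩ v), 0) := by
  have hy : ∀ v, (D.yEnd X ^ j) (f v) = 0 := fun v => by rw [hX, LinearMap.zero_apply]
  have hi : Function.Injective (D.extend j f) := by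
    -- In a relation ∑ y^l f(w_l) = 0, apply y^(j−1−k): terms with l < k vanish by induction, those
    -- with l > k because y^j = 0, and y^(j−1) f(w_k) = 0 remains.
    rw [← LinearMap.ker_eq_bot, LinearMap.ker_eq_bot']
    intro w hw
    have key : ∀ k (hk : k < j), w ⟨k, hk⟩ = 0 := by
      intro k
      induction k using Nat.strong_induction_on with
      | _ k ih =>
      intro hk
      apply hinj
      have h1 : (D.yEnd X ^ (j - 1 - k)) (D.extend j f w) = 0 := by rw [hw, map_zero]
      simp only [extend, LinearMap.sum_apply, LinearMap.comp_apply, LinearMap.proj_apply,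
        map_sum] at h1
      rw [Finset.sum_eq_single ⟨k, hk⟩] at h1
      · rw [← Module.End.mul_apply, ← pow_add, show j - 1 - k + k = j - 1 by omega] at h1
        exact h1
      · intro l _ hl
        have hl' : (l : ℕ) ≠ k := fun h => hl (Fin.ext h)
        rcases lt_or_gt_of_ne hl' with h | h
        · rw [show w l = 0 from ih l h l.2, map_zero, map_zero, map_zero]
        · rw [← Module.End.mul_apply, ← pow_add,
            show j - 1 - k + l = (l - 1 - k) + j by omega, pow_add, hX, mul_zero,
            LinearMap.zero_apply]
      · simp
    funext k
    exact key k k.2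
  obtain ⟨ψ, hψ, hψf⟩ := exists_equivariant_retraction (D.actG σ j) (D.rep X) (D.extend j f)
    (D.extend_actG σ j f hf) hi
  -- The retraction ψ is only G-equivariant. Compatibility with y forces coordinate k of x to be the
  -- last coordinate of y^(j−1−k) x, so r is rebuilt from the last coordinate of ψ.
  let r : X →ₗ[K] (Fin j → V) := LinearMap.pi fun k =>
    LinearMap.proj (⟨j - 1, by omega⟩ : Fin j) ∘ₗ ψ ∘ₗ D.yEnd X ^ (j - 1 - (k : ℕ))
  have hr : ∀ x k, r x k = ψ ((D.yEnd X ^ (j - 1 - (k : ℕ))) x) ⟨j - 1, by omega⟩ :=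
    fun _ _ => rfl
  let R : X →ₗ[D.H] D.M σ hσ j hjn := D.homOf ((D.toM σ hσ j hjn).toLinearMap ∘ₗ r)
    (fun a x => by
      simp only [LinearMap.comp_apply, LinearEquiv.coe_coe, rep_toM]
      congr 1
      funext k
      have hk := k.2
      rw [hr, yEnd_pow_rep, map_smul, hψ]
      simp only [actG, MonoidHom.coe_mk, OneHom.coe_mk, LinearMap.pi_apply, LinearMap.smul_apply,
        LinearMap.comp_apply, LinearMap.proj_apply, Pi.smul_apply, smul_smul, hr]
      congr 1
      -- The power of y gives χ^(j−1−k) and the last coordinate χ^(−(j−1)), with product χ^(−k).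
      rw [← Units.val_pow_eq_pow_val, ← Units.val_mul, inv_pow, inv_pow]
      congr 1
      rw [mul_inv_eq_iff_eq_mul, eq_inv_mul_iff_mul_eq, ← pow_add]
      congr 1
      omega)
    (fun x => by
      simp only [LinearMap.comp_apply, LinearEquiv.coe_coe, yEnd_toM]
      congr 1
      funext k
      have hk := k.2
      rw [hr, actY_apply, ← Module.End.mul_apply, ← pow_succ]
      split_ifs with h
      · rw [h, show j - 1 - 0 + 1 = j by omega, hX, LinearMap.zero_apply, map_zero]
        rfl
      · rw [hr]
        simp only
        rw [show j - 1 - (k : ℕ) + 1 = j - 1 - (k - 1) by omega])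
  have hR : R ∘ₗ D.homM σ hσ j hjn f hf hy = .id := by
    refine D.homM_ext σ hσ j hjn fun h0 v => ?_
    rw [LinearMap.comp_apply, homM_toM, extend_single, LinearMap.id_apply]
    refine congrArg (D.toM σ hσ j hjn) (funext fun k => ?_)
    have hk := k.2
    change r _ k = _
    rw [hr]
    -- y^(j−1−k) f(v) has degree j − 1 − k, and this is the last degree only for k = 0.
    have h1 := D.extend_single j f ⟨j - 1 - (k : ℕ), by omega⟩ v
    simp only at h1
    rw [pow_zero, Module.End.one_apply, ← h1, hψf]
    simp only [Pi.single_apply, Fin.ext_iff]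
    split_ifs <;> first | rfl | omega
  obtain ⟨C, e, he⟩ := D.exists_directSum_of_retract _ R hR
  refine ⟨C, e, fun v => ?_⟩
  rw [← he, homM_toM, extend_single, pow_zero, Module.End.one_apply]

end split

end GroupDatum

theorem IsCompleteSimpleSet.finrank_pos {K : Type u} {G : Type v} [Field K] [Group G] {Ω : Type*}
    {V : Ω → Type u} [∀ i, AddCommGroup (V i)] [∀ i, Module K (V i)] {ρ : ∀ i, Representation K G (V i)}
    (hρ : IsCompleteSimpleSet ρ) (i : Ω) [FiniteDimensional K (V i)] :
    0 < Module.finrank K (V i) := by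
  have := hρ.1 i
  have : Nontrivial (V i) := by
    by_contra h
    rw [not_nontrivial_iff_subsingleton] at h
    exact bot_ne_top (α := Subrepresentation (ρ i)) (Subrepresentation.toSubmodule_injective
      (Subsingleton.elim _ _))
  exact Module.finrank_pos

namespace GroupDatum

variable {K : Type u} {G : Type v} [Field K] [Group G] [Finite G] (D : GroupDatum K G)

/-! ### The invariants of g^n and the projectivity of their complement -/

section fixed

variable (X : FDModule K D.H)

/-- The action of the central element `g ^ n`. -/
noncomputable def gn : Module.End K X := D.rep X (D.g ^ D.n)

theorem commute_gn_rep (a : G) : Commute (D.gn X) (D.rep X a) := by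
  have := Subgroup.mem_center_iff.mp (Subgroup.pow_mem _ D.g_mem_center D.n) a
  rw [commute_iff_eq, gn, ← map_mul, ← map_mul, this]

theorem commute_gn_yEnd : Commute (D.gn X) (D.yEnd X) := by
  have hχ : D.χ (D.g ^ D.n) = 1 := by
    rw [map_pow]
    exact pow_orderOf_eq_one _
  refine LinearMap.ext fun x => ?_
  rw [Module.End.mul_apply, Module.End.mul_apply, gn, yEnd_rep, hχ, Units.val_one, one_smul]

theorem gn_pow_card : D.gn X ^ Nat.card G = 1 := by
  rw [gn, ← map_pow, pow_card_eq_one', map_one]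

/-- The projection to the invariants of `g ^ n`. -/
noncomputable def gnProj : Module.End K X :=
  (Nat.card G : K)⁻¹ • ∑ k ∈ Finset.range (Nat.card G), D.gn X ^ k

/-- An inverse of `g ^ n - 1` on the kernel of the projection to the invariants. -/
noncomputable def gnInv : Module.End K X :=
  (Nat.card G : K)⁻¹ • ∑ k ∈ Finset.range (Nat.card G), (k : K) • D.gn X ^ k

variable {X}

theorem commute_gnProj {T : Module.End K X} (h : Commute (D.gn X) T) : Commute (D.gnProj X) T :=
  Commute.smul_left (Commute.sum_left _ _ _ fun _ _ => h.pow_left _) _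

theorem commute_gnInv {T : Module.End K X} (h : Commute (D.gn X) T) : Commute (D.gnInv X) T :=
  Commute.smul_left (Commute.sum_left _ _ _ fun _ _ => (h.pow_left _).smul_left _) _

variable (X)

theorem gn_mul_gnProj : D.gn X * D.gnProj X = D.gnProj X := by
  rw [gnProj, mul_smul_comm]
  congr 1
  have h := Finset.sum_range_succ (fun k => D.gn X ^ k) (Nat.card G)
  rw [Finset.sum_range_succ', gn_pow_card, pow_zero, add_left_inj] at h
  rw [Finset.mul_sum, ← h]
  exact Finset.sum_congr rfl fun k _ => (pow_succ' _ _).symm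

theorem gnProj_apply_of_fixed [CharZero K] {x : X} (hx : D.gn X x = x) : D.gnProj X x = x := by
  have hc : (Nat.card G : K) ≠ 0 := by exact_mod_cast Nat.card_pos.ne'
  have hk : ∀ k, (D.gn X ^ k) x = x := by
    intro k
    induction k with
    | zero => rfl
    | succ k ih => rw [pow_succ', Module.End.mul_apply, ih, hx]
  simp only [gnProj, LinearMap.smul_apply, LinearMap.sum_apply, hk, Finset.sum_const,
    Finset.card_range]
  rw [← Nat.cast_smul_eq_nsmul K, smul_smul, inv_mul_cancel₀ hc, one_smul]

/-- Summation by parts: (T − 1) ∑_{k<m} k T^k = m T^m − T ∑_{k<m} T^k. Take m = |G|, where T^m = 1,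
and divide by |G|. -/
theorem gn_sub_one_mul_gnInv [CharZero K] : (D.gn X - 1) * D.gnInv X = 1 - D.gnProj X := by
  have hc : (Nat.card G : K) ≠ 0 := by exact_mod_cast Nat.card_pos.ne'
  have key : ∀ m : ℕ, (D.gn X - 1) * ∑ k ∈ Finset.range m, (k : K) • D.gn X ^ k =
      (m : K) • D.gn X ^ m - D.gn X * ∑ k ∈ Finset.range m, D.gn X ^ k := by
    intro m
    induction m with
    | zero => simp
    | succ m ih =>
      rw [Finset.sum_range_succ, mul_add, ih, Finset.sum_range_succ, mul_add, mul_smul_comm, sub_mul,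
        ← pow_succ', one_mul, Nat.cast_succ, add_smul, one_smul, smul_sub]
      abel
  have h2 := D.gn_mul_gnProj X
  rw [gnInv, mul_smul_comm, key, smul_sub, gn_pow_card, smul_smul, inv_mul_cancel₀ hc, one_smul,
    ← mul_smul_comm]
  exact congrArg _ h2

/-- The submodule of invariants of `g ^ n`. -/
noncomputable def fixed : Submodule D.H X :=
  D.submoduleOf (LinearMap.ker (D.gn X - 1))
    (fun a x hx => by
      have := LinearMap.congr_fun (D.commute_gn_rep X a) x
      simp only [Module.End.mul_apply] at this
      simp only [LinearMap.mem_ker, LinearMap.sub_apply, Module.End.one_apply, sub_eq_zero] at hx ⊢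
      rw [this, hx])
    (fun x hx => by
      have := LinearMap.congr_fun (D.commute_gn_yEnd X) x
      simp only [Module.End.mul_apply] at this
      simp only [LinearMap.mem_ker, LinearMap.sub_apply, Module.End.one_apply, sub_eq_zero] at hx ⊢
      rw [this, hx])

theorem mem_fixed (x : X) : x ∈ D.fixed X ↔ D.gn X x = x := by
  change (D.gn X - 1) x = 0 ↔ _
  rw [LinearMap.sub_apply, sub_eq_zero, Module.End.one_apply]

theorem gn_fixed (x : D.ofSubmodule (D.fixed X)) :
    D.rep (D.ofSubmodule (D.fixed X)) (D.g ^ D.n) x = x :=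
  Subtype.ext ((D.mem_fixed X _).mp x.2)

/-- Each module is stably isomorphic to its submodule of invariants of `g ^ n`. -/
theorem stablyIso_fixed [CharZero K] (hD : D.IsNonNilpotent) :
    (D.ofSubmodule (D.fixed X)).StablyIso X := by
  have hχ := hD.2
  have hμ : D.μ ≠ 0 := fun h => hD.1 (by rw [h, zero_smul])
  have hn0 : (D.n : K) ≠ 0 := by exact_mod_cast D.n_pos.ne'
  let e : X →ₗ[D.H] X := D.homOf (D.gnProj X)
    (fun a x => LinearMap.congr_fun (D.commute_gnProj (D.commute_gn_rep X a)) x)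
    (fun x => LinearMap.congr_fun (D.commute_gnProj (D.commute_gn_yEnd X)) x)
  refine ⟨(D.fixed X).subtype, e.codRestrict (D.fixed X) fun x => (D.mem_fixed X _).mpr
    (LinearMap.congr_fun (D.gn_mul_gnProj X) x), ?_, ?_⟩
  · convert D.factorsThroughProjective_zero (M := D.ofSubmodule (D.fixed X))
      (N := D.ofSubmodule (D.fixed X))
    rw [sub_eq_zero]
    exact LinearMap.ext fun x => Subtype.ext
      (D.gnProj_apply_of_fixed X ((D.mem_fixed X x.1).mp x.2))
  -- The map `gnProj` − 1 has to factor through Ind X, that is, to be written as ∑ y^k θ y^(n−1−k).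
  -- The chosen θ makes each of the n terms equal to −(1/n) μ⁻¹ y^n `gnInv` = (1/n)(`gnProj` − 1).
  -- The factor y in θ contributes the single χ needed for equivariance.
  · let θ : Module.End K X := (-(D.n : K)⁻¹ * D.μ⁻¹) • (D.yEnd X * D.gnInv X)
    have hθr : ∀ a x, θ (D.rep X a x) = (D.χ a : K) • D.rep X a (θ x) := by
      intro a x
      have h1 := LinearMap.congr_fun (D.commute_gnInv (D.commute_gn_rep X a)) x
      simp only [Module.End.mul_apply] at h1
      simp only [θ, LinearMap.smul_apply, Module.End.mul_apply, h1, yEnd_rep, map_smul]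
      rw [smul_comm]
    have hcy : Commute (D.gnInv X) (D.yEnd X) := D.commute_gnInv (D.commute_gn_yEnd X)
    have hθg : Commute (D.gn X) θ := Commute.smul_right
      ((D.commute_gn_yEnd X).mul_right (D.commute_gnInv (Commute.refl _)).symm) _
    have hyn : D.yEnd X ^ D.n = D.μ • (D.gn X - 1) := LinearMap.ext fun x => D.yEnd_pow_n x
    let A : X →ₗ[K] (Fin D.n → X) := LinearMap.pi fun k => θ ∘ₗ D.yEnd X ^ (D.n - 1 - (k : ℕ))
    have hA : ∀ x k, A x k = θ ((D.yEnd X ^ (D.n - 1 - (k : ℕ))) x) := fun _ _ => rfl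
    let a : X →ₗ[D.H] D.ind (D.rep X) hχ := D.homOf ((D.toInd (D.rep X) hχ).toLinearMap ∘ₗ A)
      (fun b x => by
        simp only [LinearMap.comp_apply, LinearEquiv.coe_coe, rep_toInd]
        congr 1
        funext k
        have hk := k.2
        rw [hA, yEnd_pow_rep, map_smul, hθr, smul_smul]
        simp only [actG, MonoidHom.coe_mk, OneHom.coe_mk, LinearMap.pi_apply, LinearMap.smul_apply,
          LinearMap.comp_apply, LinearMap.proj_apply, hA]
        congr 1
        rw [← Units.val_pow_eq_pow_val, ← Units.val_mul, inv_pow, ← pow_succ]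
        congr 1
        -- The total twist χ^(n−k) equals χ^(−k) because χ^n = 1.
        rw [eq_inv_iff_mul_eq_one, ← pow_add,
          show D.n - 1 - (k : ℕ) + 1 + k = D.n by omega, ← MonoidHom.pow_apply, hχ,
          MonoidHom.one_apply])
      (fun x => by
        simp only [LinearMap.comp_apply, LinearEquiv.coe_coe, yEnd_toInd]
        congr 1
        funext k
        have hk := k.2
        rw [hA, indY_apply, ← Module.End.mul_apply (D.yEnd X ^ _), ← pow_succ]
        split_ifs with h
        -- Coordinate 0 of the image of y x is θ y^n x = μ(g^n − 1) θ x, which is the wrap-around of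
        -- the last coordinate θ x.
        · have h2 := LinearMap.congr_fun hθg x
          simp only [Module.End.mul_apply] at h2
          rw [h, show D.n - 1 - 0 + 1 = D.n by have := D.n_pos; omega, hyn, hA]
          simp only [Nat.sub_self, pow_zero, Module.End.one_apply, LinearMap.smul_apply,
            LinearMap.sub_apply, map_smul, map_sub, ← h2]
          rfl
        · rw [hA]
          simp only
          rw [show D.n - 1 - (k : ℕ) + 1 = D.n - 1 - (k - 1) by omega])
    refine ⟨D.ind (D.rep X) hχ, inferInstance, a,
      D.homInd (D.rep X) hχ (N := X) LinearMap.id fun _ _ => rfl, LinearMap.ext fun x => ?_⟩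
    change D.gnProj X x - x = D.homInd (D.rep X) hχ (N := X) LinearMap.id (fun _ _ => rfl)
      (D.toInd (D.rep X) hχ (A x))
    rw [homInd_toInd]
    have hterm : ∀ k : Fin D.n, (D.yEnd X ^ (k : ℕ)) (A x k) =
        (D.n : K)⁻¹ • (D.gnProj X x - x) := by
      intro k
      have hk := k.2
      have h3 : D.yEnd X ^ (k : ℕ) * (D.yEnd X * D.gnInv X) * D.yEnd X ^ (D.n - 1 - (k : ℕ)) =
          D.yEnd X ^ D.n * D.gnInv X := by
        rw [mul_assoc, mul_assoc, (hcy.pow_right _).eq, ← mul_assoc, ← mul_assoc, ← pow_succ,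
          ← pow_add, show (k : ℕ) + 1 + (D.n - 1 - k) = D.n by omega]
      have h4 := LinearMap.congr_fun h3 x
      rw [hyn, smul_mul_assoc, gn_sub_one_mul_gnInv] at h4
      simp only [Module.End.mul_apply, LinearMap.smul_apply, LinearMap.sub_apply,
        Module.End.one_apply] at h4
      rw [hA]
      simp only [θ, LinearMap.smul_apply, Module.End.mul_apply, map_smul, h4, smul_smul]
      rw [mul_assoc, inv_mul_cancel₀ hμ, mul_one, neg_smul, ← smul_neg, neg_sub]
    simp only [extend, LinearMap.sum_apply, LinearMap.comp_apply, LinearMap.proj_apply,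
      LinearMap.id_apply, hterm]
    rw [Finset.sum_const, Finset.card_univ, Fintype.card_fin, ← Nat.cast_smul_eq_nsmul K, smul_smul,
      mul_inv_cancel₀ hn0, one_smul]

end fixed

/-! ### Reduction of stable invariants to the modules M(j, i) -/

section induction

variable [CharZero K] {V : Type u} [AddCommGroup V] [Module K V] [FiniteDimensional K V]
  (σ : Representation K G V) (hσ : σ (D.g ^ D.n) = 1)

/-- When g^n acts trivially on V, y^n kills the generators of Ind V, so Ind V is M(n, V). -/
theorem projective_M (hχ : D.χ ^ D.n = 1) : Module.Projective D.H (D.M σ hσ D.n le_rfl) := by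
  have hX : ∀ v, (D.yEnd (D.ind σ hχ) ^ D.n) (D.inclInd σ hχ v) = 0 := fun v => by
    rw [yEnd_pow_n, ← inclInd_equivariant, hσ, Module.End.one_apply, sub_self, smul_zero]
  obtain ⟨e⟩ := D.nonempty_equiv_M σ hσ D.n le_rfl (D.inclInd σ hχ)
    (D.inclInd_equivariant σ hχ) hX (fun S hS h => by
      rw [Submodule.eq_top_iff']
      intro x
      obtain ⟨w, rfl⟩ := (D.toInd σ hχ).surjective x
      rw [toInd_eq_sum]
      refine S.sum_mem fun k _ => ?_
      induction (k : ℕ) with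
      | zero => exact h _
      | succ m ih => rw [pow_succ', Module.End.mul_apply]; exact hS _ ih) (D.finrank_ind σ hχ)
  exact Module.Projective.of_equiv e.symm

variable {Ω : Type*} {V : Ω → Type u} [∀ i, AddCommGroup (V i)] [∀ i, Module K (V i)]
  [∀ i, FiniteDimensional K (V i)] (ρ : ∀ i, Representation K G (V i))

/-- A property of modules that is invariant under stable isomorphisms and compatible with direct
sums holds for all modules if it holds for the zero modules and for the modules `M(j, i)`. -/
theorem module_induction (hD : D.IsNonNilpotent) (hρ : IsCompleteSimpleSet ρ)
    {Q : FDModule K D.H → Prop} (hiso : ∀ M N, M.StablyIso N → Q M → Q N)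
    (hzero : ∀ Z : FDModule K D.H, Subsingleton Z → Q Z)
    (hsum : ∀ M N, Q M → Q N → Q (M.directSum N)) (hM : ∀ p : D.I ρ, Q (D.MI ρ p))
    (X : FDModule K D.H) : Q X := by
  -- The invariants of g^n carry the whole stable class; they are decomposed by induction on the
  -- dimension.
  suffices h : ∀ (d : ℕ) (X : FDModule K D.H), (∀ x : X, D.rep X (D.g ^ D.n) x = x) →
      Module.finrank K X = d → Q X from
    hiso _ _ (D.stablyIso_fixed X hD) (h _ _ (D.gn_fixed X) rfl)
  intro d
  induction d using Nat.strong_induction_on with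
  | _ d ih =>
  intro X hX hd
  by_cases hsub : Subsingleton X
  · exact hzero X hsub
  have hnil : ∃ j, D.yEnd X ^ j = 0 := ⟨D.n, D.yEnd_pow_n_eq_zero hX⟩
  classical
  set j := Nat.find hnil with hjdef
  have hyj : D.yEnd X ^ j = 0 := Nat.find_spec hnil
  have hjn : j ≤ D.n := Nat.find_min' hnil (D.yEnd_pow_n_eq_zero hX)
  have hj : 0 < j := by
    rcases Nat.eq_zero_or_pos j with h | h
    · rw [h, pow_zero] at hyj
      exact absurd ⟨fun x z => by
        rw [← Module.End.one_apply (R := K) x, ← Module.End.one_apply (R := K) z, hyj]; rfl⟩ hsub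
    · exact h
  -- By minimality of j the kernel of y^(j−1) is a proper subrepresentation, so some simple V_i in X
  -- avoids it and generates a summand M(j, V_i).
  obtain ⟨i, f, hf, hfi, hfp⟩ := hρ.exists_hom_not_mem (D.rep X)
    (LinearMap.ker (D.yEnd X ^ (j - 1))) (fun a x hx => by
      rw [LinearMap.mem_ker] at hx ⊢
      rw [yEnd_pow_rep, hx, map_zero, smul_zero])
    (fun h => Nat.find_min hnil (m := j - 1) (by omega) (LinearMap.ker_eq_top.mp h))
  have hi : ρ i (D.g ^ D.n) = 1 := LinearMap.ext fun v => hfi (by rw [hf, hX]; rfl)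
  obtain ⟨C, e, he⟩ := D.exists_directSum_M (ρ i) hi hj hjn hyj f hf fun v hv =>
    hfp v (LinearMap.mem_ker.mpr hv)
  refine hiso _ _ (D.stablyIso_of_equiv e.symm) (hsum _ _ ?_ (ih (Module.finrank K C) ?_ C ?_ rfl))
  -- The pair (n, i) is not in I, but M(n, V_i) is projective and so stably zero.
  · by_cases hjn' : j = D.n
    · clear_value j
      subst hjn'
      have := D.projective_M (ρ i) hi hD.2
      exact hiso _ _ (D.stablyIso_symm (D.stablyIso_zero_of_projective _
        ({ carrier := PUnit.{u + 1} } : FDModule K D.H)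
        (hP := this))) (hzero _ inferInstance)
    · exact hM ⟨(j, i), hi, hj, by change j ≤ D.n - 1; omega⟩
  · have h1 := (e.restrictScalars K ≪≫ₗ (D.toS _ C).symm.restrictScalars K).finrank_eq
    have h2 := hρ.finrank_pos i
    rw [Module.finrank_prod, finrank_M] at h1
    have := Nat.mul_pos hj h2
    omega
  · intro c
    have h1 := D.hom_rep e.toLinearMap (D.g ^ D.n) (e.symm (D.toS _ C (0, c)))
    rw [hX, LinearEquiv.coe_coe, LinearEquiv.apply_symm_apply] at h1
    have h2 := congrArg Prod.snd h1
    exact h2.symm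

end induction

end GroupDatum

/-! ### The stable Green ring and its universal property -/

namespace StableGreenRing

variable {K : Type u} {A : Type v} [Field K] [Ring A] [Bialgebra K A]

theorem cls_eq_of_stablyIso {M N : FDModule K A} (h : M.StablyIso N) : cls M = cls N :=
  RingQuot.mkRingHom_rel (.iso h)

theorem cls_directSum (M N : FDModule K A) : cls (M.directSum N) = cls M + cls N :=
  (RingQuot.mkRingHom_rel (.directSum M N)).trans (map_add _ _ _)

theorem cls_tensor (M N : FDModule K A) : cls (M.tensor N) = cls M * cls N :=
  (RingQuot.mkRingHom_rel (.tensor M N)).trans (map_mul _ _ _)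

theorem cls_trivial : cls (FDModule.trivial K A) = 1 :=
  (RingQuot.mkRingHom_rel (.trivial (K := K) (A := A))).trans (map_one _)

/-- The stable Green ring is generated by the classes of modules. -/
theorem induction {P : StableGreenRing K A → Prop} (hint : ∀ n : ℤ, P n) (hcls : ∀ M, P (cls M))
    (hmul : ∀ a b, P a → P b → P (a * b)) (hadd : ∀ a b, P a → P b → P (a + b))
    (x : StableGreenRing K A) : P x := by
  obtain ⟨x, rfl⟩ := RingQuot.mkRingHom_surjective (StableGreenRel K A) x
  induction x using FreeAlgebra.induction with
  | grade0 c =>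
    have h : RingQuot.mkRingHom (StableGreenRel K A) (algebraMap ℤ (FreeAlgebra ℤ (FDModule K A)) c) =
        (c : StableGreenRing K A) := by
      rw [eq_intCast (algebraMap ℤ (FreeAlgebra ℤ (FDModule K A)))]
      exact map_intCast _ c
    rw [h]
    exact hint c
  | grade1 M => exact hcls M
  | mul a b h1 h2 => rw [map_mul]; exact hmul _ _ h1 h2
  | add a b h1 h2 => rw [map_add]; exact hadd _ _ h1 h2

/-- The universal property of the stable Green ring. -/
noncomputable def lift {R : Type*} [Ring R] (f : FDModule K A → R)
    (hiso : ∀ M N, FDModule.StablyIso M N → f M = f N)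
    (hsum : ∀ M N, f (M.directSum N) = f M + f N) (hmul : ∀ M N, f (M.tensor N) = f M * f N)
    (hone : f (FDModule.trivial K A) = 1) : StableGreenRing K A →+* R :=
  RingQuot.lift ⟨(FreeAlgebra.lift ℤ f : FreeAlgebra ℤ (FDModule K A) →ₐ[ℤ] R).toRingHom, by
    intro a b h
    induction h with
    | iso h => simpa using hiso _ _ h
    | directSum M N => simpa using hsum M N
    | tensor M N => simpa using hmul M N
    | trivial => simpa using hone⟩

theorem lift_cls {R : Type*} [Ring R] (f : FDModule K A → R) (hiso hsum hmul hone)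
    (M : FDModule K A) : lift f hiso hsum hmul hone (cls M) = f M := by
  refine (RingQuot.lift_mkRingHom_apply _ _ _).trans ?_
  simp

end StableGreenRing

namespace GroupDatum

/-! ### Schur's lemma for the simple representations -/

section schur

variable {K : Type u} {G : Type v} [Field K] [Group G]
variable {V V' : Type u} [AddCommGroup V] [Module K V] [AddCommGroup V'] [Module K V']
  (ρ : Representation K G V) (ρ' : Representation K G V')

/-- Equivariant linear maps as intertwining maps. -/
def homSetEquiv : homSet ρ Set.univ ρ' ≃ₗ[K] Representation.IntertwiningMap ρ ρ' where
  toFun f := ⟨f.1, fun a => LinearMap.ext fun v => f.2 a trivial v⟩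
  invFun f := ⟨f.toLinearMap, fun a _ v => LinearMap.congr_fun (f.isIntertwining' a) v⟩
  map_add' _ _ := rfl
  map_smul' _ _ := rfl
  left_inv _ := rfl
  right_inv _ := rfl

variable {Ω : Type*} {V : Ω → Type u} [∀ i, AddCommGroup (V i)] [∀ i, Module K (V i)]
  [∀ i, FiniteDimensional K (V i)] (ρ : ∀ i, Representation K G (V i))

theorem finrank_homSet [IsAlgClosed K] (hρ : IsCompleteSimpleSet ρ) (i i' : Ω) [Decidable (i = i')] :
    Module.finrank K (homSet (ρ i) Set.univ (ρ i')) = if i = i' then 1 else 0 := by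
  have := hρ.1 i
  have := hρ.1 i'
  rw [(homSetEquiv (ρ i) (ρ i')).finrank_eq]
  split_ifs with h
  · subst h
    exact Representation.IsIrreducible.finrank_intertwiningMap_self (ρ i)
  · have : IsEmpty ((ρ i).Equiv (ρ i')) := ⟨fun e => h (hρ.2.1 i i' ⟨e⟩)⟩
    exact Module.finrank_zero_of_subsingleton

end schur

/-! ### Multiplicity vectors and the basis of the stable Green ring -/

variable {K : Type u} {G : Type v} [Field K] [Group G] [Finite G] (D : GroupDatum K G)

variable {Ω : Type*} {V : Ω → Type u} [∀ i, AddCommGroup (V i)] [∀ i, Module K (V i)]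
  (ρ : ∀ i, Representation K G (V i))

theorem lt_of_mem_I (p : D.I ρ) : p.1.1 < D.n :=
  lt_of_le_of_lt p.2.2.2 (Nat.sub_lt D.n_pos one_pos)

/-- The multiplicities of the modules `M(j, i)` in a module. -/
noncomputable def multI [Finite Ω] (X : FDModule K D.H) : D.I ρ →₀ ℤ :=
  Finsupp.equivFunOnFinite.symm fun p => (D.mult (ρ p.1.2) Set.univ p.1.1 X : ℤ)

theorem multI_apply [Finite Ω] (X : FDModule K D.H) (p : D.I ρ) :
    D.multI ρ X p = D.mult (ρ p.1.2) Set.univ p.1.1 X := rfl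

theorem multI_congr [Finite Ω] (hχ : D.χ ^ D.n = 1) {X Y : FDModule K D.H} (h : X.StablyIso Y) :
    D.multI ρ X = D.multI ρ Y := by
  ext p
  rw [multI_apply, multI_apply, D.mult_congr _ _ _ hχ (D.lt_of_mem_I ρ p) h]

theorem multI_subsingleton [Finite Ω] (Z : FDModule K D.H) [Subsingleton Z] : D.multI ρ Z = 0 := by
  ext p
  rw [multI_apply, mult_subsingleton]
  rfl

variable [∀ i, FiniteDimensional K (V i)]

/-- A zero module Z satisfies Z ≅ Z ⊕ Z, so [Z] = 2[Z]. -/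
theorem cls_subsingleton (Z : FDModule K D.H) [Subsingleton Z] : StableGreenRing.cls Z = 0 := by
  have h1 : StableGreenRing.cls Z = StableGreenRing.cls Z + StableGreenRing.cls Z := by
    rw [← StableGreenRing.cls_directSum]
    have : Subsingleton (Z.directSum Z) := inferInstanceAs (Subsingleton (Z × Z))
    exact StableGreenRing.cls_eq_of_stablyIso (D.stablyIso_of_equiv
      (LinearEquiv.ofSubsingleton _ _))
  exact left_eq_add.mp h1

theorem cls_mem_span [CharZero K] (hD : D.IsNonNilpotent) (hρ : IsCompleteSimpleSet ρ)
    (X : FDModule K D.H) : StableGreenRing.cls X ∈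
    Submodule.span ℤ (Set.range fun p => StableGreenRing.cls (D.MI ρ p)) := by
  induction X using D.module_induction ρ hD hρ with
  | hiso X Y h hX => rwa [← StableGreenRing.cls_eq_of_stablyIso h]
  | hzero Z hZ =>
    rw [D.cls_subsingleton Z]
    exact zero_mem _
  | hsum X Y hX hY =>
    rw [StableGreenRing.cls_directSum]
    exact add_mem hX hY
  | hM p => exact Submodule.subset_span ⟨p, rfl⟩

/-- The ring is generated by classes of modules, and a product of such classes is the class of a
tensor product. So the span is a left ideal, and it contains 1, the class of the trivial module. -/
theorem span_cls_MI [CharZero K] (hD : D.IsNonNilpotent) (hρ : IsCompleteSimpleSet ρ) :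
    Submodule.span ℤ (Set.range fun p => StableGreenRing.cls (D.MI ρ p)) = ⊤ := by
  rw [Submodule.eq_top_iff']
  set S := Submodule.span ℤ (Set.range fun p => StableGreenRing.cls (D.MI ρ p))
  suffices h : ∀ x, ∀ s ∈ S, x * s ∈ S by
    intro x
    have := h x _ (D.cls_mem_span ρ hD hρ (FDModule.trivial K D.H))
    rwa [StableGreenRing.cls_trivial, mul_one] at this
  intro x
  induction x using StableGreenRing.induction with
  | hint m =>
    intro s hs
    rw [← zsmul_eq_mul]
    exact S.smul_mem m hs
  | hcls M =>
    intro s hs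
    induction hs using Submodule.span_induction with
    | mem s h =>
      obtain ⟨p, rfl⟩ := h
      simp only
      rw [← StableGreenRing.cls_tensor]
      exact D.cls_mem_span ρ hD hρ _
    | zero => rw [mul_zero]; exact zero_mem _
    | add s t _ _ hs ht => rw [mul_add]; exact add_mem hs ht
    | smul c s _ hs => rw [mul_smul_comm]; exact S.smul_mem c hs
  | hmul a b ha hb => exact fun s hs => by rw [mul_assoc]; exact ha _ (hb s hs)
  | hadd a b ha hb => exact fun s hs => by rw [add_mul]; exact add_mem (ha s hs) (hb s hs)

variable [Finite Ω]

theorem multI_directSum (X Y : FDModule K D.H) :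
    D.multI ρ (X.directSum Y) = D.multI ρ X + D.multI ρ Y := by
  ext p
  rw [Finsupp.add_apply, multI_apply, multI_apply, multI_apply, mult_directSum, Nat.cast_add]

/-- A degree different from j contributes nothing; in degree j Schur's lemma counts the equivariant
maps between simple modules. -/
theorem multI_MI [IsAlgClosed K] (hρ : IsCompleteSimpleSet ρ) (p : D.I ρ) :
    D.multI ρ (D.MI ρ p) = Finsupp.single p 1 := by
  classical
  ext q
  obtain ⟨⟨j, i⟩, hp⟩ := p
  obtain ⟨⟨k, i'⟩, hq⟩ := q
  have hi : ρ i (D.g ^ D.n) = 1 := hp.1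
  have hj : 0 < j := hp.2.1
  have hk : 0 < k := hq.2.1
  have hjn : j ≤ D.n := hp.2.2.trans (Nat.sub_le _ _)
  have h : D.mult (ρ i') Set.univ k (D.M (ρ i) hi j hjn) = if j = k ∧ i = i' then 1 else 0 := by
    by_cases hjk : j = k
    · subst hjk
      rw [D.mult_M_self _ _ _ _ hj, finrank_homSet ρ hρ]
      simp only [eq_comm, true_and]
    · rw [D.mult_M_of_ne _ _ _ _ hk hjk, if_neg (fun h => hjk h.1)]
  rw [multI_apply, Finsupp.single_apply]
  refine (congrArg Nat.cast h).trans ?_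
  simp only [Subtype.mk.injEq, Prod.mk.injEq]
  split_ifs <;> rfl

/-- Tensoring on the left with a module, on the level of multiplicities. -/
noncomputable def tensorOp (M : FDModule K D.H) : Module.End ℤ (D.I ρ →₀ ℤ) :=
  Finsupp.linearCombination ℤ fun p => D.multI ρ (M.tensor (D.MI ρ p))

variable [IsAlgClosed K] [CharZero K] (hD : D.IsNonNilpotent) (hρ : IsCompleteSimpleSet ρ)

include hD hρ

/-- Both sides are additive stable invariants of X that agree on the M(j, i). This turns
associativity of the tensor product into multiplicativity of M ↦ `tensorOp ρ M`. -/
theorem tensorOp_multI (M X : FDModule K D.H) :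
    D.tensorOp ρ M (D.multI ρ X) = D.multI ρ (M.tensor X) := by
  induction X using D.module_induction ρ hD hρ with
  | hiso X Y h hX =>
    rw [← D.multI_congr ρ hD.2 h, hX]
    exact D.multI_congr ρ hD.2 (D.stablyIso_tensor_right hD.2 M h)
  | hzero Z hZ =>
    have : Subsingleton (M.tensor Z) := by
      rw [← Module.finrank_zero_iff (R := K), finrank_tensor,
        Module.finrank_zero_of_subsingleton (M := Z), mul_zero]
    rw [multI_subsingleton, multI_subsingleton, map_zero]
  | hsum X Y hX hY =>
    rw [multI_directSum, map_add, hX, hY, ← multI_directSum]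
    exact (D.multI_congr ρ hD.2 (D.stablyIso_of_equiv (D.tensorDirectSum M X Y))).symm
  | hM p =>
    rw [D.multI_MI ρ hρ, tensorOp, Finsupp.linearCombination_single, one_smul]

/-- The representation of the stable Green ring by tensoring on the left. -/
noncomputable def tensorOpHom : StableGreenRing K D.H →+* Module.End ℤ (D.I ρ →₀ ℤ) :=
  StableGreenRing.lift (D.tensorOp ρ)
    (fun M N h => Finsupp.lhom_ext' fun p => LinearMap.ext_ring <| by
      simp only [tensorOp, LinearMap.comp_apply, Finsupp.lsingle_apply,
        Finsupp.linearCombination_single, one_smul]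
      exact D.multI_congr ρ hD.2 (D.stablyIso_tensor_left hD.2 _ h))
    (fun M N => Finsupp.lhom_ext' fun p => LinearMap.ext_ring <| by
      simp only [tensorOp, LinearMap.comp_apply, Finsupp.lsingle_apply, LinearMap.add_apply,
        Finsupp.linearCombination_single, one_smul]
      rw [← multI_directSum]
      exact D.multI_congr ρ hD.2 (D.stablyIso_of_equiv (D.directSumTensor M N _)))
    (fun M N => Finsupp.lhom_ext' fun p => LinearMap.ext_ring <| by
      rw [LinearMap.comp_apply, LinearMap.comp_apply, Finsupp.lsingle_apply, Module.End.mul_apply,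
        ← D.multI_MI ρ hρ, D.tensorOp_multI ρ hD hρ, D.tensorOp_multI ρ hD hρ,
        D.tensorOp_multI ρ hD hρ]
      exact D.multI_congr ρ hD.2 (D.stablyIso_of_equiv (D.tensorAssoc M N _)))
    (Finsupp.lhom_ext' fun p => LinearMap.ext_ring <| by
      rw [LinearMap.comp_apply, LinearMap.comp_apply, Finsupp.lsingle_apply, Module.End.one_apply,
        ← D.multI_MI ρ hρ, D.tensorOp_multI ρ hD hρ]
      exact D.multI_congr ρ hD.2 (D.stablyIso_of_equiv (D.trivialTensor _)))

/-- The multiplicities of the modules `M(j, i)`, on the stable Green ring. -/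
noncomputable def multHom : StableGreenRing K D.H →ₗ[ℤ] (D.I ρ →₀ ℤ) :=
  ((LinearMap.applyₗ (R := ℤ) (D.multI ρ (FDModule.trivial K D.H))).toAddMonoidHom.comp
    (D.tensorOpHom ρ hD hρ).toAddMonoidHom).toIntLinearMap

/-- Tensoring the trivial module with X gives back X. Hence the operators, which respect the ring
relations, recover the merely additive function `multI`. -/
theorem multHom_cls (X : FDModule K D.H) :
    D.multHom ρ hD hρ (StableGreenRing.cls X) = D.multI ρ X := by
  have : D.multHom ρ hD hρ (StableGreenRing.cls X) =
    D.tensorOpHom ρ hD hρ (StableGreenRing.cls X) (D.multI ρ (FDModule.trivial K D.H)) := rfl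
  rw [this, tensorOpHom, StableGreenRing.lift_cls, D.tensorOp_multI ρ hD hρ]
  exact D.multI_congr ρ hD.2 (D.stablyIso_of_equiv (D.tensorTrivial X))

/-- The basis of the stable Green ring given by the modules `M(j, i)`. -/
noncomputable def greenBasis : Module.Basis (D.I ρ) ℤ (StableGreenRing K D.H) :=
  Module.Basis.mk (v := fun p => StableGreenRing.cls (D.MI ρ p))
    (LinearIndependent.of_comp (D.multHom ρ hD hρ) (by
      have : (D.multHom ρ hD hρ ∘ fun p => StableGreenRing.cls (D.MI ρ p)) =
          fun p => Finsupp.single p 1 := funext fun p => by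
        rw [Function.comp_apply, multHom_cls, D.multI_MI ρ hρ]
      rw [this]
      exact Finsupp.linearIndependent_single_one ℤ (D.I ρ)))
    (D.span_cls_MI ρ hD hρ).ge

theorem greenBasis_apply (p : D.I ρ) :
    D.greenBasis ρ hD hρ p = StableGreenRing.cls (D.MI ρ p) := Module.Basis.mk_apply _ _ _

/-- Coordinates of classes of modules are multiplicities, which later gives nonnegative structure
constants. -/
theorem greenBasis_repr (x : StableGreenRing K D.H) :
    (D.greenBasis ρ hD hρ).repr x = D.multHom ρ hD hρ x := by
  have : (D.greenBasis ρ hD hρ).repr.toLinearMap = D.multHom ρ hD hρ :=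
    (D.greenBasis ρ hD hρ).ext fun p => by
      rw [LinearEquiv.coe_coe, Module.Basis.repr_self, greenBasis_apply, multHom_cls,
        D.multI_MI ρ hρ]
  exact LinearMap.congr_fun this x

end GroupDatum

/-! ### A Perron criterion, Dickson polynomials and quantum integers -/

section perron

/-- A positive additive functional that is multiplied with `c` by the left multiplication by `x`
shows that `c` is the Frobenius-Perron dimension of `x`, if `x` has nonnegative structure
constants. -/
theorem isFPdim_of_functional {R I : Type*} [Ring R] [Finite I] [Nonempty I]
    (b : Module.Basis I ℤ R) (x : R) (c : ℝ) (d : R →ₗ[ℤ] ℝ)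
    (hd : ∀ q, d (x * b q) = c * d (b q)) (hpos : ∀ q, 0 < d (b q))
    (hnn : ∀ p q, 0 ≤ b.repr (x * b q) p) : IsFPdim b x c := by
  unfold IsFPdim
  let _ := Fintype.ofFinite I
  let _ := Classical.decEq I
  set A : Matrix I I ℝ := (Algebra.leftMulMatrix b x).map (Int.cast : ℤ → ℝ) with hA
  set w : I → ℝ := fun p => d (b p) with hw
  have hA0 : ∀ p q, 0 ≤ A p q := fun p q => by
    rw [hA, Matrix.map_apply, Algebra.leftMulMatrix_eq_repr_mul]
    exact_mod_cast hnn p q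
  -- The values of d on the basis form a positive left eigenvector of A for c.
  have hvec : ∀ q, ∑ p, w p * A p q = c * w q := fun q => by
    rw [hw, ← hd]
    conv_rhs => rw [← b.sum_repr (x * b q), map_sum]
    refine Finset.sum_congr rfl fun p _ => ?_
    rw [hA, Matrix.map_apply, Algebra.leftMulMatrix_eq_repr_mul, map_zsmul, zsmul_eq_mul, mul_comm]
  obtain ⟨q0⟩ := ‹Nonempty I›
  refine ⟨⟨?_, ?_⟩, ?_⟩
  · have h1 : 0 ≤ c * w q0 := by
      rw [← hvec]
      exact Finset.sum_nonneg fun p _ => mul_nonneg (hpos p).le (hA0 p q0)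
    exact nonneg_of_mul_nonneg_left h1 (hpos q0)
  -- The vanishing determinant converts the left eigenvector into a right one.
  · have hdet : (A - c • (1 : Matrix I I ℝ)).det = 0 := by
      rw [← Matrix.exists_vecMul_eq_zero_iff]
      refine ⟨w, fun h => (hpos q0).ne' (congrFun h q0), ?_⟩
      rw [Matrix.vecMul_sub, sub_eq_zero, Matrix.vecMul_smul, Matrix.vecMul_one]
      exact funext hvec
    obtain ⟨u, hu, hu'⟩ := Matrix.exists_mulVec_eq_zero_iff.mpr hdet
    rw [Matrix.sub_mulVec, sub_eq_zero, Matrix.smul_mulVec, Matrix.one_mulVec] at hu'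
    exact Module.End.hasEigenvalue_of_hasEigenvector
      ⟨Module.End.mem_eigenspace_iff.mpr (by rw [Matrix.toLin'_apply, hu']), hu⟩
  · rintro t ⟨ht, hev⟩
    obtain ⟨u, hu⟩ := hev.exists_hasEigenvector
    have hu1 : ∀ p, ∑ q, A p q * u q = t * u p := fun p => by
      have := congrFun (Module.End.mem_eigenspace_iff.mp hu.1) p
      rwa [Matrix.toLin'_apply] at this
    have hu2 : ∀ p, t * |u p| ≤ ∑ q, A p q * |u q| := fun p => by
      rw [← abs_of_nonneg ht, ← abs_mul, ← hu1]
      refine (Finset.abs_sum_le_sum_abs _ _).trans (Finset.sum_le_sum fun q _ => ?_)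
      rw [abs_mul, abs_of_nonneg (hA0 p q)]
    -- Pair the entrywise inequality t|u| ≤ A|u| with w and use w A = c w; the pairing of w with |u|
    -- is positive, so t ≤ c.
    have h3 : t * ∑ p, w p * |u p| ≤ c * ∑ p, w p * |u p| := by
      calc t * ∑ p, w p * |u p| = ∑ p, w p * (t * |u p|) := by
            rw [Finset.mul_sum]
            exact Finset.sum_congr rfl fun p _ => by ring
        _ ≤ ∑ p, w p * ∑ q, A p q * |u q| :=
            Finset.sum_le_sum fun p _ => mul_le_mul_of_nonneg_left (hu2 p) (hpos p).le
        _ = ∑ q, (∑ p, w p * A p q) * |u q| := by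
            simp only [Finset.mul_sum, Finset.sum_mul]
            rw [Finset.sum_comm]
            exact Finset.sum_congr rfl fun q _ => Finset.sum_congr rfl fun p _ => by ring
        _ = c * ∑ p, w p * |u p| := by
            rw [Finset.mul_sum]
            exact Finset.sum_congr rfl fun q _ => by rw [hvec]; ring
    refine le_of_mul_le_mul_right h3 ?_
    obtain ⟨p, hp⟩ := Function.ne_iff.mp hu.2
    exact Finset.sum_pos' (fun q _ => mul_nonneg (hpos q).le (abs_nonneg _))
      ⟨p, Finset.mem_univ _, mul_pos (hpos p) (abs_pos.mpr hp)⟩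

/-- The numbers sin(jt) satisfy sin((j+1)t) = 2 cos t sin(jt) − sin((j−1)t), the Dickson recursion
with Y = 1 and Z = 2 cos t. The product form avoids division by sin t. -/
theorem dicksonF_mul_sin (t : ℝ) (k : ℕ) :
    dicksonF (k + 1) 1 (2 * Real.cos t) * Real.sin t = Real.sin ((k + 1 : ℕ) * t) := by
  induction k using Nat.strong_induction_on with
  | _ k ih =>
  match k with
  | 0 => rw [dicksonF_one]; simp
  | 1 =>
    rw [dicksonF_two, show ((1 + 1 : ℕ) : ℝ) * t = 2 * t by push_cast; ring, Real.sin_two_mul]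
    ring
  | k + 2 =>
    have h1 := ih (k + 1) (by omega)
    have h2 := ih k (by omega)
    rw [dicksonF_rec _ _ _ (by omega), show k + 2 + 1 - 1 = k + 1 + 1 by omega,
      show k + 2 + 1 - 2 = k + 1 by omega]
    have h3 := Real.sin_add ((k + 1 + 1 : ℕ) * t) t
    have h4 := Real.sin_sub ((k + 1 + 1 : ℕ) * t) t
    rw [show ((k + 1 + 1 : ℕ) : ℝ) * t + t = (k + 2 + 1 : ℕ) * t by push_cast; ring] at h3
    rw [show ((k + 1 + 1 : ℕ) : ℝ) * t - t = (k + 1 : ℕ) * t by push_cast; ring] at h4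
    linear_combination 2 * Real.cos t * h1 - h2 - h3 - h4

/-- The quantum integer `sin (j π / n) / sin (π / n)`. -/
noncomputable def quantumInt (n j : ℕ) : ℝ := Real.sin (j * (Real.pi / n)) / Real.sin (Real.pi / n)

theorem sin_pi_div_pos {n : ℕ} (hn : 2 ≤ n) : 0 < Real.sin (Real.pi / n) := by
  have hn' : (1 : ℝ) < n := by exact_mod_cast hn
  exact Real.sin_pos_of_pos_of_lt_pi (by positivity) (div_lt_self Real.pi_pos hn')

theorem quantumInt_eq_dicksonF {n : ℕ} (hn : 2 ≤ n) {j : ℕ} (hj : 0 < j) :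
    quantumInt n j = dicksonF j 1 (2 * Real.cos (Real.pi / n)) := by
  obtain ⟨k, rfl⟩ : ∃ k, j = k + 1 := ⟨j - 1, by omega⟩
  rw [quantumInt, div_eq_iff (sin_pi_div_pos hn).ne', dicksonF_mul_sin]

theorem quantumInt_zero (n : ℕ) : quantumInt n 0 = 0 := by simp [quantumInt]

theorem quantumInt_one {n : ℕ} (hn : 2 ≤ n) : quantumInt n 1 = 1 := by
  rw [quantumInt, Nat.cast_one, one_mul, div_self (sin_pi_div_pos hn).ne']

/-- The numerator is sin π. This vanishing lets the dimension ignore the projective modules M(n, V).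
-/
theorem quantumInt_self {n : ℕ} (hn : 2 ≤ n) : quantumInt n n = 0 := by
  have hn' : (n : ℝ) ≠ 0 := by positivity
  rw [quantumInt, mul_div_cancel₀ _ hn', Real.sin_pi, zero_div]

theorem quantumInt_pos {n : ℕ} {j : ℕ} (hj : 0 < j) (hjn : j < n) : 0 < quantumInt n j := by
  have hn : 2 ≤ n := by omega
  have h1 : (0 : ℝ) < j := by exact_mod_cast hj
  have h2 : (0 : ℝ) < n := by exact_mod_cast (by omega : 0 < n)
  have h3 : (j : ℝ) < n := by exact_mod_cast hjn
  refine div_pos (Real.sin_pos_of_pos_of_lt_pi (by positivity) ?_) (sin_pi_div_pos hn)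
  rw [mul_div_left_comm]
  exact mul_lt_of_lt_one_right Real.pi_pos ((div_lt_one h2).mpr h3)

/-- The sum of sin(α ± β), with α = jπ/n and β = π/n. It is the numerical form of the rule for
tensoring with M(2, K). -/
theorem quantumInt_add (n j : ℕ) (hj : 0 < j) :
    quantumInt n (j + 1) + quantumInt n (j - 1) =
      2 * Real.cos (Real.pi / n) * quantumInt n j := by
  have e1 : ((j + 1 : ℕ) : ℝ) * (Real.pi / n) = j * (Real.pi / n) + Real.pi / n := by
    push_cast; ring
  have e2 : ((j - 1 : ℕ) : ℝ) * (Real.pi / n) = j * (Real.pi / n) - Real.pi / n := by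
    rw [Nat.cast_sub hj]; push_cast; ring
  rw [quantumInt, quantumInt, quantumInt, ← add_div, e1, e2, Real.sin_add, Real.sin_sub]
  ring

end perron

/-- Contract the second factor with β. -/
theorem eq_zero_of_tmul_eq_zero {K M N : Type*} [Field K] [AddCommGroup M] [Module K M]
    [AddCommGroup N] [Module K N] {x : M} {z : N} (β : N →ₗ[K] K) (hβ : β z = 1)
    (h : x ⊗ₜ[K] z = 0) : x = 0 := by
  have h1 := congrArg (TensorProduct.rid K M ∘ TensorProduct.map .id β) h
  simpa [hβ] using h1

namespace GroupDatum

variable {K : Type u} {G : Type v} [Field K] [Group G] [Finite G] (D : GroupDatum K G)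

/-! ### Tensor products with `M(1, W)` and with `M(2, K)` -/

section incl

variable {V : Type u} [AddCommGroup V] [Module K V] [FiniteDimensional K V]
  (σ : Representation K G V) (hσ : σ (D.g ^ D.n) = 1) (j : ℕ) (hj : j ≤ D.n) (h0 : 0 < j)

/-- The inclusion of `V` in `M(j, V)`. -/
noncomputable def inclM : V →ₗ[K] D.M σ hσ j hj :=
  (D.toM σ hσ j hj).toLinearMap ∘ₗ LinearMap.single K (fun _ => V) ⟨0, h0⟩

theorem inclM_apply (v : V) :
    D.inclM σ hσ j hj h0 v = D.toM σ hσ j hj (Pi.single ⟨0, h0⟩ v) := rfl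

theorem inclM_equivariant (a : G) (v : V) :
    D.inclM σ hσ j hj h0 (σ a v) = D.rep (D.M σ hσ j hj) a (D.inclM σ hσ j hj h0 v) := by
  rw [inclM_apply, inclM_apply, rep_toM, actG_single]
  simp

theorem toM_eq_sum (w : Fin j → V) : D.toM σ hσ j hj w =
    ∑ k : Fin j, (D.yEnd (D.M σ hσ j hj) ^ (k : ℕ)) (D.inclM σ hσ j hj h0 (w k)) := by
  conv_lhs => rw [← Finset.univ_sum_single w, map_sum]
  exact Finset.sum_congr rfl fun k _ => D.toM_single σ hσ j hj k (w k)

theorem yEnd_pow_M_eq_zero : D.yEnd (D.M σ hσ j hj) ^ j = 0 := by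
  refine LinearMap.ext fun x => ?_
  obtain ⟨w, rfl⟩ := (D.toM σ hσ j hj).surjective x
  rw [yEnd_pow_toM, actY_pow_eq_zero le_rfl, LinearMap.zero_apply, map_zero, LinearMap.zero_apply]

end incl

section one

variable {V : Type u} [AddCommGroup V] [Module K V] [FiniteDimensional K V]
  (σ : Representation K G V) (hσ : σ (D.g ^ D.n) = 1) (j : ℕ) (hj : j ≤ D.n) (h0 : 0 < j)
  {W : Type u} [AddCommGroup W] [Module K W] [FiniteDimensional K W]
  (τ : Representation K G W) (hτ : τ (D.g ^ D.n) = 1)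

theorem yEnd_pow_tmul_of_yEnd_eq_zero {M N : FDModule K D.H} (hN : D.yEnd N = 0) (k : ℕ) (x : M)
    (z : N) : (D.yEnd (M.tensor N) ^ k) (D.toT M N (x ⊗ₜ z)) =
      D.toT M N ((D.yEnd M ^ k) x ⊗ₜ (D.rep N D.g ^ k) z) := by
  induction k with
  | zero => rfl
  | succ k ih =>
    rw [pow_succ', Module.End.mul_apply, ih, yEnd_toT_tmul, hN, LinearMap.zero_apply,
      TensorProduct.tmul_zero, map_zero, add_zero, pow_succ', pow_succ', Module.End.mul_apply,
      Module.End.mul_apply]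

include h0 in
-- On M(1, W) the operator y vanishes, so y acts on the tensor product as y ⊗ g. Thus V ⊗ W in
-- degree 0 is killed by y^j and generates.
theorem nonempty_equiv_tensor_one (hστ : (σ.tprod τ) (D.g ^ D.n) = 1) (h1 : 1 ≤ D.n) :
    Nonempty (D.M (σ.tprod τ) hστ j hj ≃ₗ[D.H] (D.M σ hσ j hj).tensor (D.M τ hτ 1 h1)) := by
  have hN : D.yEnd (D.M τ hτ 1 h1) = 0 := by simpa using D.yEnd_pow_M_eq_zero τ hτ 1 h1
  refine D.nonempty_equiv_M _ _ j hj ((D.toT _ _).toLinearMap ∘ₗ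
    TensorProduct.map (D.inclM σ hσ j hj h0) (D.inclM τ hτ 1 h1 one_pos)) (fun a t => ?_)
    (fun t => ?_) (fun S hS h => D.submodule_eq_top_of_toT S fun x z => ?_) ?_
  · induction t with
    | zero => simp
    | tmul x z => simp [rep_toT_tmul, inclM_equivariant]
    | add s t hs ht => simp only [map_add, hs, ht]
  · induction t with
    | zero => simp
    | tmul x z =>
      simp only [LinearMap.comp_apply, LinearEquiv.coe_coe, TensorProduct.map_tmul]
      rw [D.yEnd_pow_tmul_of_yEnd_eq_zero hN, yEnd_pow_M_eq_zero, LinearMap.zero_apply,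
        TensorProduct.zero_tmul, map_zero]
    | add s t hs ht => simp only [map_add, hs, ht, add_zero]
  · obtain ⟨w, rfl⟩ := (D.toM σ hσ j hj).surjective x
    obtain ⟨w', rfl⟩ := (D.toM τ hτ 1 h1).surjective z
    rw [D.toM_eq_sum σ hσ j hj h0, TensorProduct.sum_tmul, map_sum]
    refine S.sum_mem fun k _ => D.yEnd_pow_tmul_mem (D.inclM σ hσ j hj h0) S hS (fun v z => ?_) k
      (w k) _
    obtain ⟨w', rfl⟩ := (D.toM τ hτ 1 h1).surjective z
    rw [D.toM_eq_sum τ hτ 1 h1 one_pos]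
    simpa using h (v ⊗ₜ w' 0)
  · rw [finrank_tensor, finrank_M, finrank_M, Module.finrank_tensorProduct]
    ring

end one

section two

variable (h2 : 2 ≤ D.n)

/-- The module `M(2, K)` of the trivial representation. -/
noncomputable def M2 : FDModule K D.H := D.M (1 : Representation K G K) rfl 2 h2

/-- The `k`-th basis vector of `M(2, K)`. -/
noncomputable def e2 (k : Fin 2) : D.M2 h2 :=
  D.toM (1 : Representation K G K) rfl 2 h2 (Pi.single k 1)

/-- The second coordinate on `M(2, K)`. -/
noncomputable def e2Coord : D.M2 h2 →ₗ[K] K :=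
  LinearMap.proj (1 : Fin 2) ∘ₗ (D.toM (1 : Representation K G K) rfl 2 h2).symm.toLinearMap

theorem e2Coord_one : D.e2Coord h2 (D.e2 h2 1) = 1 :=
  (congrFun (LinearEquiv.symm_apply_apply (D.toM (1 : Representation K G K) rfl 2 h2)
    (Pi.single 1 1)) 1).trans (Pi.single_eq_same (M := fun _ => K) (1 : Fin 2) 1)

theorem rep_e2 (a : G) (k : Fin 2) :
    D.rep (D.M2 h2) a (D.e2 h2 k) = ((D.χ a : K)⁻¹ ^ (k : ℕ)) • D.e2 h2 k := by
  refine (D.rep_toM _ _ _ _ _ _).trans ?_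
  rw [actG_single, map_smul, Units.val_pow_eq_pow_val, Units.val_inv_eq_inv_val]
  rfl

theorem yEnd_e2_zero : D.yEnd (D.M2 h2) (D.e2 h2 0) = D.e2 h2 1 := by
  refine (D.yEnd_toM _ _ _ _ _).trans ?_
  rw [actY_single]
  rfl

theorem yEnd_e2_one : D.yEnd (D.M2 h2) (D.e2 h2 1) = 0 := by
  refine (D.yEnd_toM _ _ _ _ _).trans ?_
  rw [actY_single]
  exact map_zero _

theorem exists_eq_e2 (z : D.M2 h2) : ∃ c c' : K, z = c • D.e2 h2 0 + c' • D.e2 h2 1 := by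
  obtain ⟨w, rfl⟩ := (D.toM (1 : Representation K G K) rfl 2 h2).surjective z
  refine ⟨w 0, w 1, ?_⟩
  have h : w = w 0 • Pi.single 0 1 + w 1 • Pi.single 1 1 := by
    funext k
    fin_cases k <;> simp
  conv_lhs => rw [h, map_add, map_smul, map_smul]
  rfl

theorem submodule_eq_top_of_e2 {X : FDModule K D.H} (S : Submodule K (X.tensor (D.M2 h2)))
    (h : ∀ x k, D.toT X (D.M2 h2) (x ⊗ₜ D.e2 h2 k) ∈ S) : S = ⊤ :=
  D.submodule_eq_top_of_toT S fun x z => by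
    obtain ⟨c, c', rfl⟩ := D.exists_eq_e2 h2 z
    rw [TensorProduct.tmul_add, TensorProduct.tmul_smul, TensorProduct.tmul_smul, map_add, map_smul,
      map_smul]
    exact S.add_mem (S.smul_mem _ (h _ _)) (S.smul_mem _ (h _ _))

/-- Since y kills the second basis vector and g multiplies it by q⁻¹, where q = χ(g), each
application of y acts on the first factor with a factor q⁻¹. -/
theorem yEnd_pow_tmul_e2_one (X : FDModule K D.H) (k : ℕ) (x : X) :
    (D.yEnd (X.tensor (D.M2 h2)) ^ k) (D.toT X (D.M2 h2) (x ⊗ₜ D.e2 h2 1)) =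
      ((D.χ D.g : K)⁻¹ ^ k) • D.toT X (D.M2 h2) ((D.yEnd X ^ k) x ⊗ₜ D.e2 h2 1) := by
  induction k with
  | zero => simp
  | succ k ih =>
    rw [pow_succ', Module.End.mul_apply, ih, map_smul, yEnd_toT_tmul, yEnd_e2_one, rep_e2,
      TensorProduct.tmul_zero, map_zero, add_zero, TensorProduct.tmul_smul, map_smul, smul_smul,
      pow_succ' (D.yEnd X), Module.End.mul_apply]
    congr 1
    simp [pow_succ]

/-- Among the k + 1 applications of y, at most one moves the second factor to the other basis
vector. The later ones each contribute q⁻¹, so the sum over the position of that move is a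
q-integer. -/
theorem yEnd_pow_tmul_e2_zero (X : FDModule K D.H) (k : ℕ) (x : X) :
    (D.yEnd (X.tensor (D.M2 h2)) ^ (k + 1)) (D.toT X (D.M2 h2) (x ⊗ₜ D.e2 h2 0)) =
      D.toT X (D.M2 h2) ((D.yEnd X ^ (k + 1)) x ⊗ₜ D.e2 h2 0) +
      (∑ a ∈ Finset.range (k + 1), (D.χ D.g : K)⁻¹ ^ a) •
        D.toT X (D.M2 h2) ((D.yEnd X ^ k) x ⊗ₜ D.e2 h2 1) := by
  induction k with
  | zero => simp [yEnd_toT_tmul, rep_e2, yEnd_e2_zero]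
  | succ k ih =>
    rw [pow_succ', Module.End.mul_apply, ih, map_add, map_smul, yEnd_toT_tmul, yEnd_toT_tmul,
      yEnd_e2_zero, yEnd_e2_one, rep_e2, rep_e2, TensorProduct.tmul_zero, map_zero, add_zero,
      TensorProduct.tmul_smul, TensorProduct.tmul_smul, map_smul, map_smul, smul_smul, add_assoc,
      ← Module.End.mul_apply (D.yEnd X), ← pow_succ', ← Module.End.mul_apply (D.yEnd X),
      ← pow_succ', Finset.sum_range_succ' _ (k + 1), add_smul, pow_zero, one_smul,
      Fin.val_zero, pow_zero, one_smul]
    congr 1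
    rw [add_comm]
    congr 2
    rw [Finset.sum_mul]
    exact Finset.sum_congr rfl fun a _ => by simp [pow_succ]

/-- Multiplied by q⁻¹ − 1 the sum becomes q^(−k) − 1, nonzero because q has order n. -/
theorem geom_sum_ne_zero {k : ℕ} (hk : 0 < k) (hkn : k < D.n) :
    ∑ a ∈ Finset.range k, (D.χ D.g : K)⁻¹ ^ a ≠ 0 := by
  intro h
  have h1 := mul_geom_sum ((D.χ D.g : K)⁻¹) k
  rw [h, mul_zero, eq_comm, sub_eq_zero, inv_pow, inv_eq_one] at h1
  have h3 := D.orderOf_q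
  exact pow_ne_one_of_lt_orderOf (x := (D.χ D.g : K)) (n := k) (by omega) (by omega) h1

variable {V : Type u} [AddCommGroup V] [Module K V]
  (σ : Representation K G V) (hσ : σ (D.g ^ D.n) = 1)

/-- The representation `V ⊗ χ⁻¹`. -/
def twist : Representation K G V where
  toFun a := ((D.χ a : K)⁻¹) • σ a
  map_one' := by simp
  map_mul' a b := by
    refine LinearMap.ext fun v => ?_
    simp [smul_smul, mul_comm]

theorem twist_apply (a : G) (v : V) : D.twist σ a v = ((D.χ a : K)⁻¹) • σ a v := rfl

include hσ in
theorem twist_gn : D.twist σ (D.g ^ D.n) = 1 := by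
  have hχ : D.χ (D.g ^ D.n) = 1 := by
    rw [map_pow]
    exact pow_orderOf_eq_one _
  refine LinearMap.ext fun v => ?_
  rw [twist_apply, hχ, hσ, Units.val_one, inv_one, one_smul]

variable [FiniteDimensional K V] [CharZero K]

/-- The Clebsch-Gordan formula for the tensor product with `M(2, K)`. -/
theorem exists_equiv_tensor_two {j : ℕ} (h0 : 0 < j) (hj : j + 1 ≤ D.n) :
    ∃ C : FDModule K D.H,
      Nonempty ((D.M σ hσ j (by omega)).tensor (D.M2 h2) ≃ₗ[D.H]
        (D.M σ hσ (j + 1) hj).directSum C) ∧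
      Nonempty (D.M (D.twist σ) (D.twist_gn σ hσ) (j - 1) (by omega) ≃ₗ[D.H] C) := by
  set X := D.M σ hσ j (by omega) with hX
  obtain ⟨m, rfl⟩ : ∃ m, j = m + 1 := ⟨j - 1, by omega⟩
  set ι := D.inclM σ hσ (m + 1) (by omega) h0 with hι
  set c : ℕ → K := fun k => ∑ a ∈ Finset.range k, (D.χ D.g : K)⁻¹ ^ a with hc
  have hyX : D.yEnd X ^ (m + 1) = 0 := D.yEnd_pow_M_eq_zero σ hσ (m + 1) _
  -- The summand of length j + 1 is the longest possible: y^j = 0 on X, and y moves the second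
  -- factor at most once.
  have hyT : D.yEnd (X.tensor (D.M2 h2)) ^ (m + 1 + 1) = 0 := by
    rw [← LinearMap.ker_eq_top]
    refine D.submodule_eq_top_of_e2 h2 _ fun x k => ?_
    rw [LinearMap.mem_ker]
    fin_cases k
    · refine (D.yEnd_pow_tmul_e2_zero h2 X (m + 1) x).trans ?_
      rw [pow_succ, mul_eq_zero_of_left hyX, hyX]
      simp
    · refine (D.yEnd_pow_tmul_e2_one h2 X (m + 1 + 1) x).trans ?_
      rw [pow_succ (D.yEnd X), mul_eq_zero_of_left hyX]
      simp
  have hyj : ∀ v, (D.yEnd (X.tensor (D.M2 h2)) ^ (m + 1)) (D.toT _ _ (ι v ⊗ₜ D.e2 h2 0)) =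
      c (m + 1) • D.toT X (D.M2 h2) ((D.yEnd X ^ m) (ι v) ⊗ₜ D.e2 h2 1) := fun v => by
    rw [yEnd_pow_tmul_e2_zero, hyX, LinearMap.zero_apply, TensorProduct.zero_tmul, map_zero, zero_add]
  have hcm : c (m + 1) ≠ 0 := D.geom_sum_ne_zero h0 (by omega)
  -- `f 0` is equivariant on V and will generate M(j+1, V); `f 1` is equivariant for V ⊗ χ⁻¹ and
  -- will generate the complement.
  let f : Fin 2 → V →ₗ[K] X.tensor (D.M2 h2) := fun k =>
    (D.toT X (D.M2 h2)).toLinearMap ∘ₗ (TensorProduct.mk K X (D.M2 h2)).flip (D.e2 h2 k) ∘ₗ ι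
  have hf : ∀ k v, f k v = D.toT X (D.M2 h2) (ι v ⊗ₜ D.e2 h2 k) := fun _ _ => rfl
  have hfa : ∀ k a v, D.rep (X.tensor (D.M2 h2)) a (f k v) =
      ((D.χ a : K)⁻¹ ^ (k : ℕ)) • f k (σ a v) := fun k a v => by
    rw [hf, hf, rep_toT_tmul, rep_e2, TensorProduct.tmul_smul, map_smul, ← inclM_equivariant]
  obtain ⟨C, e, he⟩ := D.exists_directSum_M σ hσ (Nat.succ_pos (m + 1)) hj hyT (f 0)
    (fun a v => by rw [hfa]; simp) (fun v hv => by
      -- y^j(v ⊗ e_0) is a q-integer times y^(j−1)v ⊗ e_1. The q-integer is nonzero since 0 < j < n,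
      -- so vanishing forces y^(j−1) v = 0 and then v = 0.
      have h1 : m + 1 + 1 - 1 = m + 1 := rfl
      rw [hf, h1, hyj, smul_eq_zero_iff_right hcm, LinearEquiv.map_eq_zero_iff] at hv
      have hm : D.toM σ hσ (m + 1) (by omega) (Pi.single ⟨m, by omega⟩ v) = 0 :=
        (D.toM_single σ hσ (m + 1) _ ⟨m, by omega⟩ v).trans
          (eq_zero_of_tmul_eq_zero _ (D.e2Coord_one h2) hv)
      exact (Pi.single_eq_zero_iff).mp ((LinearEquiv.map_eq_zero_iff _).mp hm))
  refine ⟨C, ⟨e⟩, ?_⟩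
  let π : X.tensor (D.M2 h2) →ₗ[D.H] C :=
    LinearMap.snd D.H _ C ∘ₗ (D.toS _ C).symm.toLinearMap ∘ₗ e.toLinearMap
  have hπ0 : ∀ v, π (f 0 v) = 0 := fun v => congrArg Prod.snd (he v)
  have hπs : Function.Surjective π := fun y => ⟨e.symm (D.toS _ C (0, y)), by simp [π]⟩
  have hq : (D.χ D.g : K)⁻¹ ≠ 0 := inv_ne_zero (Units.ne_zero _)
  refine D.nonempty_equiv_M _ _ _ _ (π.restrictScalars K ∘ₗ f 1) (fun a v => ?_) (fun v => ?_)
    (fun S hS h => ?_) ?_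
  · simp only [LinearMap.comp_apply, LinearMap.restrictScalars_apply]
    rw [← hom_rep, hfa, twist_apply, map_smul (f 1), LinearMap.map_smul_of_tower]
    simp
  · simp only [LinearMap.comp_apply, LinearMap.restrictScalars_apply]
    rw [← hom_yEnd_pow, hf, Nat.add_sub_cancel, yEnd_pow_tmul_e2_one]
    -- y^(j−1) of v ⊗ e_1 is proportional to y^j(v ⊗ e_0), and the projection π to C kills v ⊗ e_0.
    have h3 := congrArg π (hyj v)
    rw [hom_yEnd_pow, ← hf, hπ0, map_zero, LinearMap.map_smul_of_tower, eq_comm,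
      smul_eq_zero_iff_right hcm] at h3
    rw [LinearMap.map_smul_of_tower, h3, smul_zero]
  -- The preimage of S is stable under y and contains v ⊗ e_0, killed by π, and v ⊗ e_1. The
  -- formulas for powers of y then put every y^k v ⊗ e_l in it.
  · have hS' : S.comap (π.restrictScalars K) = ⊤ := by
      have hy' : ∀ k, ∀ x ∈ S.comap (π.restrictScalars K),
          (D.yEnd (X.tensor (D.M2 h2)) ^ k) x ∈ S.comap (π.restrictScalars K) := by
        intro k x hx
        induction k with
        | zero => exact hx
        | succ k ih =>
          rw [pow_succ', Module.End.mul_apply, Submodule.mem_comap, LinearMap.restrictScalars_apply,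
            hom_yEnd]
          exact hS _ ih
      have hm1 : ∀ k v, D.toT X (D.M2 h2) ((D.yEnd X ^ k) (ι v) ⊗ₜ D.e2 h2 1) ∈
          S.comap (π.restrictScalars K) := fun k v => by
        have h3 := hy' k (f 1 v) (h v)
        rw [hf, yEnd_pow_tmul_e2_one] at h3
        exact (Submodule.smul_mem_iff _ (pow_ne_zero _ hq)).mp h3
      have hm0 : ∀ k v, D.toT X (D.M2 h2) ((D.yEnd X ^ k) (ι v) ⊗ₜ D.e2 h2 0) ∈
          S.comap (π.restrictScalars K) := fun k v => by
        have hz : f 0 v ∈ S.comap (π.restrictScalars K) := by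
          rw [Submodule.mem_comap, LinearMap.restrictScalars_apply, hπ0]
          exact zero_mem _
        cases k with
        | zero => exact hz
        | succ k =>
          have h3 := hy' (k + 1) _ hz
          rw [hf, yEnd_pow_tmul_e2_zero] at h3
          exact (Submodule.add_mem_iff_left _ (Submodule.smul_mem _ _ (hm1 k v))).mp h3
      refine D.submodule_eq_top_of_e2 h2 _ fun x k => ?_
      obtain ⟨w, rfl⟩ := (D.toM σ hσ (m + 1) (by omega)).surjective x
      rw [D.toM_eq_sum σ hσ (m + 1) _ h0, TensorProduct.sum_tmul, map_sum]
      refine Submodule.sum_mem _ fun l _ => ?_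
      fin_cases k
      · exact hm0 l (w l)
      · exact hm1 l (w l)
    rw [Submodule.eq_top_iff']
    intro y
    obtain ⟨x, rfl⟩ := hπs y
    exact (Submodule.eq_top_iff'.mp hS') x
  -- The dimension count is 2j = (j + 1) + (j − 1).
  · have h4 := (e.restrictScalars K ≪≫ₗ (D.toS _ C).symm.restrictScalars K).finrank_eq
    rw [Module.finrank_prod, finrank_tensor, finrank_M, M2, finrank_M, Module.finrank_self,
      D.finrank_M σ hσ (m + 1 + 1) hj] at h4
    rw [Nat.add_sub_cancel]
    nlinarith

end two

end GroupDatum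

namespace GroupDatum

variable {K : Type u} {G : Type v} [Field K] [Group G] [Finite G] (D : GroupDatum K G)

/-! ### The dimension character of the stable Green ring -/

/-- The sum of the numbers `dim V * [j]` over the indecomposable summands `M(j, V)`. -/
noncomputable def dimFun (X : FDModule K D.H) : ℝ :=
  ∑ j ∈ Finset.Icc 1 (D.n - 1), D.mult (1 : Representation K G K) ∅ j X * quantumInt D.n j

theorem dimFun_congr (hχ : D.χ ^ D.n = 1) {X Y : FDModule K D.H} (h : X.StablyIso Y) :
    D.dimFun X = D.dimFun Y :=
  Finset.sum_congr rfl fun j hj => by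
    have := Finset.mem_Icc.mp hj
    rw [D.mult_congr _ _ j hχ (by omega) h]

theorem dimFun_directSum (X Y : FDModule K D.H) :
    D.dimFun (X.directSum Y) = D.dimFun X + D.dimFun Y := by
  rw [dimFun, dimFun, dimFun, ← Finset.sum_add_distrib]
  exact Finset.sum_congr rfl fun j _ => by rw [mult_directSum, Nat.cast_add, add_mul]

theorem dimFun_subsingleton (Z : FDModule K D.H) [Subsingleton Z] : D.dimFun Z = 0 :=
  Finset.sum_eq_zero fun j _ => by rw [mult_subsingleton, Nat.cast_zero, zero_mul]

theorem cls_eq_of_equiv {X Y : FDModule K D.H} (e : X ≃ₗ[D.H] Y) :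
    StableGreenRing.cls X = StableGreenRing.cls Y :=
  StableGreenRing.cls_eq_of_stablyIso (D.stablyIso_of_equiv e)

section M

variable {V : Type u} [AddCommGroup V] [Module K V] [FiniteDimensional K V]
  (σ : Representation K G V) (hσ : σ (D.g ^ D.n) = 1)

omit [Finite G] in
-- With no equivariance imposed, all linear maps K → V count. Thus `mult` with W = K and S = ∅
-- weighs M(j, V) by dim V, even for V not simple, as occurs for V ⊗ W.
theorem finrank_homSet_empty :
    Module.finrank K (homSet (1 : Representation K G K) ∅ σ) = Module.finrank K V := by
  have h : homSet (1 : Representation K G K) ∅ σ = ⊤ :=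
    Submodule.eq_top_iff'.mpr fun _ _ ha => absurd ha (Set.notMem_empty _)
  rw [h, finrank_top, Module.finrank_linearMap, Module.finrank_self, one_mul]

/-- Only degree j contributes. The boundary values j = 0 and j = n lie outside the sum and are
covered by [0] = [n] = 0. -/
theorem dimFun_M (hn : 2 ≤ D.n) (j : ℕ) (hj : j ≤ D.n) :
    D.dimFun (D.M σ hσ j hj) = Module.finrank K V * quantumInt D.n j := by
  have h0 : ∀ k ∈ Finset.Icc 1 (D.n - 1), k ≠ j →
      D.mult (1 : Representation K G K) ∅ k (D.M σ hσ j hj) * quantumInt D.n k = 0 :=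
    fun k hk hkj => by
      rw [D.mult_M_of_ne _ _ _ _ (Finset.mem_Icc.mp hk).1 hkj.symm, Nat.cast_zero, zero_mul]
  by_cases hj' : j ∈ Finset.Icc 1 (D.n - 1)
  · rw [dimFun, Finset.sum_eq_single_of_mem j hj' h0,
      D.mult_M_self _ _ _ _ (Finset.mem_Icc.mp hj').1, finrank_homSet_empty]
  · rw [dimFun, Finset.sum_eq_zero fun k hk => h0 k hk fun h => hj' (h ▸ hk)]
    rw [Finset.mem_Icc] at hj'
    obtain h | h : j = 0 ∨ j = D.n := by omega
    · rw [h, quantumInt_zero, mul_zero]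
    · rw [h, quantumInt_self hn, mul_zero]

end M

variable {Ω : Type*} [Finite Ω] {V : Ω → Type u} [∀ i, AddCommGroup (V i)] [∀ i, Module K (V i)]
  [∀ i, FiniteDimensional K (V i)] (ρ : ∀ i, Representation K G (V i))
  [IsAlgClosed K] [CharZero K] (hD : D.IsNonNilpotent) (hρ : IsCompleteSimpleSet ρ)

/-- The character of the stable Green ring extending `dimFun`. -/
noncomputable def dimHom : StableGreenRing K D.H →ₗ[ℤ] ℝ :=
  (D.greenBasis ρ hD hρ).constr ℤ fun p => D.dimFun (D.MI ρ p)

theorem dimHom_cls (X : FDModule K D.H) :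
    D.dimHom ρ hD hρ (StableGreenRing.cls X) = D.dimFun X := by
  induction X using D.module_induction ρ hD hρ with
  | hiso X Y h hX => rw [← StableGreenRing.cls_eq_of_stablyIso h, hX, D.dimFun_congr hD.2 h]
  | hzero Z hZ => rw [D.cls_subsingleton, map_zero, dimFun_subsingleton]
  | hsum X Y hX hY => rw [StableGreenRing.cls_directSum, map_add, hX, hY, dimFun_directSum]
  | hM p => rw [← D.greenBasis_apply ρ hD hρ, dimHom, Module.Basis.constr_basis]

/-- The right multiplication by `z` multiplies `dimHom` with its value at `z`, if it does so on the
basis. -/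
theorem dimHom_mul_of_basis (z : StableGreenRing K D.H)
    (h : ∀ (i : Ω) (hi : ρ i (D.g ^ D.n) = 1) (j : ℕ) (_ : 0 < j) (hj : j + 1 ≤ D.n),
      D.dimHom ρ hD hρ (StableGreenRing.cls (D.M (ρ i) hi j (Nat.le_of_succ_le hj)) * z) =
      D.dimHom ρ hD hρ (StableGreenRing.cls (D.M (ρ i) hi j (Nat.le_of_succ_le hj))) *
        D.dimHom ρ hD hρ z)
    (x : StableGreenRing K D.H) :
    D.dimHom ρ hD hρ (x * z) = D.dimHom ρ hD hρ x * D.dimHom ρ hD hρ z := by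
  have : D.dimHom ρ hD hρ ∘ₗ LinearMap.mulRight ℤ z =
      (LinearMap.mulRight ℤ (D.dimHom ρ hD hρ z)) ∘ₗ D.dimHom ρ hD hρ :=
    (D.greenBasis ρ hD hρ).ext fun p => by
      rw [greenBasis_apply]
      exact h p.1.2 p.2.1 p.1.1 p.2.2.1 (D.lt_of_mem_I ρ p)
  exact LinearMap.congr_fun this x

variable (hn : 2 ≤ D.n)

include hn

/-- Tensoring with M(1, W) replaces V by V ⊗ W, so dimensions multiply, and [1] = 1. -/
theorem dimHom_mul_M_one {W : Type u} [AddCommGroup W] [Module K W] [FiniteDimensional K W]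
    (τ : Representation K G W) (hτ : τ (D.g ^ D.n) = 1) (h1 : 1 ≤ D.n)
    (x : StableGreenRing K D.H) :
    D.dimHom ρ hD hρ (x * StableGreenRing.cls (D.M τ hτ 1 h1)) =
      D.dimHom ρ hD hρ x * D.dimHom ρ hD hρ (StableGreenRing.cls (D.M τ hτ 1 h1)) := by
  refine D.dimHom_mul_of_basis ρ hD hρ _ (fun i hi j hj hjn => ?_) x
  have hst : ((ρ i).tprod τ) (D.g ^ D.n) = 1 := by
    rw [Representation.tprod_apply, hi, hτ]
    exact TensorProduct.map_id
  obtain ⟨e⟩ := D.nonempty_equiv_tensor_one (ρ i) hi j (Nat.le_of_succ_le hjn) hj τ hτ hst h1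
  rw [← StableGreenRing.cls_tensor, ← D.cls_eq_of_equiv e, dimHom_cls, dimHom_cls, dimHom_cls,
    D.dimFun_M _ _ hn, D.dimFun_M _ _ hn, D.dimFun_M _ _ hn, quantumInt_one hn,
    Module.finrank_tensorProduct]
  push_cast
  ring

theorem dimHom_mul_M2 (x : StableGreenRing K D.H) :
    D.dimHom ρ hD hρ (x * StableGreenRing.cls (D.M2 hn)) =
      D.dimHom ρ hD hρ x * D.dimHom ρ hD hρ (StableGreenRing.cls (D.M2 hn)) := by
  refine D.dimHom_mul_of_basis ρ hD hρ _ (fun i hi j hj hjn => ?_) x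
  obtain ⟨C, ⟨e⟩, ⟨e'⟩⟩ := D.exists_equiv_tensor_two hn (ρ i) hi hj hjn
  -- This is [2] = 2 cos(π/n).
  have h2 := quantumInt_add D.n 1 one_pos
  rw [quantumInt_one hn, Nat.sub_self, quantumInt_zero, add_zero, mul_one] at h2
  rw [← StableGreenRing.cls_tensor, D.cls_eq_of_equiv e, StableGreenRing.cls_directSum,
    ← D.cls_eq_of_equiv e', map_add, dimHom_cls, dimHom_cls, dimHom_cls, dimHom_cls, M2,
    D.dimFun_M _ _ hn, D.dimFun_M _ _ hn, D.dimFun_M _ _ hn, D.dimFun_M _ _ hn, ← mul_add,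
    quantumInt_add D.n j hj, ← h2, Module.finrank_self]
  push_cast
  ring

/-- Clebsch-Gordan gives [M(j+2, W)] = [M(j+1, W)][M(2, K)] − [M(j, W ⊗ χ⁻¹)], so multiplicativity
propagates from M(1, W) and M(2, K). The twist changes W, hence the induction over all
representations. -/
theorem dimHom_mul_M {W : Type u} [AddCommGroup W] [Module K W] [FiniteDimensional K W]
    (τ : Representation K G W) (hτ : τ (D.g ^ D.n) = 1) (j : ℕ) (hj : j ≤ D.n)
    (x : StableGreenRing K D.H) :
    D.dimHom ρ hD hρ (x * StableGreenRing.cls (D.M τ hτ j hj)) =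
      D.dimHom ρ hD hρ x * D.dimHom ρ hD hρ (StableGreenRing.cls (D.M τ hτ j hj)) := by
  induction j using Nat.strong_induction_on generalizing τ x with
  | _ j ih =>
  match j with
  | 0 =>
    have : Subsingleton (D.M τ hτ 0 hj) := by
      rw [← Module.finrank_zero_iff (R := K), finrank_M, zero_mul]
    rw [D.cls_subsingleton, mul_zero, map_zero, mul_zero]
  | 1 => exact D.dimHom_mul_M_one ρ hD hρ hn τ hτ hj x
  | j + 2 =>
    obtain ⟨C, ⟨e⟩, ⟨e'⟩⟩ := D.exists_equiv_tensor_two hn τ hτ (Nat.succ_pos j) hj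
    have h1 : StableGreenRing.cls (D.M τ hτ (j + 2) hj) =
        StableGreenRing.cls (D.M τ hτ (j + 1) (by omega)) * StableGreenRing.cls (D.M2 hn) -
        StableGreenRing.cls (D.M (D.twist τ) (D.twist_gn τ hτ) j (by omega)) := by
      rw [eq_sub_iff_add_eq, ← StableGreenRing.cls_tensor, D.cls_eq_of_equiv e,
        StableGreenRing.cls_directSum, ← D.cls_eq_of_equiv e']
      rfl
    rw [h1, mul_sub, map_sub, map_sub, ← mul_assoc, dimHom_mul_M2, dimHom_mul_M2,
      ih (j + 1) (by omega), ih j (by omega)]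
    ring

end GroupDatum

/-! ### The Frobenius–Perron dimensions -/

theorem mainTheorem10 {K : Type u} [Field K] [IsAlgClosed K] [CharZero K]
    {G : Type v} [Group G] [Finite G] (D : GroupDatum K G) (hD : D.IsNonNilpotent) (hn : 2 ≤ D.n)
    {Ω : Type*} [Finite Ω] {V : Ω → Type u} [∀ i, AddCommGroup (V i)] [∀ i, Module K (V i)]
    [∀ i, FiniteDimensional K (V i)] (ρ : ∀ i, Representation K G (V i))
    (hρ : IsCompleteSimpleSet ρ) :
    ∃ b : Module.Basis (D.I ρ) ℤ (StableGreenRing K D.H),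
      (∀ p, b p = StableGreenRing.cls (D.MI ρ p)) ∧
      ∀ p : D.I ρ, IsFPdim b (StableGreenRing.cls (D.MI ρ p))
        (Module.finrank K (V p.1.2) * dicksonF p.1.1 1 (2 * Real.cos (Real.pi / D.n))) := by
  refine ⟨D.greenBasis ρ hD hρ, D.greenBasis_apply ρ hD hρ, fun p => ?_⟩
  have hdim : ∀ q : D.I ρ, D.dimHom ρ hD hρ (StableGreenRing.cls (D.MI ρ q)) =
      Module.finrank K (V q.1.2) * quantumInt D.n q.1.1 := fun q => by
    rw [D.dimHom_cls]
    exact D.dimFun_M _ _ hn _ _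
  have : Nonempty (D.I ρ) := ⟨p⟩
  -- The claimed value is d evaluated at the class itself, so the eigenvalue equation is
  -- multiplicativity of d.
  rw [← quantumInt_eq_dicksonF hn p.2.2.1, ← hdim p]
  refine isFPdim_of_functional _ _ _ (D.dimHom ρ hD hρ) (fun q => ?_) (fun q => ?_) fun q r => ?_
  · rw [D.greenBasis_apply]
    exact D.dimHom_mul_M ρ hD hρ hn _ _ _ _ _
  · rw [D.greenBasis_apply, hdim]
    exact mul_pos (Nat.cast_pos.mpr (hρ.finrank_pos q.1.2))
      (quantumInt_pos q.2.2.1 (D.lt_of_mem_I ρ q))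
  · rw [D.greenBasis_apply, ← StableGreenRing.cls_tensor, D.greenBasis_repr, D.multHom_cls,
      D.multI_apply]
    exact Nat.cast_nonneg _
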